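/- A subset $A$ of an abelian group is called sum-free if there are no $x,y,z\in A$ (not necessarily distinct) with $x+y=z$. For a finite abelian group $G$, let $\mathrm{sf}_0(G)$ be the maximum cardinality of a sum-free subset of $G$, and let $\mathrm{sf}_1(G)$ be the largest cardinality of a sum-free subset of $G$ that is not contained in any sum-free subset of $G$ of cardinality $\mathrm{sf}_0(G)$. A sum-free set $A\subseteq\mathbb F_5^n$ is called normal if $A\subseteq H\cup(-H)$ for some affine hyperplane $H\subseteq\mathbb F_5^n$ not containing $0$. Let $$\Lambda=\bigl(\{(1,0),(-1,0),(0,1),(0,-1)\}\times\mathbb F_5\bigr)\cup\{(-1,2,0),(-1,2,1),(2,1,1),(2,1,2),(1,-2,0),(1,-2,-1),(-2,-1,-1),(-2,-1,-2)\}\subseteq\mathbb F_5^3 .$$ For $n\ge 3$, a subset of $\mathbb F_5^n$ is called a VL-set if it is the image of $\Lambda\times\mathbb F_5^{n-3}\subseteq\mathbb F_5^n$ under a linear automorphism of $\mathbb F_5^n$. **Theorem.** For every integer $n\ge 3$ we have $\mathrm{sf}_1(\mathbb F_5^n)=28\cdot 5^{n-3}$. Moreover, every sum-free set $A\subseteq\mathbb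 F_5^n$ with $|A|\ge 28\cdot 5^{n-3}$ is either normal or a VL-set. -/

import Mathlib

namespace SumFreeSets

/-- A subset `A` of an abelian group is sum-free if there are no solutions of `x + y = z` with
`x, y, z ∈ A` (the case `x = y` is included). -/
def IsSumFree {G : Type*} [AddCommGroup G] (A : Finset G) : Prop :=
  ∀ x ∈ A, ∀ y ∈ A, ∀ z ∈ A, x + y ≠ z

open Classical in
/-- `sf₀(G)`: the maximum cardinality of a sum-free subset of the finite abelian group `G`. -/
noncomputable def sf0 (G : Type*) [AddCommGroup G] [Fintype G] : ℕ :=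
  (Finset.univ.filter fun A : Finset G => IsSumFree A).sup Finset.card

/-- `A` is a sum-free subset of `G` of maximum cardinality. -/
def IsMaximumSumFree {G : Type*} [AddCommGroup G] [Fintype G] (A : Finset G) : Prop :=
  IsSumFree A ∧ A.card = sf0 G

open Classical in
/-- `sf₁(G)`: the largest cardinality of a sum-free subset of `G` that is not contained in any
sum-free subset of `G` of maximum cardinality (`0` if there is no such set). -/
noncomputable def sf1 (G : Type*) [AddCommGroup G] [Fintype G] : ℕ :=
  (Finset.univ.filter fun A : Finset G =>
    IsSumFree A ∧ ∀ B : Finset G, IsMaximumSumFree B → ¬ A ⊆ B).sup Finset.card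

/-- An affine hyperplane: a nonempty affine subspace of codimension one. -/
def IsAffineHyperplane {n : ℕ} (H : AffineSubspace (ZMod 5) (Fin n → ZMod 5)) : Prop :=
  (H : Set (Fin n → ZMod 5)).Nonempty ∧ Module.finrank (ZMod 5) H.direction + 1 = n

/-- `A ⊆ 𝔽₅ⁿ` is normal: it is contained in `H ∪ (-H)` for some affine hyperplane `H` that does
not contain the origin. (Used for sum-free sets `A`.) -/
def IsNormal {n : ℕ} (A : Finset (Fin n → ZMod 5)) : Prop :=
  ∃ H : AffineSubspace (ZMod 5) (Fin n → ZMod 5),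
    IsAffineHyperplane H ∧ (0 : Fin n → ZMod 5) ∉ H ∧ ∀ x ∈ A, x ∈ H ∨ -x ∈ H

/-- Two subsets of `𝔽₅ⁿ` are isomorphic if an automorphism of `𝔽₅ⁿ` maps one onto the other. -/
def IsIsomorphic {n : ℕ} (A B : Set (Fin n → ZMod 5)) : Prop :=
  ∃ e : (Fin n → ZMod 5) ≃ₗ[ZMod 5] (Fin n → ZMod 5), e '' A = B

/-- The set `Λ ⊆ 𝔽₅³` of Lev and Versteegen. -/
def Lam : Set (Fin 3 → ZMod 5) :=
  {v | ∃ z : ZMod 5, v = ![1, 0, z] ∨ v = ![-1, 0, z] ∨ v = ![0, 1, z] ∨ v = ![0, -1, z]} ∪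
  {![-1, 2, 0], ![-1, 2, 1], ![2, 1, 1], ![2, 1, 2],
    ![1, -2, 0], ![1, -2, -1], ![-2, -1, -1], ![-2, -1, -2]}

/-- `Λ × 𝔽₅ⁿ⁻³`, as a subset of `𝔽₅ⁿ`: the vectors whose first three coordinates form an element
of `Λ`. -/
def LamCylinder {n : ℕ} (hn : 3 ≤ n) : Set (Fin n → ZMod 5) :=
  {x | (fun i : Fin 3 => x (Fin.castLE hn i)) ∈ Lam}

/-- A VL-set in `𝔽₅ⁿ`, `n ≥ 3`: a set isomorphic to `Λ × 𝔽₅ⁿ⁻³`. -/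
def IsVLSet {n : ℕ} (hn : 3 ≤ n) (A : Finset (Fin n → ZMod 5)) : Prop :=
  IsIsomorphic (LamCylinder hn) (A : Set (Fin n → ZMod 5))

end SumFreeSets

/-! The proof is an induction on the dimension n ≥ 1 of the following classification (`Classified`):
a sum-free set A of density at least 28/125 in V = 𝔽₅ⁿ either lies in {χ = ±1} for a linear
functional χ, or is the preimage of Λ under a linear surjection. The value of sf₁ follows, because
the sets {χ = ±1} with χ ≠ 0 are exactly large enough to be maximum sum-free sets and Λ lies in none
of them.

Let n ≥ 2 and |V| = 25N. Such an A contains an antipodal pair x, -x: in the plane by a finite check,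
in higher dimension because averaging over the hyperplanes through a point of A gives a section to
which the induction hypothesis applies, and a normal section without antipodal pair is too small
(`Classified.exists_antipodal`). Averaging over the hyperplanes through x, whose line now carries
two points of A, gives a section of density strictly above 28/125. Hence the densest section {ξ = 0}
is normal, say with η = ±1 on it, and (ξ, η) projects V onto a plane (`Pivot`).

Let f(x, y) be the density of A in the fiber over (x, y). Kneser's theorem for fibers over points u,
v, u + v shows that the three sets together meet at most t + 1 cosets of some subgroup of index t,
with t ≥ 5 a power of 5 (`KneserTriple`). For two neighbours (x, y), (x, y + 1) of a row, the set of
forbidden differences is the dense fiber of A ∪ -A over (0, 1), and maximality of the section {ξ =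
0} makes it meet at least four cosets if t = 5 (`Pivot.four_le_cosets_axis`).

Averaging f over opposite points leaves ten densities, U c on ±(1, c) and W c on ±(2, 2c). With M
the mean of f over (0, 1) and (0, -1), the size of A says ΣU + ΣW ≥ 14/5 - M. The Kneser bounds
become `ClassRules`, with a bound σ for neighbours that depends on M. A discussion of the supports,
seen as subsets of a 5-cycle, leaves the support of a normal set and a few borderline configurations
(`Exceptional`). Those with M = 4/5 are refuted by the rigid structure of A on {ξ = 0}
(`Pivot.not_full`, `Pivot.not_path`); the last one has M = 1 and determines Λ (`Pivot.vlPreimage`).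
-/

namespace SumFreeSets

open Finset

set_option linter.unusedVariables false
set_option linter.unusedSectionVars false

/-! ### Kneser's theorem for finite abelian groups -/

section Kneser

open scoped Pointwise

/-- The stabilizer of a finite set under translation. -/
abbrev stab {G : Type*} [AddCommGroup G] [DecidableEq G] (C : Finset G) : AddSubgroup G :=
  AddAction.stabilizer G C

theorem mem_stab {G : Type*} [AddCommGroup G] [DecidableEq G] {C : Finset G} {g : G} :
    g ∈ stab C ↔ ∀ c ∈ C, g + c ∈ C := by
  rw [AddAction.mem_stabilizer_iff]
  constructor
  · intro h c hc
    rw [← h]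
    exact Finset.vadd_mem_vadd_finset hc
  · intro h
    apply Finset.eq_of_subset_of_card_le
    · intro x hx
      obtain ⟨c, hc, rfl⟩ := Finset.mem_vadd_finset.1 hx
      exact h c hc
    · rw [Finset.card_vadd_finset]

theorem card_le_natCard_of_subset {G : Type*} [AddCommGroup G] [Finite G] {S : Finset G} {H : AddSubgroup G} (h : ∀ x ∈ S, x ∈ H) :
    #S ≤ Nat.card H := by
  rw [← Set.ncard_coe_finset]
  exact Set.ncard_le_ncard (t := (H : Set G)) (fun x hx => h x hx) (Set.toFinite _)

theorem natCard_le_card_of_subset {G : Type*} [AddCommGroup G] [Finite G] {S : Finset G} {H : AddSubgroup G} (h : ∀ x ∈ H, x ∈ S) :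
    Nat.card H ≤ #S := by
  rw [← Set.ncard_coe_finset]
  exact Set.ncard_le_ncard (s := (H : Set G)) (fun x hx => h x hx) (Set.toFinite _)

variable {G : Type*} [AddCommGroup G] [Fintype G] [DecidableEq G]

/-- Dyson's e-transform. For e ∈ A with e + B ⊄ A, passing to A ∪ (e + B) and {b ∈ B : e + b ∈ A}
preserves |A| + |B|, keeps 0 in the second set, does not enlarge the sumset and shrinks B. If there
is no such e, then B lies in the stabilizer of A and C = A works. -/
theorem exists_subset_add_card_stab_of_zero_mem (k : ℕ) :
    ∀ (A B : Finset G), #B ≤ k → (0 : G) ∈ B → ∀ a ∈ A,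
      ∃ C ⊆ A + B, a ∈ C ∧ #A + #B ≤ #C + Nat.card (stab C) := by
  induction k with
  | zero =>
    intro A B hB h0
    rw [Nat.le_zero, Finset.card_eq_zero] at hB
    simp [hB] at h0
  | succ k ih =>
    intro A B hB h0 a ha
    by_cases h : ∀ e ∈ A, ∀ b ∈ B, e + b ∈ A
    · refine ⟨A, fun x hx => ?_, ha, ?_⟩
      · simpa using Finset.add_mem_add hx h0
      · have : #B ≤ Nat.card (stab A) := by
          apply card_le_natCard_of_subset
          intro b hb
          rw [mem_stab]
          intro c hc
          rw [add_comm]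
          exact h c hc b hb
        omega
    · push Not at h
      obtain ⟨e, he, b₀, hb₀, hne⟩ := h
      have hcard : #(A ∪ (e +ᵥ B)) + #(B.filter fun b => e + b ∈ A) = #A + #B := by
        have h1 : #(B.filter fun b => e + b ∈ A) = #(A ∩ (e +ᵥ B)) := by
          rw [← Finset.card_vadd_finset e (B.filter fun b => e + b ∈ A)]
          congr 1
          ext x
          simp only [Finset.mem_vadd_finset, Finset.mem_filter, Finset.mem_inter, vadd_eq_add]
          constructor
          · rintro ⟨y, ⟨hy, hy'⟩, rfl⟩
            exact ⟨hy', y, hy, rfl⟩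
          · rintro ⟨hx, y, hy, rfl⟩
            exact ⟨y, ⟨hy, hx⟩, rfl⟩
        rw [h1, Finset.card_union_add_card_inter, Finset.card_vadd_finset]
      have hlt : #(B.filter fun b => e + b ∈ A) < #B := by
        apply Finset.card_lt_card
        rw [Finset.ssubset_iff_of_subset (Finset.filter_subset _ _)]
        exact ⟨b₀, hb₀, by simp [hne]⟩
      obtain ⟨C, hC, haC, hc⟩ :=
        ih (A ∪ (e +ᵥ B)) (B.filter fun b => e + b ∈ A) (by omega) (by simp [h0, he]) a
          (Finset.mem_union_left _ ha)
      · refine ⟨C, hC.trans ?_, haC, by omega⟩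
        intro x hx
        obtain ⟨y, hy, z, hz, rfl⟩ := Finset.mem_add.1 hx
        obtain ⟨hz1, hz2⟩ := Finset.mem_filter.1 hz
        rcases Finset.mem_union.1 hy with hy | hy
        · exact Finset.add_mem_add hy hz1
        · obtain ⟨b, hb, rfl⟩ := Finset.mem_vadd_finset.1 hy
          have : (e +ᵥ b) + z = (e + z) + b := by rw [vadd_eq_add]; abel
          rw [this]
          exact Finset.add_mem_add hz2 hb

theorem exists_subset_add_card_stab (A B : Finset G) {a b : G} (ha : a ∈ A) (hb : b ∈ B) :
    ∃ C ⊆ A + B, a + b ∈ C ∧ #A + #B ≤ #C + Nat.card (stab C) := by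
  obtain ⟨C, hC, haC, hc⟩ := exists_subset_add_card_stab_of_zero_mem #B (b +ᵥ A) (-b +ᵥ B)
    (by rw [Finset.card_vadd_finset])
    (Finset.mem_vadd_finset.2 ⟨b, hb, by simp⟩) (b + a) (Finset.mem_vadd_finset.2 ⟨a, ha, rfl⟩)
  refine ⟨C, ?_, by rwa [add_comm], by simpa only [Finset.card_vadd_finset] using hc⟩
  refine hC.trans fun x hx => ?_
  obtain ⟨y, hy, z, hz, rfl⟩ := Finset.mem_add.1 hx
  obtain ⟨a', ha', rfl⟩ := Finset.mem_vadd_finset.1 hy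
  obtain ⟨b', hb', rfl⟩ := Finset.mem_vadd_finset.1 hz
  have : (b +ᵥ a') + (-b +ᵥ b') = a' + b' := by simp only [vadd_eq_add]; abel
  rw [this]
  exact Finset.add_mem_add ha' hb'

/-- Two representations g + x + y of the same value differ by an element of H₁ ∩ H₂, so the addition
map on S₁ × S₂ has fibers of at most |H₁ ∩ H₂| elements. -/
theorem card_mul_card_le_of_add_mem {H₁ H₂ : AddSubgroup G} {S₁ S₂ T : Finset G} {g : G}
    (h₁ : ∀ x ∈ S₁, x ∈ H₁) (h₂ : ∀ x ∈ S₂, x ∈ H₂)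
    (h : ∀ x ∈ S₁, ∀ y ∈ S₂, g + x + y ∈ T) :
    #S₁ * #S₂ ≤ Nat.card (H₁ ⊓ H₂ : AddSubgroup G) * #T := by
  rw [← Finset.card_product]
  apply Finset.card_le_mul_card_image_of_maps_to (f := fun p : G × G => g + p.1 + p.2)
  · rintro ⟨x, y⟩ hp
    rw [Finset.mem_product] at hp
    exact h x hp.1 y hp.2
  · intro b _
    rcases Finset.eq_empty_or_nonempty ((S₁ ×ˢ S₂).filter fun p : G × G => g + p.1 + p.2 = b)
      with he | ⟨⟨x₀, y₀⟩, h0⟩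
    · simp [he]
    · rw [Finset.mem_filter, Finset.mem_product] at h0
      rw [← Finset.card_image_of_injOn (f := fun p : G × G => p.1 - x₀)]
      · apply card_le_natCard_of_subset
        intro z hz
        obtain ⟨⟨x, y⟩, hp, rfl⟩ := Finset.mem_image.1 hz
        rw [Finset.mem_filter, Finset.mem_product] at hp
        refine ⟨H₁.sub_mem (h₁ _ hp.1.1) (h₁ _ h0.1.1), ?_⟩
        have e : x - x₀ = y₀ - y := by
          have := hp.2.trans h0.2.symm
          simp only at this
          rw [sub_eq_sub_iff_add_eq_add]
          have h3 : g + (x + y) = g + (x₀ + y₀) := by simpa only [add_assoc] using this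
          rw [add_left_cancel h3, add_comm]
        simp only [e]
        exact H₂.sub_mem (h₂ _ h0.1.2) (h₂ _ hp.1.2)
      · rintro ⟨x, y⟩ hp ⟨x', y'⟩ hp' hxx
        simp only [Finset.coe_filter, Finset.mem_product, Set.mem_ofPred_eq] at hp hp'
        have hx : x = x' := sub_left_injective hxx
        subst hx
        have : g + x + y = g + x + y' := hp.2.trans hp'.2.symm
        rw [add_left_cancel this]

/-- The numerical part of `grid_step`. The alternative h1 < h2 is harmless: it disappears when the
statement is used a second time with the two sets exchanged. -/
theorem grid_arith {h h1 h2 x y d1 d2 : ℕ} (hy : h + y ≤ h1) (hx : h ≤ x) (hx2 : x ≤ h2)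
    (hy' : y = 0 ∨ h ≤ y) (hx' : x = h2 ∨ h + x ≤ h2) (hpos : 0 < h)
    (e1 : (h1 - y) * x ≤ h * d1) (e2 : y * (h2 - x) ≤ h * d2) :
    h2 ≤ d1 + h ∨ h1 ≤ d2 + h ∨ h1 < h2 := by
  obtain ⟨a, rfl⟩ := Nat.exists_eq_add_of_le (show y ≤ h1 by omega)
  obtain ⟨b, rfl⟩ := Nat.exists_eq_add_of_le hx2
  rw [Nat.add_sub_cancel_left] at e1 e2
  have ha : h ≤ a := by omega
  rcases hx' with hx' | hx'
  · left
    have hb : b = 0 := by omega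
    subst hb
    have : h * x ≤ h * d1 := (Nat.mul_le_mul_right x ha).trans e1
    have := Nat.le_of_mul_le_mul_left this hpos
    omega
  · rcases hy' with rfl | hy'
    · by_cases hlt : 0 + a < x + b
      · exact Or.inr (Or.inr hlt)
      · left
        have : a * h ≤ a * x := Nat.mul_le_mul_left a hx
        have : h * a ≤ h * d1 := by linarith [mul_comm a h]
        have := Nat.le_of_mul_le_mul_left this hpos
        omega
    · by_contra hcon
      push Not at hcon
      obtain ⟨c1, c2, c3⟩ := hcon
      zify at *
      have hb : (h : ℤ) ≤ b := by linarith
      nlinarith [mul_nonneg (sub_nonneg.2 ha) (sub_nonneg.2 hx),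
        mul_nonneg (sub_nonneg.2 hy') (sub_nonneg.2 hb)]

/-- C₁ is a union of cosets of H₁ and C₂ of H₂. Let X be the trace of C₁ on g + H₂ and Y that of C₂
on g + H₁, both translated by -g. Sums from H₁ \ Y and X land in C₁ \ C₂, sums from Y and H₂ \ X in
C₂ \ C₁, which bounds both differences from below. -/
theorem grid_step (C₁ C₂ : Finset G) {g : G} (hg₁ : g ∈ C₁) (hg₂ : g ∉ C₂) :
    Nat.card (stab C₂) ≤ #(C₁ \ C₂) + Nat.card (stab C₁ ⊓ stab C₂ : AddSubgroup G) ∨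
    Nat.card (stab C₁) ≤ #(C₂ \ C₁) + Nat.card (stab C₁ ⊓ stab C₂ : AddSubgroup G) ∨
    Nat.card (stab C₁) < Nat.card (stab C₂) := by
  classical
  set H₁ := stab C₁ with hH₁
  set H₂ := stab C₂ with hH₂
  let T₁ : Finset G := univ.filter fun x => x ∈ H₁
  let T₂ : Finset G := univ.filter fun x => x ∈ H₂
  let T : Finset G := univ.filter fun x => x ∈ H₁ ∧ x ∈ H₂
  have cT₁ : #T₁ = Nat.card H₁ := le_antisymm (card_le_natCard_of_subset (by simp [T₁]))
    (natCard_le_card_of_subset (by simp [T₁]))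
  have cT₂ : #T₂ = Nat.card H₂ := le_antisymm (card_le_natCard_of_subset (by simp [T₂]))
    (natCard_le_card_of_subset (by simp [T₂]))
  have cT : #T = Nat.card (H₁ ⊓ H₂ : AddSubgroup G) :=
    le_antisymm (card_le_natCard_of_subset (by simp [T, AddSubgroup.mem_inf]))
    (natCard_le_card_of_subset (by simp [T, AddSubgroup.mem_inf]))
  let X := T₂.filter fun x => g + x ∈ C₁
  let Y := T₁.filter fun x => g + x ∈ C₂
  have hX2 : X ⊆ T₂ := Finset.filter_subset _ _
  have hY1 : Y ⊆ T₁ := Finset.filter_subset _ _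
  have s1 : ∀ {x c}, x ∈ H₁ → c ∈ C₁ → c + x ∈ C₁ := fun hx hc => by
    rw [add_comm]; exact mem_stab.1 hx _ hc
  have s2 : ∀ {x c}, x ∈ H₂ → c ∈ C₂ → c + x ∈ C₂ := fun hx hc => by
    rw [add_comm]; exact mem_stab.1 hx _ hc
  have s1' : ∀ {x c}, x ∈ H₁ → c + x ∈ C₁ → c ∈ C₁ := fun hx hc => by
    simpa using s1 (H₁.neg_mem hx) hc
  have s2' : ∀ {x c}, x ∈ H₂ → c + x ∈ C₂ → c ∈ C₂ := fun hx hc => by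
    simpa using s2 (H₂.neg_mem hx) hc
  have e1 : (#T₁ - #Y) * #X ≤ #T * #(C₁ \ C₂) := by
    rw [← Finset.card_sdiff_of_subset hY1, cT]
    apply card_mul_card_le_of_add_mem (H₁ := H₁) (H₂ := H₂) (g := g)
    · intro x hx; simp only [mem_sdiff] at hx; simpa [T₁] using hx.1
    · intro x hx; simpa [T₂] using hX2 hx
    · intro x hx y hy
      simp only [mem_sdiff, Y, X, T₁, T₂, mem_filter, mem_univ, true_and, not_and] at hx hy ⊢
      refine ⟨?_, fun hc => hx.2 hx.1 (s2' hy.1 hc)⟩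
      rw [add_right_comm]
      exact s1 hx.1 hy.2
  have e2 : #Y * (#T₂ - #X) ≤ #T * #(C₂ \ C₁) := by
    rw [← Finset.card_sdiff_of_subset hX2, cT]
    apply card_mul_card_le_of_add_mem (H₁ := H₁) (H₂ := H₂) (g := g)
    · intro x hx; simpa [T₁] using hY1 hx
    · intro x hx; simp only [mem_sdiff] at hx; simpa [T₂] using hx.1
    · intro x hx y hy
      simp only [mem_sdiff, Y, X, T₁, T₂, mem_filter, mem_univ, true_and, not_and] at hx hy ⊢
      refine ⟨s2 hy.1 hx.2, fun hc => hy.2 hy.1 (s1' hx.1 ?_)⟩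
      rwa [add_right_comm]
  have per : ∀ {Z : Finset G} {z : G}, z ∈ Z → (∀ x ∈ T, z + x ∈ Z) → #T ≤ #Z := by
    intro Z z _ h
    rw [← Finset.card_vadd_finset z T]
    apply Finset.card_le_card
    intro w hw
    obtain ⟨x, hx, rfl⟩ := Finset.mem_vadd_finset.1 hw
    exact h x hx
  have memT : ∀ {x}, x ∈ T ↔ x ∈ H₁ ∧ x ∈ H₂ := by simp [T]
  have f1 : #T + #Y ≤ #T₁ := by
    have : #T ≤ #(T₁ \ Y) := by
      apply per (z := 0)
      · simp [T₁, Y, H₁.zero_mem, hg₂]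
      · intro x hx
        rw [memT] at hx
        simp only [mem_sdiff, Y, T₁, mem_filter, mem_univ, true_and, zero_add, hx.1]
        exact fun hc => hg₂ (s2' hx.2 hc)
    rw [Finset.card_sdiff_of_subset hY1] at this
    have := Finset.card_le_card hY1
    omega
  have f2 : #T ≤ #X := by
    apply per (z := 0)
    · simp [X, T₂, H₂.zero_mem, hg₁]
    · intro x hx
      rw [memT] at hx
      simp only [X, T₂, mem_filter, mem_univ, true_and, zero_add]
      exact ⟨hx.2, s1 hx.1 hg₁⟩
  have f3 : #Y = 0 ∨ #T ≤ #Y := by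
    rcases Y.eq_empty_or_nonempty with h | ⟨z, hz⟩
    · left; rw [h]; rfl
    · right
      apply per hz
      intro x hx
      rw [memT] at hx
      simp only [Y, T₁, mem_filter, mem_univ, true_and] at hz ⊢
      refine ⟨H₁.add_mem hz.1 hx.1, ?_⟩
      rw [← add_assoc]
      exact s2 hx.2 hz.2
  have f4 : #X = #T₂ ∨ #T + #X ≤ #T₂ := by
    rcases (T₂ \ X).eq_empty_or_nonempty with h | ⟨z, hz⟩
    · left
      exact congrArg card (hX2.antisymm (Finset.sdiff_eq_empty_iff_subset.1 h))
    · right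
      have : #T ≤ #(T₂ \ X) := by
        apply per hz
        intro x hx
        rw [memT] at hx
        simp only [X, T₂, mem_sdiff, mem_filter, mem_univ, true_and, not_and] at hz ⊢
        refine ⟨H₂.add_mem hz.1 hx.2, fun _ hc => hz.2 hz.1 (s1' hx.1 ?_)⟩
        rwa [add_assoc]
      rw [Finset.card_sdiff_of_subset hX2] at this
      have := Finset.card_le_card hX2
      omega
  have hpos : 0 < #T := Finset.card_pos.2 ⟨0, memT.2 ⟨H₁.zero_mem, H₂.zero_mem⟩⟩
  rw [← cT, ← cT₁, ← cT₂]
  exact grid_arith f1 f2 (Finset.card_le_card hX2) f3 f4 hpos e1 e2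

theorem inf_stab_le_stab_union {G : Type*} [AddCommGroup G] [DecidableEq G] (C₁ C₂ : Finset G) : stab C₁ ⊓ stab C₂ ≤ stab (C₁ ∪ C₂) := by
  intro x hx
  rw [mem_stab]
  intro c hc
  rcases Finset.mem_union.1 hc with hc | hc
  · exact Finset.mem_union_left _ (mem_stab.1 hx.1 _ hc)
  · exact Finset.mem_union_right _ (mem_stab.1 hx.2 _ hc)

/-- The elements gained in the union, at least |stab C₂| - |stab C₁ ∩ stab C₂| or the same with
indices exchanged, make up for the loss of stabilizer. -/
theorem le_card_union_add_card_stab {C₁ C₂ : Finset G} {n : ℕ}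
    (h₁ : n ≤ #C₁ + Nat.card (stab C₁)) (h₂ : n ≤ #C₂ + Nat.card (stab C₂)) :
    n ≤ #(C₁ ∪ C₂) + Nat.card (stab (C₁ ∪ C₂)) := by
  by_cases s12 : C₁ ⊆ C₂
  · rwa [Finset.union_eq_right.2 s12]
  by_cases s21 : C₂ ⊆ C₁
  · rwa [Finset.union_eq_left.2 s21]
  obtain ⟨g, hg1, hg2⟩ := Finset.not_subset.1 s12
  obtain ⟨g', hg1', hg2'⟩ := Finset.not_subset.1 s21
  have k1 := grid_step C₁ C₂ hg1 hg2
  have k2 := grid_step C₂ C₁ hg1' hg2'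
  rw [inf_comm (stab C₂)] at k2
  have hle : Nat.card (stab C₁ ⊓ stab C₂ : AddSubgroup G) ≤ Nat.card (stab (C₁ ∪ C₂)) :=
    AddSubgroup.card_le_of_le (inf_stab_le_stab_union C₁ C₂)
  have e1 : #(C₁ ∪ C₂) = #(C₁ \ C₂) + #C₂ := by
    rw [← Finset.sdiff_union_self_eq_union, Finset.card_union_of_disjoint Finset.sdiff_disjoint]
  have e2 : #(C₁ ∪ C₂) = #(C₂ \ C₁) + #C₁ := by
    rw [Finset.union_comm, ← Finset.sdiff_union_self_eq_union,
      Finset.card_union_of_disjoint Finset.sdiff_disjoint]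
  omega

/-- A form of Kneser's theorem. -/
theorem card_add_card_le_card_add_card_stab {A B : Finset G} (hA : A.Nonempty)
    (hB : B.Nonempty) : #A + #B ≤ #(A + B) + Nat.card (stab (A + B)) := by
  choose! C hC using fun p : G × G => fun hp : p ∈ A ×ˢ B =>
    exists_subset_add_card_stab A B (Finset.mem_product.1 hp).1 (Finset.mem_product.1 hp).2
  -- A + B is the union of the sets C attached to its single sums, and the inequality is stable
  -- under unions.
  have key : ∀ S : Finset (G × G), S.Nonempty → S ⊆ A ×ˢ B →
      #A + #B ≤ #(S.biUnion C) + Nat.card (stab (S.biUnion C)) := by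
    intro S hS
    induction hS using Finset.Nonempty.cons_induction with
    | singleton p =>
      intro h
      rw [Finset.singleton_biUnion]
      exact (hC p (h (Finset.mem_singleton_self p))).2.2
    | cons p S hp hS ih =>
      intro h
      rw [Finset.cons_eq_insert, Finset.biUnion_insert]
      exact le_card_union_add_card_stab (hC p (h (Finset.mem_cons_self p S))).2.2
        (ih fun x hx => h (Finset.mem_cons.2 (Or.inr hx)))
  have e : (A ×ˢ B).biUnion C = A + B := by
    apply Finset.Subset.antisymm
    · exact Finset.biUnion_subset.2 fun p hp => (hC p hp).1
    · intro x hx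
      obtain ⟨a, ha, b, hb, rfl⟩ := Finset.mem_add.1 hx
      have hp : (a, b) ∈ A ×ˢ B := Finset.mem_product.2 ⟨ha, hb⟩
      exact Finset.mem_biUnion.2 ⟨(a, b), hp, (hC _ hp).2.1⟩
  rw [← e]
  exact key _ (hA.product hB) (Finset.Subset.refl _)

end Kneser

/-! ### Counting cosets met by a set -/

section Cosets

open scoped Pointwise

variable {G : Type*} [AddCommGroup G] [Fintype G]

/-- The number of cosets of `H` that meet `S`. -/
noncomputable def cosets (H : AddSubgroup G) (S : Finset G) : ℕ :=
  Set.ncard ((QuotientAddGroup.mk : G → G ⧸ H) '' S)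

theorem card_coset_hull (H : AddSubgroup G) (S : Finset G) {T : Finset G}
    (hT : ∀ x, x ∈ T ↔ ∃ s ∈ S, x - s ∈ H) : #T = cosets H S * Nat.card H := by
  classical
  have himg : cosets H S = #(S.image (QuotientAddGroup.mk : G → G ⧸ H)) := by
    rw [cosets, ← Finset.coe_image, Set.ncard_coe_finset]
  rw [himg]
  rw [Finset.card_eq_sum_card_fiberwise (f := (QuotientAddGroup.mk : G → G ⧸ H))
    (t := S.image QuotientAddGroup.mk)]
  · apply Finset.sum_const_nat
    intro q hq
    obtain ⟨s, hs, rfl⟩ := Finset.mem_image.1 hq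
    have : (T.filter fun x : G => (QuotientAddGroup.mk x : G ⧸ H) = QuotientAddGroup.mk s) =
        (s +ᵥ (univ.filter fun x : G => x ∈ H) : Finset G) := by
      ext x
      simp only [mem_filter, hT, Finset.mem_vadd_finset, mem_univ, true_and, vadd_eq_add]
      constructor
      · rintro ⟨-, hx⟩
        refine ⟨x - s, ?_, add_sub_cancel _ _⟩
        rw [QuotientAddGroup.eq_iff_sub_mem] at hx
        exact hx
      · rintro ⟨y, hy, rfl⟩
        refine ⟨⟨s, hs, by simpa using hy⟩, ?_⟩
        rw [QuotientAddGroup.eq_iff_sub_mem]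
        simpa using hy
    rw [this, Finset.card_vadd_finset]
    exact le_antisymm (card_le_natCard_of_subset (by simp)) (natCard_le_card_of_subset (by simp))
  · intro x hx
    obtain ⟨s, hs, hxs⟩ := (hT x).1 hx
    exact Finset.mem_coe.2 (Finset.mem_image.2 ⟨s, hs, ((QuotientAddGroup.eq_iff_sub_mem).2 hxs).symm⟩)

theorem exists_coset_hull (H : AddSubgroup G) (S : Finset G) :
    ∃ T : Finset G, (∀ x, x ∈ T ↔ ∃ s ∈ S, x - s ∈ H) ∧ #T = cosets H S * Nat.card H := by
  classical
  exact ⟨univ.filter fun x => ∃ s ∈ S, x - s ∈ H, by simp, card_coset_hull H S (by simp)⟩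

theorem card_le_cosets_mul (H : AddSubgroup G) (S : Finset G) :
    #S ≤ cosets H S * Nat.card H := by
  obtain ⟨T, hT, hc⟩ := exists_coset_hull H S
  rw [← hc]
  exact Finset.card_le_card fun x hx => (hT x).2 ⟨x, hx, by simp⟩

theorem cosets_pos (H : AddSubgroup G) {S : Finset G} (hS : S.Nonempty) : 0 < cosets H S :=
  (Set.ncard_pos (Set.toFinite _)).2 ⟨_, Set.mem_image_of_mem _ hS.choose_spec⟩

/-- Kneser's theorem for three sets without solutions of `b + c = d` inside cosets of `K`. -/
theorem exists_lt_cosets_add_le (K : AddSubgroup G) {B C D : Finset G} (hB : B.Nonempty)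
    (hC : C.Nonempty) (hD : D.Nonempty) (hBK : ∀ b ∈ B, ∀ b' ∈ B, b - b' ∈ K)
    (hCK : ∀ c ∈ C, ∀ c' ∈ C, c - c' ∈ K) (hDK : ∀ b ∈ B, ∀ c ∈ C, ∀ d ∈ D, d - (b + c) ∈ K)
    (hdisj : ∀ b ∈ B, ∀ c ∈ C, b + c ∉ D) :
    ∃ H < K, (cosets H B + cosets H C + cosets H D) * Nat.card H ≤ Nat.card K + Nat.card H := by
  classical
  set H := stab (B + C) with hH
  obtain ⟨b₀, hb₀⟩ := hB
  obtain ⟨c₀, hc₀⟩ := hC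
  obtain ⟨d₀, hd₀⟩ := hD
  have h0 : b₀ + c₀ ∈ B + C := Finset.add_mem_add hb₀ hc₀
  have hsum : ∀ s ∈ B + C, s - (b₀ + c₀) ∈ K := by
    intro s hs
    obtain ⟨b, hb, c, hc, rfl⟩ := Finset.mem_add.1 hs
    rw [add_sub_add_comm]
    exact K.add_mem (hBK _ hb _ hb₀) (hCK _ hc _ hc₀)
  have hHK : H ≤ K := by
    intro x hx
    have := hsum _ (mem_stab.1 hx _ h0)
    simpa using this
  have hdis : ∀ s ∈ B + C, s ∉ D := by
    intro s hs
    obtain ⟨b, hb, c, hc, rfl⟩ := Finset.mem_add.1 hs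
    exact hdisj b hb c hc
  -- H = K would make B + C a full coset of K, namely the one that contains D.
  have hlt : H < K := by
    refine lt_of_le_of_ne hHK fun he => ?_
    have h1 : d₀ - (b₀ + c₀) ∈ H := he ▸ hDK _ hb₀ _ hc₀ _ hd₀
    have h2 := mem_stab.1 h1 _ h0
    rw [sub_add_cancel] at h2
    exact hdis _ h2 hd₀
  refine ⟨H, hlt, ?_⟩
  obtain ⟨B', hB', cB⟩ := exists_coset_hull H B
  obtain ⟨C', hC', cC⟩ := exists_coset_hull H C
  obtain ⟨D', hD', cD⟩ := exists_coset_hull H D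
  -- Filling up B and C to unions of H-cosets does not change the sumset, so Kneser's theorem can be
  -- applied to the hulls.
  have hBC : B' + C' = B + C := by
    apply Finset.Subset.antisymm
    · intro x hx
      obtain ⟨b', hb', c', hc', rfl⟩ := Finset.mem_add.1 hx
      obtain ⟨b, hb, hbb⟩ := (hB' _).1 hb'
      obtain ⟨c, hc, hcc⟩ := (hC' _).1 hc'
      have := mem_stab.1 (H.add_mem hbb hcc) _ (Finset.add_mem_add hb hc)
      have e : b' - b + (c' - c) + (b + c) = b' + c' := by abel
      rwa [e] at this
    · exact Finset.add_subset_add (fun x hx => (hB' x).2 ⟨x, hx, by simp⟩)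
        (fun x hx => (hC' x).2 ⟨x, hx, by simp⟩)
  have hk := card_add_card_le_card_add_card_stab (A := B') (B := C')
    ⟨b₀, (hB' _).2 ⟨b₀, hb₀, by simp⟩⟩ ⟨c₀, (hC' _).2 ⟨c₀, hc₀, by simp⟩⟩
  rw [hBC, ← hH, cB, cC] at hk
  have hle : #(B + C) + #D' ≤ Nat.card K := by
    rw [← Finset.card_union_of_disjoint, ← Finset.card_vadd_finset (-(b₀ + c₀))]
    · apply card_le_natCard_of_subset
      intro x hx
      obtain ⟨y, hy, rfl⟩ := Finset.mem_vadd_finset.1 hx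
      rw [vadd_eq_add, neg_add_eq_sub]
      rcases Finset.mem_union.1 hy with hy | hy
      · exact hsum y hy
      · obtain ⟨d, hd, hyd⟩ := (hD' _).1 hy
        have := K.add_mem (hHK hyd) (hDK _ hb₀ _ hc₀ _ hd)
        simpa using this
    · rw [Finset.disjoint_left]
      intro x hx hx'
      obtain ⟨d, hd, hxd⟩ := (hD' _).1 hx'
      have := mem_stab.1 (H.neg_mem hxd) _ hx
      rw [neg_sub, sub_add_cancel] at this
      exact hdis _ this hd
  rw [cD] at hle
  rw [add_mul, add_mul]
  omega

end Cosets

theorem five_eq_zero : (5 : ZMod 5) = 0 := by decide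

/-! ### Linear inequalities for ten densities and the possible supports -/

section ClassRules

/-- Constraints on the densities `U`, `W` of the ten pairs of opposite nonzero points
`±(1, c)`, `±(2, 2c)` of the plane. -/
structure ClassRules (σ : ℚ) (U W : ZMod 5 → ℚ) : Prop where
  nonnegU : ∀ c, 0 ≤ U c
  nonnegW : ∀ c, 0 ≤ W c
  oneU : ∀ c, U c ≤ 1
  oneW : ∀ c, W c ≤ 1
  adjU : ∀ c d, d = c + 1 → 0 < U c → 0 < U d → U c + U d ≤ σ
  -- (2, 2c) and (2, 2d) are neighbours for 2d + 1 = 2c, that is d = c + 2.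
  adjW : ∀ c d, d = c + 2 → 0 < W c → 0 < W d → W c + W d ≤ σ
  mixed : ∀ c, 0 < U c → 0 < W c → U c ≤ 1 / 2 ∧ W c ≤ 1 / 2 ∧ U c + W c ≤ 4 / 5
  -- The relation behind this rule is (1, c) + (1, d) = (2, 2e).
  midU : ∀ c d e, c + d = 2 * e → 0 < U c → 0 < U d → 0 < W e →
    U c + U d ≤ 1 ∧ U c + W e ≤ 1 ∧ U d + W e ≤ 1 ∧ (U c + U d + W e ≤ 6 / 5 ∨
      ((0 < W c → U c + W c ≤ 3 / 5) ∧ (0 < W d → U d + W d ≤ 3 / 5)))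
  -- The relation behind this rule is (2, 2c) + (2, 2d) = -(1, e).
  midW : ∀ c d e, c + d = 2 * e → 0 < W c → 0 < W d → 0 < U e →
    W c + W d ≤ 1 ∧ W c + U e ≤ 1 ∧ W d + U e ≤ 1 ∧ (W c + W d + U e ≤ 6 / 5 ∨
      ((0 < U c → W c + U c ≤ 3 / 5) ∧ (0 < U d → W d + U d ≤ 3 / 5)))

variable {σ : ℚ} {U W : ZMod 5 → ℚ}

/-- The symmetry between the rows ±1 and ±2, induced by replacing ξ with 2ξ. -/
theorem ClassRules.swap (R : ClassRules σ U W) :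
    ClassRules σ (fun c => W (2 * c)) (fun c => U (2 * c)) where
  nonnegU _ := R.nonnegW _
  nonnegW _ := R.nonnegU _
  oneU _ := R.oneW _
  oneW _ := R.oneU _
  adjU c d h := R.adjW _ _ (by rw [h]; ring)
  adjW c d h h1 h2 := by
    have := R.adjU (2 * d) (2 * c) (by subst h; linear_combination (-1 : ZMod 5) * five_eq_zero) h2 h1
    linarith
  mixed c h1 h2 := by
    obtain ⟨a, b, c⟩ := R.mixed (2 * c) h2 h1
    exact ⟨b, a, by linarith⟩
  midU c d e h := R.midW _ _ _ (by rw [← mul_add, h])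
  midW c d e h := R.midU _ _ _ (by rw [← mul_add, h])

theorem ClassRules.shift (R : ClassRules σ U W) (k : ZMod 5) :
    ClassRules σ (fun c => U (k + c)) (fun c => W (k + c)) where
  nonnegU _ := R.nonnegU _
  nonnegW _ := R.nonnegW _
  oneU _ := R.oneU _
  oneW _ := R.oneW _
  adjU c d h := R.adjU _ _ (by rw [h]; ring)
  adjW c d h := R.adjW _ _ (by rw [h]; ring)
  mixed c := R.mixed _
  midU c d e h := R.midU _ _ _ (by linear_combination h)
  midW c d e h := R.midW _ _ _ (by linear_combination h)

theorem sum_zmod_five (U : ZMod 5 → ℚ) : ∑ c, U c = U 0 + U 1 + U 2 + U 3 + U 4 :=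
  Fin.sum_univ_five U

/-- The support of `U`, `W` is that of a normal set. -/
def NormalSupport (U W : ZMod 5 → ℚ) : Prop :=
  ∃ α : ZMod 5, (∀ c, 0 < U c → c + α = 1 ∨ c + α = -1) ∧ ∀ c, 0 < W c → c + α = 2 ∨ c + α = -2

/-- `U` is supported on a path of length four and `W` on an edge and an isolated vertex. -/
def PathSupport (U W : ZMod 5 → ℚ) (k : ZMod 5) : Prop :=
  (0 < U k ∧ U (k + 1) = 0 ∧ 0 < U (k + 2) ∧ 0 < U (k + 3) ∧ 0 < U (k + 4)) ∧
    0 < W k ∧ 0 < W (k + 1) ∧ 0 < W (k + 2) ∧ W (k + 3) = 0 ∧ W (k + 4) = 0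

/-- `U` is supported on `k ± 1` and `W` on one of these two points. -/
def TripleSupport (U W : ZMod 5 → ℚ) (k : ZMod 5) : Prop :=
  (U k = 0 ∧ 0 < U (k + 1) ∧ U (k + 2) = 0 ∧ U (k + 3) = 0 ∧ 0 < U (k + 4)) ∧
    W k = 0 ∧ W (k + 2) = 0 ∧ W (k + 3) = 0 ∧
      (0 < W (k + 1) ∧ W (k + 4) = 0 ∨ W (k + 1) = 0 ∧ 0 < W (k + 4))

theorem normalSupport_of_eq_zero (h0 : U 0 = 0) (h2 : U 2 = 0) (h3 : U 3 = 0) (w0 : W 0 = 0)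
    (w1 : W 1 = 0) (w4 : W 4 = 0) : NormalSupport U W := by
  refine ⟨0, fun c hc => ?_, fun c hc => ?_⟩
  · fin_cases c <;> first
    | decide | exact absurd h0 hc.ne' | exact absurd h2 hc.ne' | exact absurd h3 hc.ne'
  · fin_cases c <;> first
    | decide | exact absurd w0 hc.ne' | exact absurd w1 hc.ne' | exact absurd w4 hc.ne'

/-- Every support of W is examined, each case being linear arithmetic. The bound 3/2 + σ is chosen
to stay below the required 14/5 - M for the values of σ used later. -/
theorem ClassRules.two_isolated (R : ClassRules σ U W) (hσ : 1 / 5 ≤ σ) (hσ' : σ ≤ 1 / 2)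
    (h0 : U 0 = 0) (h1 : 0 < U 1) (h2 : U 2 = 0) (h3 : U 3 = 0) (h4 : 0 < U 4) :
    NormalSupport U W ∨ U 1 + U 4 + (W 0 + W 1 + W 2 + W 3 + W 4) ≤ 3 / 2 + σ ∨
      ((0 < W 0 ∧ 0 < W 1 ∧ 0 < W 2 ∧ 0 < W 3 ∧ 0 < W 4) ∧ U 1 + U 4 ≤ 1) ∨
      TripleSupport U W 0 := by
  have hN := normalSupport_of_eq_zero (W := W) h0 h2 h3
  have hT : W 0 = 0 → W 2 = 0 → W 3 = 0 → (0 < W 1 ∧ W 4 = 0 ∨ W 1 = 0 ∧ 0 < W 4) →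
      TripleSupport U W 0 := fun w0 w2 w3 w14 => by simp_all [TripleSupport]
  have := R.oneU 1
  have := R.oneU 4
  have := R.nonnegW 0
  have := R.nonnegW 1
  have := R.nonnegW 2
  have := R.nonnegW 3
  have := R.nonnegW 4
  have := R.oneW 0
  have := R.oneW 2
  have := R.oneW 3
  have := R.adjW 0 2 (by decide)
  have := R.adjW 2 4 (by decide)
  have := R.adjW 4 1 (by decide)
  have := R.adjW 1 3 (by decide)
  have := R.adjW 3 0 (by decide)
  have := R.mixed 1 h1
  have := R.mixed 4 h4
  have := R.midU 1 4 0 (by decide) h1 h4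
  have := R.midW 3 4 1 (by decide)
  have := R.midW 1 2 4 (by decide)
  clear R
  grind

theorem ClassRules.isolated_and_edge (R : ClassRules σ U W) (hσ' : σ ≤ 1 / 2)
    (h1 : 0 < U 1) (h3 : 0 < U 3) (h4 : 0 < U 4) :
    U 1 + U 3 + U 4 + (W 0 + W 1 + W 2 + W 3 + W 4) ≤ 3 / 2 + σ ∨
      ((0 < W 0 ∧ 0 < W 1 ∧ 0 < W 2 ∧ 0 < W 3 ∧ 0 < W 4) ∧ U 1 + U 3 + U 4 ≤ 1) ∨
      (0 < W 0 ∧ W 1 = 0 ∧ 0 < W 2 ∧ 0 < W 3 ∧ 0 < W 4) := by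
  have := R.oneU 1
  have := R.nonnegW 0
  have := R.nonnegW 1
  have := R.nonnegW 2
  have := R.nonnegW 3
  have := R.nonnegW 4
  have := R.oneW 0
  have := R.oneW 2
  have := R.oneW 3
  have := R.oneW 4
  have := R.adjU 3 4 (by decide) h3 h4
  have := R.adjW 0 2 (by decide)
  have := R.adjW 2 4 (by decide)
  have := R.adjW 4 1 (by decide)
  have := R.adjW 1 3 (by decide)
  have := R.adjW 3 0 (by decide)
  have := R.mixed 1 h1
  have := R.mixed 3 h3
  have := R.mixed 4 h4
  have := R.midU 1 4 0 (by decide) h1 h4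
  have := R.midU 1 3 2 (by decide) h1 h3
  have := R.midU 3 4 1 (by decide) h3 h4
  have := R.midW 3 4 1 (by decide)
  have := R.midW 0 2 1 (by decide)
  have := R.midW 1 2 4 (by decide)
  have := R.midW 0 3 4 (by decide)
  have := R.midW 0 1 3 (by decide)
  have := R.midW 2 4 3 (by decide)
  clear R
  grind
theorem ClassRules.isolated (R : ClassRules σ U W) (hσ : 0 ≤ σ) {i j : ZMod 5}
    (hi : 0 < U i) (hj : 0 < W j) (hU : ∀ c, c ≠ i → U c = 0) (hW : ∀ c, c ≠ j → W c = 0) :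
    NormalSupport U W ∨ U i + W j ≤ 3 / 2 + σ := by
  by_cases hij : i = j
  · subst hij
    right
    have := (R.mixed i hi hj).2.2
    linarith
  · left
    have key : ∀ i j : ZMod 5, i ≠ j →
        ∃ α : ZMod 5, (i + α = 1 ∨ i + α = -1) ∧ (j + α = 2 ∨ j + α = -2) := by decide
    obtain ⟨α, h1, h2⟩ := key i j hij
    refine ⟨α, fun c hc => ?_, fun c hc => ?_⟩
    · rwa [show c = i by by_contra h; exact hc.ne' (hU c h)]
    · rwa [show c = j by by_contra h; exact hc.ne' (hW c h)]

/-- A proper nonempty subset of the 5-cycle without isolated vertices is a path, and a path is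
covered by at most two edges; hence 2σ. The other patterns are, up to rotation, a vertex, two
nonadjacent vertices, and a vertex with a disjoint edge. -/
theorem cycle_cases (U : ZMod 5 → ℚ) (h : ∀ c, 0 ≤ U c) (hσ : 0 ≤ σ)
    (hadj : ∀ c d, d = c + 1 → 0 < U c → 0 < U d → U c + U d ≤ σ)  :
    (∀ c, 0 < U c) ∨ ∑ c, U c ≤ 2 * σ ∨ ∃ k, U (k + 2) = 0 ∧
      ((0 < U k ∧ U (k + 1) = 0 ∧ U (k + 3) = 0 ∧ U (k + 4) = 0) ∨
        (U k = 0 ∧ 0 < U (k + 1) ∧ U (k + 3) = 0 ∧ 0 < U (k + 4)) ∨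
        (U k = 0 ∧ 0 < U (k + 1) ∧ 0 < U (k + 3) ∧ 0 < U (k + 4))) := by
  rw [or_iff_not_imp_left, or_iff_not_imp_right, sum_zmod_five]
  intro hf hk
  push Not at hk
  have k0 := hk 0
  have k1 := hk 1
  have k2 := hk 2
  have k3 := hk 3
  have k4 := hk 4
  clear hk
  have e : ∀ {x y}, x = y → U x = U y := fun h => by rw [h]
  rw [e (show (0 + 2 : ZMod 5) = 2 by decide), e (show (0 + 1 : ZMod 5) = 1 by decide),
    e (show (0 + 3 : ZMod 5) = 3 by decide), e (show (0 + 4 : ZMod 5) = 4 by decide)] at k0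
  rw [e (show (1 + 2 : ZMod 5) = 3 by decide), e (show (1 + 1 : ZMod 5) = 2 by decide),
    e (show (1 + 3 : ZMod 5) = 4 by decide), e (show (1 + 4 : ZMod 5) = 0 by decide)] at k1
  rw [e (show (2 + 2 : ZMod 5) = 4 by decide), e (show (2 + 1 : ZMod 5) = 3 by decide),
    e (show (2 + 3 : ZMod 5) = 0 by decide), e (show (2 + 4 : ZMod 5) = 1 by decide)] at k2
  rw [e (show (3 + 2 : ZMod 5) = 0 by decide), e (show (3 + 1 : ZMod 5) = 4 by decide),
    e (show (3 + 3 : ZMod 5) = 1 by decide), e (show (3 + 4 : ZMod 5) = 2 by decide)] at k3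
  rw [e (show (4 + 2 : ZMod 5) = 1 by decide), e (show (4 + 1 : ZMod 5) = 0 by decide),
    e (show (4 + 3 : ZMod 5) = 2 by decide), e (show (4 + 4 : ZMod 5) = 3 by decide)] at k4
  have := h 0
  have := h 1
  have := h 2
  have := h 3
  have := h 4
  have := hadj 0 1 (by decide)
  have := hadj 1 2 (by decide)
  have := hadj 2 3 (by decide)
  have := hadj 3 4 (by decide)
  have := hadj 4 0 (by decide)
  have hf : ¬ (0 < U 0 ∧ 0 < U 1 ∧ 0 < U 2 ∧ 0 < U 3 ∧ 0 < U 4) := by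
    rintro ⟨_, _, _, _, _⟩
    apply hf
    intro c
    fin_cases c <;> assumption
  clear h hadj e
  grind
theorem sum_shift (U : ZMod 5 → ℚ) (k : ZMod 5) : ∑ c, U (k + c) = ∑ c, U c :=
  Equiv.sum_comp (Equiv.addLeft k) U

theorem sum_double (U : ZMod 5 → ℚ) : ∑ c, U (2 * c) = ∑ c, U c :=
  Function.Bijective.sum_comp (e := fun c : ZMod 5 => 2 * c) (by decide) U

theorem NormalSupport.of_shift {k : ZMod 5}
    (h : NormalSupport (fun c => U (k + c)) (fun c => W (k + c))) : NormalSupport U W := by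
  obtain ⟨α, hU, hW⟩ := h
  refine ⟨α - k, fun c hc => ?_, fun c hc => ?_⟩
  · rw [show c + (α - k) = c - k + α by ring]
    exact hU (c - k) (by simpa only [add_sub_cancel] using hc)
  · rw [show c + (α - k) = c - k + α by ring]
    exact hW (c - k) (by simpa only [add_sub_cancel] using hc)

theorem NormalSupport.of_swap (h : NormalSupport (fun c => W (2 * c)) (fun c => U (2 * c))) :
    NormalSupport U W := by
  obtain ⟨α, hU, hW⟩ := h
  have e : ∀ c : ZMod 5, c = 2 * (3 * c) := by decide
  refine ⟨2 * α, fun c hc => ?_, fun c hc => ?_⟩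
  · rw [e c] at hc
    have := hW (3 * c) hc
    revert this
    clear hU hW hc
    revert c α
    decide
  · rw [e c] at hc
    have := hU (3 * c) hc
    revert this
    clear hU hW hc
    revert c α
    decide

theorem forall_zmod_five_shift {p : ZMod 5 → Prop} (k : ZMod 5) (h0 : p k) (h1 : p (k + 1))
    (h2 : p (k + 2)) (h3 : p (k + 3)) (h4 : p (k + 4)) (c : ZMod 5) : p c := by
  have : c = k ∨ c = k + 1 ∨ c = k + 2 ∨ c = k + 3 ∨ c = k + 4 := by
    clear h0 h1 h2 h3 h4
    revert c k
    decide
  rcases this with rfl | rfl | rfl | rfl | rfl <;> assumption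

/-- The outcome of the analysis of the class densities. -/
def ClassOutcome (σ : ℚ) (U W : ZMod 5 → ℚ) : Prop :=
  NormalSupport U W ∨ ∑ c, U c + ∑ c, W c ≤ 3 / 2 + σ ∨
    ((∀ c, 0 < U c) ∧ (∑ c, W c ≤ 1 ∨ ∀ c, 0 < W c)) ∨
    ((∀ c, 0 < W c) ∧ (∑ c, U c ≤ 1 ∨ ∀ c, 0 < U c)) ∨
    (∃ k, PathSupport U W k) ∨ (∃ k, PathSupport (fun c => W (2 * c)) (fun c => U (2 * c)) k) ∨
    (∃ k, TripleSupport U W k) ∨ ∃ k, TripleSupport (fun c => W (2 * c)) (fun c => U (2 * c)) k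

/-- Swapping twice reflects the indices, c ↦ -c, since 2 · 2 = -1; up to a shift of k the path and
triple patterns are invariant under this reflection. -/
theorem ClassOutcome.of_swap (h : ClassOutcome σ (fun c => W (2 * c)) (fun c => U (2 * c))) :
    ClassOutcome σ U W := by
  have e : ∀ c : ZMod 5, c = 2 * (3 * c) := by decide
  rcases h with h | h | h | h | ⟨k, h⟩ | ⟨k, h⟩ | ⟨k, h⟩ | ⟨k, h⟩
  · exact Or.inl h.of_swap
  · rw [sum_double, sum_double, add_comm] at h
    exact Or.inr (Or.inl h)
  · rw [sum_double] at h
    refine Or.inr (Or.inr (Or.inr (Or.inl ⟨fun c => ?_, h.2.imp_right fun h c => ?_⟩)))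
    · rw [e c]; exact h.1 _
    · rw [e c]; exact h _
  · rw [sum_double] at h
    refine Or.inr (Or.inr (Or.inl ⟨fun c => ?_, h.2.imp_right fun h c => ?_⟩))
    · rw [e c]; exact h.1 _
    · rw [e c]; exact h _
  · exact Or.inr (Or.inr (Or.inr (Or.inr (Or.inr (Or.inl ⟨k, h⟩)))))
  · refine Or.inr (Or.inr (Or.inr (Or.inr (Or.inl ⟨-k - 2, ?_⟩))))
    have := (by decide : ∀ k : ZMod 5, 2 * (2 * k) = -k - 2 + 2 ∧ 2 * (2 * (k + 1)) = -k - 2 + 1 ∧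
      2 * (2 * (k + 2)) = -k - 2 ∧ 2 * (2 * (k + 3)) = -k - 2 + 4 ∧
      2 * (2 * (k + 4)) = -k - 2 + 3) k
    simp only [PathSupport, this] at h ⊢
    tauto
  · exact Or.inr (Or.inr (Or.inr (Or.inr (Or.inr (Or.inr (Or.inr ⟨k, h⟩))))))
  · refine Or.inr (Or.inr (Or.inr (Or.inr (Or.inr (Or.inr (Or.inl ⟨-k, ?_⟩))))))
    have := (by decide : ∀ k : ZMod 5, 2 * (2 * k) = -k ∧ 2 * (2 * (k + 1)) = -k + 4 ∧
      2 * (2 * (k + 2)) = -k + 3 ∧ 2 * (2 * (k + 3)) = -k + 2 ∧ 2 * (2 * (k + 4)) = -k + 1) k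
    simp only [TripleSupport, this] at h ⊢
    tauto

theorem ClassRules.outcome_of_isolated (R : ClassRules σ U W) (hσ : 1 / 5 ≤ σ) (hσ' : σ ≤ 1 / 2)
    {k : ZMod 5} (h2 : U (k + 2) = 0)
    (h : (U k = 0 ∧ 0 < U (k + 1) ∧ U (k + 3) = 0 ∧ 0 < U (k + 4)) ∨
        (U k = 0 ∧ 0 < U (k + 1) ∧ 0 < U (k + 3) ∧ 0 < U (k + 4))) : ClassOutcome σ U W := by
  have hsU := sum_shift U k
  have hsW := sum_shift W k
  rw [sum_zmod_five] at hsU hsW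
  simp only [add_zero] at hsU hsW
  rcases h with ⟨h0, h1, h3, h4⟩ | ⟨h0, h1, h3, h4⟩
  · rcases (R.shift k).two_isolated hσ hσ' (by rwa [add_zero]) h1 h2 h3 h4 with
      h | h | ⟨⟨w0, w1, w2, w3, w4⟩, h⟩ | h
    · exact Or.inl h.of_shift
    · right; left; simp only [add_zero] at h; linarith
    · right; right; right; left
      rw [add_zero] at w0
      exact ⟨forall_zmod_five_shift k w0 w1 w2 w3 w4, Or.inl (by linarith)⟩
    · right; right; right; right; right; right; left
      simp only [TripleSupport, add_zero, zero_add] at h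
      exact ⟨k, h⟩
  · rcases (R.shift k).isolated_and_edge hσ' h1 h3 h4 with
      h | ⟨⟨w0, w1, w2, w3, w4⟩, h⟩ | ⟨w0, w1, w2, w3, w4⟩
    · right; left; simp only [add_zero] at h; linarith
    · right; right; right; left
      rw [add_zero] at w0
      exact ⟨forall_zmod_five_shift k w0 w1 w2 w3 w4, Or.inl (by linarith)⟩
    · right; right; right; right; right; left
      refine ⟨3 * k + 2, ?_⟩
      have e0 : 2 * (3 * k + 2) = k + 4 :=
        (by decide : ∀ k : ZMod 5, 2 * (3 * k + 2) = k + 4) k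
      have e1 : 2 * (3 * k + 2 + 1) = k + 1 :=
        (by decide : ∀ k : ZMod 5, 2 * (3 * k + 2 + 1) = k + 1) k
      have e2 : 2 * (3 * k + 2 + 2) = k + 3 :=
        (by decide : ∀ k : ZMod 5, 2 * (3 * k + 2 + 2) = k + 3) k
      have e3 : 2 * (3 * k + 2 + 3) = k :=
        (by decide : ∀ k : ZMod 5, 2 * (3 * k + 2 + 3) = k) k
      have e4 : 2 * (3 * k + 2 + 4) = k + 2 :=
        (by decide : ∀ k : ZMod 5, 2 * (3 * k + 2 + 4) = k + 2) k
      rw [add_zero] at w0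
      simp only [PathSupport, e0, e1, e2, e3, e4]
      exact ⟨⟨w4, w1, w3, w0, w2⟩, h4, h1, h3, h0, h2⟩

theorem ClassRules.outcome (R : ClassRules σ U W) (hσ : 1 / 5 ≤ σ) (hσ' : σ ≤ 1 / 2) :
    ClassOutcome σ U W := by
  have single : ∀ {U : ZMod 5 → ℚ} {k : ZMod 5}, U (k + 2) = 0 → (0 < U k ∧ U (k + 1) = 0 ∧
      U (k + 3) = 0 ∧ U (k + 4) = 0) → 0 < U k ∧ (∀ c, c ≠ k → U c = 0) ∧ ∑ c, U c = U k := by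
    rintro U k h2 ⟨h0, h1, h3, h4⟩
    refine ⟨h0, forall_zmod_five_shift (p := fun c => c ≠ k → U c = 0) k
      (fun h => absurd rfl h) (fun _ => h1) (fun _ => h2) (fun _ => h3) (fun _ => h4), ?_⟩
    rw [← sum_shift U k, sum_zmod_five, add_zero]
    linarith
  have full : ∀ {U W : ZMod 5 → ℚ}, (∀ c, 0 < U c) → (∑ c, W c ≤ 1 ∨ ∀ c, 0 < W c) →
      ClassOutcome σ U W := fun h h' => Or.inr (Or.inr (Or.inl ⟨h, h'⟩))
  have small : ∀ {U W : ZMod 5 → ℚ}, ∑ c, U c + ∑ c, W c ≤ 3 / 2 + σ → ClassOutcome σ U W :=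
    fun h => Or.inr (Or.inl h)
  have hsW : ∑ c, W (2 * c) = ∑ c, W c := sum_double W
  rcases cycle_cases U R.nonnegU (by linarith) R.adjU with hU | hU | ⟨k, h2, hU | hU⟩
  on_goal 4 => exact R.outcome_of_isolated hσ hσ' h2 hU
  all_goals
    rcases cycle_cases _ R.swap.nonnegU (by linarith) R.swap.adjU with hW | hW | ⟨l, k2, hW | hW⟩
    on_goal 4 => exact (R.swap.outcome_of_isolated hσ hσ' k2 hW).of_swap
  · refine full hU (Or.inr fun c => ?_)
    rw [(by decide : ∀ c : ZMod 5, c = 2 * (3 * c)) c]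
    exact hW _
  · exact full hU (Or.inl (by linarith))
  · have hs : ∑ c, W (2 * c) = W (2 * l) := (single (U := fun c => W (2 * c)) k2 hW).2.2
    exact full hU (Or.inl (by linarith [R.oneW (2 * l)]))
  · exact (full hW (Or.inl (by rw [sum_double]; linarith))).of_swap
  · exact small (by linarith)
  · have hs : ∑ c, W (2 * c) = W (2 * l) := (single (U := fun c => W (2 * c)) k2 hW).2.2
    exact small (by linarith [R.oneW (2 * l)])
  · obtain ⟨-, -, hs⟩ := single h2 hU
    exact (full hW (Or.inl (by rw [sum_double]; linarith [R.oneU k]))).of_swap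
  · obtain ⟨-, -, hs⟩ := single h2 hU
    exact small (by linarith [R.oneU k])
  · obtain ⟨hp, hz, hs⟩ := single h2 hU
    obtain ⟨hp', hz', hs'⟩ := single (U := fun c => W (2 * c)) k2 hW
    have hz'' : ∀ c, c ≠ 2 * l → W c = 0 := by
      intro c hc
      rw [(by decide : ∀ c : ZMod 5, c = 2 * (3 * c)) c] at hc ⊢
      exact hz' _ fun h => hc (by rw [h])
    rcases R.isolated (by linarith) hp hp' hz hz'' with h | h
    · exact Or.inl h
    · exact small (by linarith)

end ClassRules

/-! ### Consequences of Kneser's theorem for densities over a plane -/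

section Plane

/-- The numerical consequence of Kneser's theorem for three sets of densities `a`, `b`, `c` in
cosets of a group of exponent `5`, without solutions of `x + y = z`. -/
def KneserTriple (a b c : ℚ) : Prop :=
  ∃ t x y z : ℕ, (t = 5 ∨ t = 25 ∨ 125 ≤ t) ∧ 1 ≤ x ∧ 1 ≤ y ∧ 1 ≤ z ∧
    t * a ≤ x ∧ t * b ≤ y ∧ t * c ≤ z ∧ x + y + z ≤ t + 1

/-- A `KneserTriple` with the additional information that, for `t = 5`, the second set meets at
least four cosets. -/
def KneserAdj (a b c : ℚ) : Prop :=
  ∃ t x y z : ℕ, (t = 5 ∧ 4 ≤ y ∨ t = 25 ∨ 125 ≤ t) ∧ 1 ≤ x ∧ 1 ≤ y ∧ 1 ≤ z ∧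
    t * a ≤ x ∧ t * b ≤ y ∧ t * c ≤ z ∧ x + y + z ≤ t + 1

variable {a b c : ℚ}

/-- Each set meets at least one coset, which leaves at most t for the other two; and (t + 1)/t ≤
6/5. -/
theorem KneserTriple.bounds (h : KneserTriple a b c) :
    a + b ≤ 1 ∧ a + c ≤ 1 ∧ b + c ≤ 1 ∧ a + b + c ≤ 6 / 5 := by
  obtain ⟨t, x, y, z, ht, hx, hy, hz, ha, hb, hc, hs⟩ := h
  have ht5 : (5 : ℚ) ≤ t := by
    have : 5 ≤ t := by omega
    exact_mod_cast this
  have hs' : (x + y + z : ℚ) ≤ t + 1 := by exact_mod_cast hs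
  have hx' : (1 : ℚ) ≤ x := by exact_mod_cast hx
  have hy' : (1 : ℚ) ≤ y := by exact_mod_cast hy
  have hz' : (1 : ℚ) ≤ z := by exact_mod_cast hz
  have tp : (0 : ℚ) < t := by linarith
  refine ⟨?_, ?_, ?_, ?_⟩ <;> refine le_of_mul_le_mul_left ?_ tp <;> linarith

/-- For t = 5 the number z of cosets met by the third set is kept as an integer; for t ≥ 25 the
bound (t + 1)/t ≤ 26/25 is enough. The next four lemmas round a lower bound for 5c up to an integer
z. -/
theorem KneserTriple.five_or (h : KneserTriple a b c) :
    (∃ z : ℕ, 1 ≤ z ∧ z ≤ 4 ∧ 5 * c ≤ z ∧ 5 * a ≤ 5 - z ∧ 5 * b ≤ 5 - z ∧ 5 * (a + b) ≤ 6 - z) ∨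
      a + b + c ≤ 26 / 25 := by
  obtain ⟨t, x, y, z, ht, hx, hy, hz, ha, hb, hc, hs⟩ := h
  have hs' : (x + y + z : ℚ) ≤ t + 1 := by exact_mod_cast hs
  have hx' : (1 : ℚ) ≤ x := by exact_mod_cast hx
  have hy' : (1 : ℚ) ≤ y := by exact_mod_cast hy
  by_cases h5 : t = 5
  · subst h5
    push_cast at ha hb hc hs'
    exact Or.inl ⟨z, hz, by omega, hc, by linarith, by linarith, by linarith⟩
  · right
    have ht5 : (25 : ℚ) ≤ t := by
      have : 25 ≤ t := by omega
      exact_mod_cast this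
    refine le_of_mul_le_mul_left ?_ (show (0 : ℚ) < t by linarith)
    linarith

theorem KneserTriple.four_fifths (h : KneserTriple a b c) (hc : 3 / 5 < c) :
    (c ≤ 4 / 5 ∧ a ≤ 1 / 5 ∧ b ≤ 1 / 5) ∨ a + b + c ≤ 26 / 25 := by
  rcases h.five_or with ⟨z, -, hz4, h1, h2, h3, -⟩ | h
  · left
    have : (3 : ℚ) < z := by linarith
    have hz : z = 4 := by
      have : 3 < z := by exact_mod_cast this
      omega
    subst hz
    push_cast at *
    exact ⟨by linarith, by linarith, by linarith⟩
  · exact Or.inr h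

theorem KneserTriple.three_fifths (h : KneserTriple a b c) (hc : 2 / 5 < c) :
    (c ≤ 4 / 5 ∧ a ≤ 2 / 5 ∧ b ≤ 2 / 5 ∧ a + b ≤ 3 / 5) ∨ a + b + c ≤ 26 / 25 := by
  rcases h.five_or with ⟨z, -, hz4, h1, h2, h3, h4⟩ | h
  · left
    have : (2 : ℚ) < z := by linarith
    have hz : 3 ≤ z := by
      have : 2 < z := by exact_mod_cast this
      omega
    have hz' : (3 : ℚ) ≤ z := by exact_mod_cast hz
    have hz4' : (z : ℚ) ≤ 4 := by exact_mod_cast hz4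
    exact ⟨by linarith, by linarith, by linarith, by linarith⟩
  · exact Or.inr h

theorem KneserTriple.two_fifths (h : KneserTriple a b c) (hc : 1 / 5 < c) :
    (a + b ≤ 4 / 5 ∧ a ≤ 1 - c ∧ b ≤ 1 - c) ∨ a + b + c ≤ 26 / 25 := by
  rcases h.five_or with ⟨z, -, hz4, h1, h2, h3, h4⟩ | h
  · left
    have : (1 : ℚ) < z := by linarith
    have hz : 2 ≤ z := by
      have : 1 < z := by exact_mod_cast this
      omega
    have hz' : (2 : ℚ) ≤ z := by exact_mod_cast hz
    exact ⟨by linarith, by linarith, by linarith⟩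
  · exact Or.inr h

theorem KneserTriple.one_fifth (h : KneserTriple a b c) :
    (a + b ≤ 1 ∧ a ≤ 1 - c ∧ b ≤ 1 - c) ∨ a + b + c ≤ 26 / 25 := by
  rcases h.five_or with ⟨z, hz, hz4, h1, h2, h3, h4⟩ | h
  · left
    have hz' : (1 : ℚ) ≤ z := by exact_mod_cast hz
    exact ⟨by linarith, by linarith, by linarith⟩
  · exact Or.inr h

theorem KneserAdj.symm (h : KneserAdj a b c) : KneserAdj c b a := by
  obtain ⟨t, x, y, z, ht, hx, hy, hz, ha, hb, hc, hs⟩ := h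
  exact ⟨t, z, y, x, ht, hz, hy, hx, hc, hb, ha, by omega⟩

theorem KneserAdj.cases (h : KneserAdj a b c) :
    (b ≤ 4 / 5 ∧ a ≤ 1 / 5 ∧ c ≤ 1 / 5) ∨ a + c + b ≤ 26 / 25 := by
  obtain ⟨t, x, y, z, ht, hx, hy, hz, ha, hb, hc, hs⟩ := h
  have hs' : (x + y + z : ℚ) ≤ t + 1 := by exact_mod_cast hs
  have hx' : (1 : ℚ) ≤ x := by exact_mod_cast hx
  have hz' : (1 : ℚ) ≤ z := by exact_mod_cast hz
  by_cases h5 : t = 5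
  · subst h5
    have hy' : (4 : ℚ) ≤ y := by
      have : 4 ≤ y := by omega
      exact_mod_cast this
    push_cast at ha hb hc hs'
    exact Or.inl ⟨by linarith, by linarith, by linarith⟩
  · right
    have ht5 : (25 : ℚ) ≤ t := by
      have : 25 ≤ t := by omega
      exact_mod_cast this
    refine le_of_mul_le_mul_left ?_ (show (0 : ℚ) < t by linarith)
    linarith

/-- The bound for adjacent cells of a row when `b` is only slightly larger than `14 / 25`. -/
theorem KneserAdj.low (h : KneserAdj a b c) {M : ℚ} (hM : 14 / 25 < M) (hM' : M ≤ 3 / 5)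
    (hb : M ≤ b) :
    a + c ≤ 14 / 25 - M / 5 ∧ ¬ (a = 7 / 25 - M / 10 ∧ c = 7 / 25 - M / 10) := by
  obtain ⟨t, x, y, z, ht, hx, hy, hz, ha, hb', hc, hs⟩ := h
  have hs' : (x + y + z : ℚ) ≤ t + 1 := by exact_mod_cast hs
  have hx' : (1 : ℚ) ≤ x := by exact_mod_cast hx
  have hz' : (1 : ℚ) ≤ z := by exact_mod_cast hz
  -- Only t = 25 needs care. There y ≥ 15 leaves x + z ≤ 11, while the excluded equal values give
  -- 25a = 25c = 7 - 5M/2 > 5 and so x, z ≥ 6.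
  suffices hlt : a + c < 14 / 25 - M / 5 ∨ (t = 25 ∧ 15 ≤ y) by
    rcases hlt with h | ⟨rfl, hy15⟩
    · exact ⟨h.le, fun h' => by linarith [h'.1, h'.2]⟩
    · push_cast at ha hb' hc hs'
      have hy' : (15 : ℚ) ≤ y := by exact_mod_cast hy15
      refine ⟨by linarith, ?_⟩
      rintro ⟨rfl, rfl⟩
      have h5x : (5 : ℚ) < x := by linarith
      have h5z : (5 : ℚ) < z := by linarith
      have : 5 < x := by exact_mod_cast h5x
      have : 5 < z := by exact_mod_cast h5z
      omega
  rcases ht with ⟨rfl, hy4⟩ | rfl | ht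
  · left
    have hy' : (4 : ℚ) ≤ y := by exact_mod_cast hy4
    push_cast at ha hb' hc hs'
    linarith
  · right
    push_cast at ha hb' hc hs'
    have : (14 : ℚ) < y := by linarith
    have : 14 < y := by exact_mod_cast this
    exact ⟨rfl, this⟩
  · left
    have ht' : (125 : ℚ) ≤ t := by exact_mod_cast ht
    have h1 : t * (a + b + c) ≤ t * (126 / 125) := by linarith
    have := le_of_mul_le_mul_left h1 (by linarith)
    linarith

/-- The constraints on the densities of four cells `±v`, `±(v + e₂)`. -/
structure FourCells (p q r b₁ c₁ b₂ c₂ : ℚ) : Prop where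
  same₁ : 0 < b₁ → 0 < c₁ → KneserAdj b₁ r c₁
  same₂ : 0 < b₂ → 0 < c₂ → KneserAdj b₂ r c₂
  cross₁ : 0 < b₁ → 0 < c₂ → 0 < q → KneserTriple b₁ c₂ q
  cross₂ : 0 < b₂ → 0 < c₁ → 0 < p → KneserTriple b₂ c₁ p

variable {p q r b₁ c₁ b₂ c₂ : ℚ}

/-- Here r ≥ p > 4/5 rules out t = 5 for neighbours in a row, so two positive neighbours have sum
below 26/25 - 4/5 = 6/25. -/
theorem FourCells.high (F : FourCells p q r b₁ c₁ b₂ c₂) (hp : p ≤ r) (hq : q ≤ p) (hp1 : p ≤ 1)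
    (hM : 8 / 5 < p + q) (nb₁ : 0 ≤ b₁) (nc₁ : 0 ≤ c₁) (nb₂ : 0 ≤ b₂) (nc₂ : 0 ≤ c₂)
    (hb : 0 < b₁ ∨ 0 < b₂) (hc : 0 < c₁ ∨ 0 < c₂) : b₁ + c₁ + b₂ + c₂ ≤ 12 / 25 := by
  have s₁ := fun h h' => (F.same₁ h h').cases
  have s₂ := fun h h' => (F.same₂ h h').cases
  have x₁ := fun h h' => (F.cross₁ h h' (by linarith)).four_fifths (by linarith)
  have x₂ := fun h h' => (F.cross₂ h h' (by linarith)).four_fifths (by linarith)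
  clear F
  grind

theorem FourCells.middle (F : FourCells p q r b₁ c₁ b₂ c₂) (hp : p ≤ r) (hq : q ≤ p) (hp1 : p ≤ 1)
    (hM : 6 / 5 < p + q) (hM' : p + q < 8 / 5) (nb₁ : 0 ≤ b₁) (nc₁ : 0 ≤ c₁) (nb₂ : 0 ≤ b₂)
    (nc₂ : 0 ≤ c₂) (hb : 0 < b₁ ∨ 0 < b₂) (hc : 0 < c₁ ∨ 0 < c₂) :
    b₁ + c₁ + b₂ + c₂ ≤ 4 / 5 ∨ b₁ + c₁ + b₂ + c₂ ≤ 52 / 25 - (p + q) := by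
  have s₁ := fun h h' => (F.same₁ h h').cases
  have s₂ := fun h h' => (F.same₂ h h').cases
  have x₁ := fun h h' => (F.cross₁ h h' (by linarith)).two_fifths (by linarith)
  have y₁ := fun h h' hq => (F.cross₁ h h' (by linarith)).three_fifths hq
  have x₂ := fun h h' => (F.cross₂ h h' (by linarith)).four_fifths (by linarith)
  clear F
  grind

theorem FourCells.low (F : FourCells p q r b₁ c₁ b₂ c₂) (hp : p ≤ r) (hq : q ≤ p) (hp1 : p ≤ 1)
    (hM : 28 / 25 < p + q) (nb₁ : 0 ≤ b₁) (nc₁ : 0 ≤ c₁) (nb₂ : 0 ≤ b₂)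
    (nc₂ : 0 ≤ c₂) (hb : 0 < b₁ ∨ 0 < b₂) (hc : 0 < c₁ ∨ 0 < c₂) :
    b₁ + c₁ + b₂ + c₂ ≤ 1 := by
  have s₁ := fun h h' => (F.same₁ h h').cases
  have s₂ := fun h h' => (F.same₂ h h').cases
  have x₁ := fun h h' => (F.cross₁ h h' (by linarith)).one_fifth
  have y₁ := fun h h' hq => (F.cross₁ h h' (by linarith)).two_fifths hq
  have x₂ := fun h h' => (F.cross₂ h h' (by linarith)).three_fifths (by linarith)
  clear F
  grind

/-- The critical value: four cells of density 1/5 satisfy all constraints and lead to equality in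
the final count. The clause with 6/25 yields neighbours whose sum is too large for any t other than
5. -/
theorem FourCells.tie (F : FourCells p q r b₁ c₁ b₂ c₂) (hp : p ≤ r) (hq : q ≤ p) (hp1 : p ≤ 1)
    (hM : p + q = 8 / 5) (nb₁ : 0 ≤ b₁) (nc₁ : 0 ≤ c₁) (nb₂ : 0 ≤ b₂)
    (nc₂ : 0 ≤ c₂) (hb : 0 < b₁ ∨ 0 < b₂) (hc : 0 < c₁ ∨ 0 < c₂) :
    b₁ + c₁ + b₂ + c₂ ≤ 3 / 5 ∨ (p = 4 / 5 ∧ b₁ + c₁ + b₂ + c₂ ≤ 4 / 5 ∧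
      (b₁ + c₁ + b₂ + c₂ = 4 / 5 → b₁ = 1 / 5 ∧ c₁ = 1 / 5 ∧ b₂ = 1 / 5 ∧ c₂ = 1 / 5) ∧
      ((0 < b₁ ∧ 0 < c₁ ∧ 6 / 25 < b₁ + c₁) ∨ (0 < b₂ ∧ 0 < c₂ ∧ 6 / 25 < b₂ + c₂))) := by
  have s₁ := fun h h' => (F.same₁ h h').cases
  have s₂ := fun h h' => (F.same₂ h h').cases
  have x₁ := fun h h' => (F.cross₁ h h' (by linarith)).three_fifths (by linarith)
  have y₁ := fun h h' hq => (F.cross₁ h h' (by linarith)).four_fifths hq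
  have x₂ := fun h h' => (F.cross₂ h h' (by linarith)).four_fifths (by linarith)
  clear F
  grind (splits := 20)

/-- Bounds for the four nonzero multiples of a vector. -/
theorem multiples_bound {a b b' a' : ℚ} (na : 0 ≤ a) (nb : 0 ≤ b) (nb' : 0 ≤ b') (na' : 0 ≤ a')
    (oa : a ≤ 1) (ob : b ≤ 1) (ob' : b' ≤ 1) (oa' : a' ≤ 1)
    (h112 : 0 < a → 0 < b → KneserTriple a a b) (h224 : 0 < b → 0 < a' → KneserTriple b b a')
    (h443 : 0 < a' → 0 < b' → KneserTriple a' a' b') (h331 : 0 < b' → 0 < a → KneserTriple b' b' a)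
    (h123 : 0 < a → 0 < b → 0 < b' → KneserTriple a b b')
    (h134 : 0 < a → 0 < b' → 0 < a' → KneserTriple a b' a')
    (h241 : 0 < b → 0 < a' → 0 < a → KneserTriple b a' a)
    (h342 : 0 < b' → 0 < a' → 0 < b → KneserTriple b' a' b)
    (h14 : 0 < a ∨ 0 < a') (h23 : 0 < b ∨ 0 < b') :
    a + a' ≤ 1 ∧ b + b' ≤ 1 ∧ a + a' + b + b' ≤ 8 / 5 ∧
      (a = 0 ∨ a' = 0 → a + a' + b + b' ≤ 6 / 5) ∧
      (b = 0 ∨ b' = 0 → a + a' + b + b' ≤ 6 / 5) ∧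
      (a + a' + b + b' = 8 / 5 → a = 2 / 5 ∧ a' = 2 / 5 ∧ b = 2 / 5 ∧ b' = 2 / 5) := by
  replace h112 := fun x y => (h112 x y).bounds
  replace h224 := fun x y => (h224 x y).bounds
  replace h443 := fun x y => (h443 x y).bounds
  replace h331 := fun x y => (h331 x y).bounds
  replace h123 := fun x y z => (h123 x y z).bounds
  replace h134 := fun x y z => (h134 x y z).bounds
  replace h241 := fun x y z => (h241 x y z).bounds
  replace h342 := fun x y z => (h342 x y z).bounds
  grind (splits := 30)

theorem middle_bound {u u' v v' w w' : ℚ} (nu : 0 ≤ u) (nu' : 0 ≤ u') (nv : 0 ≤ v) (nv' : 0 ≤ v')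
    (nw : 0 ≤ w) (nw' : 0 ≤ w') (ou : u ≤ 1) (ou' : u' ≤ 1) (ov : v ≤ 1) (ov' : v' ≤ 1)
    (ow : w ≤ 1) (ow' : w' ≤ 1)
    (h₁ : 0 < u → 0 < v → 0 < w → KneserTriple u v w)
    (h₂ : 0 < u → 0 < v' → 0 < w → KneserTriple w v' u)
    (h₃ : 0 < u' → 0 < v → 0 < w → KneserTriple w u' v)
    (h₄ : 0 < u' → 0 < v' → 0 < w' → KneserTriple u' v' w')
    (h₅ : 0 < u' → 0 < v → 0 < w' → KneserTriple w' v u')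
    (h₆ : 0 < u → 0 < v' → 0 < w' → KneserTriple w' u v')
    (hu : 0 < u ∨ 0 < u') (hv : 0 < v ∨ 0 < v') (hw : 0 < w ∨ 0 < w') :
    u + u' + (v + v') ≤ 2 ∧ u + u' + (w + w') ≤ 2 ∧ v + v' + (w + w') ≤ 2 ∧
      (u + u' + (v + v') + (w + w') ≤ 12 / 5 ∨ ((u = 0 ∨ u' = 0) ∧ (v = 0 ∨ v' = 0))) := by
  replace h₁ := fun x y z => (h₁ x y z).bounds
  replace h₂ := fun x y z => (h₂ x y z).bounds
  replace h₃ := fun x y z => (h₃ x y z).bounds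
  replace h₄ := fun x y z => (h₄ x y z).bounds
  replace h₅ := fun x y z => (h₅ x y z).bounds
  replace h₆ := fun x y z => (h₆ x y z).bounds
  grind (splits := 30)

/-- A cyclic sequence of five small densities has a small sum. -/
theorem row_lt {X : ZMod 5 → ℚ} {M : ℚ} (hM : M ≤ 3 / 5) (hn : ∀ c, 0 ≤ X c)
    (hc : ∀ c, X c ≤ 12 / 25)
    (hadj : ∀ c d, d = c + 1 → 0 < X c → 0 < X d → X c + X d ≤ 12 / 25 ∧ 
      X c + X d ≤ 14 / 25 - M / 5 ∧ ¬ (X c = 7 / 25 - M / 10 ∧ X d = 7 / 25 - M / 10)) :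
    ∑ c, X c < 7 / 5 - M / 2 := by
  rw [sum_zmod_five]
  have := hn 0
  have := hn 1
  have := hn 2
  have := hn 3
  have := hn 4
  have := hc 0
  have := hc 1
  have := hc 2
  have := hc 3
  have := hc 4
  have := hadj 0 1 (by decide)
  have := hadj 1 2 (by decide)
  have := hadj 2 3 (by decide)
  have := hadj 3 4 (by decide)
  have := hadj 4 0 (by decide)
  clear hn hc hadj
  -- If all entries are positive, the five adjacent pairs give 2 ΣX ≤ 5 (14/25 - M/5). Equality
  -- would make all entries equal, because the cycle is odd, and equal entries are excluded.
  grind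

/-- X and Y describe the row ξ = 1 and the reflected row ξ = -1. Since every column is occupied,
each positive cell has a partner in the next column, in its own row or the opposite one, and is
therefore at most 12/25. -/
theorem full_rows_lt {X Y : ZMod 5 → ℚ} {M : ℚ} (hM : 14 / 25 < M) (hM' : M ≤ 3 / 5) (hp : M ≤ p)
    (hr : p ≤ r) (hX : ∀ c, 0 ≤ X c) (hY : ∀ c, 0 ≤ Y c)
    (hXX : ∀ c d, d = c + 1 → 0 < X c → 0 < X d → KneserAdj (X c) r (X d))
    (hYY : ∀ c d, d = c + 1 → 0 < Y c → 0 < Y d → KneserAdj (Y c) r (Y d))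
    (hYX : ∀ c d, d = c + 1 → 0 < Y c → 0 < X d → KneserTriple (Y c) (X d) p)
    (hfull : ∀ c, 0 < X c ∨ 0 < Y c) : ∑ c, X c + ∑ c, Y c < 14 / 5 - M := by
  have aX : ∀ c d, d = c + 1 → 0 < X c → 0 < X d → X c + X d ≤ 12 / 25 ∧ 
      X c + X d ≤ 14 / 25 - M / 5 ∧ ¬ (X c = 7 / 25 - M / 10 ∧ X d = 7 / 25 - M / 10) :=
    fun c d h h1 h2 => by
      have := (hXX c d h h1 h2).low hM hM' (hp.trans hr)
      exact ⟨by linarith [this.1], this⟩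
  have aY : ∀ c d, d = c + 1 → 0 < Y c → 0 < Y d → Y c + Y d ≤ 12 / 25 ∧ 
      Y c + Y d ≤ 14 / 25 - M / 5 ∧ ¬ (Y c = 7 / 25 - M / 10 ∧ Y d = 7 / 25 - M / 10) :=
    fun c d h h1 h2 => by
      have := (hYY c d h h1 h2).low hM hM' (hp.trans hr)
      exact ⟨by linarith [this.1], this⟩
  have aYX : ∀ c d, d = c + 1 → 0 < Y c → 0 < X d → Y c ≤ 12 / 25 ∧ X d ≤ 12 / 25 :=
    fun c d h h1 h2 => by
      rcases (hYX c d h h1 h2).three_fifths (by linarith) with h | h <;>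
        constructor <;> linarith [h1, h2]
  have cX : ∀ c, X c ≤ 12 / 25 := by
    intro c
    rcases (hX c).eq_or_lt with h | h
    · linarith
    · rcases hfull (c - 1) with h' | h'
      · linarith [(aX (c - 1) c (by ring) h' h).1]
      · exact (aYX (c - 1) c (by ring) h' h).2
  have cY : ∀ c, Y c ≤ 12 / 25 := by
    intro c
    rcases (hY c).eq_or_lt with h | h
    · linarith
    · rcases hfull (c + 1) with h' | h'
      · exact (aYX c (c + 1) rfl h h').1
      · linarith [(aY c (c + 1) rfl h h').1]
  linarith [row_lt hM' hX cX aX, row_lt hM' hY cY aY]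

end Plane

/-! ### Density configurations compatible with the size of the set -/

section PlaneOutcome

/-- The mean density of the cells `±(1, c)`. -/
def oneDensity (f : ZMod 5 → ZMod 5 → ℚ) (c : ZMod 5) : ℚ := (f 1 c + f (-1) (-c)) / 2

/-- The mean density of the cells `±(2, 2c)`. -/
def twoDensity (f : ZMod 5 → ZMod 5 → ℚ) (c : ZMod 5) : ℚ := (f 2 (2 * c) + f (-2) (-(2 * c))) / 2

/-- The constraints on the densities `f x y` of the fibers of a sum-free set over a plane, such
that the line `x = 0` has maximum density. -/
structure PlaneDensity (f : ZMod 5 → ZMod 5 → ℚ) (r : ℚ) : Prop where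
  nonneg : ∀ x y, 0 ≤ f x y
  le_one : ∀ x y, f x y ≤ 1
  tri : ∀ {x y x' y' x'' y''}, x + x' = x'' → y + y' = y'' → 0 < f x y → 0 < f x' y' →
    0 < f x'' y'' → KneserTriple (f x y) (f x' y') (f x'' y'')
  adj : ∀ x {y y'}, y' = y + 1 → 0 < f x y → 0 < f x y' → KneserAdj (f x y) r (f x y')
  le_r : f 0 1 ≤ r
  le_p : f 0 (-1) ≤ f 0 1
  big : 28 / 25 < f 0 1 + f 0 (-1)
  -- The line y = cx carries a hyperplane section, no larger than the densest one.
  cap : ∀ c, oneDensity f c + twoDensity f c ≤ (f 0 1 + f 0 (-1)) / 2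
  total : 28 / 5 ≤ f 0 1 + f 0 (-1) + 2 * (∑ c, oneDensity f c + ∑ c, twoDensity f c)

variable {f : ZMod 5 → ZMod 5 → ℚ} {r : ℚ}

theorem oneDensity_swap (f : ZMod 5 → ZMod 5 → ℚ) :
    oneDensity (fun x y => f (3 * x) y) = fun c => twoDensity f (2 * c) := by
  funext c
  have e : 2 * (2 * c) = -c := (by decide : ∀ c : ZMod 5, 2 * (2 * c) = -c) c
  simp only [oneDensity, twoDensity, e, neg_neg]
  rw [show (3 * 1 : ZMod 5) = -2 by decide, show (3 * -1 : ZMod 5) = 2 by decide, add_comm]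

theorem twoDensity_swap (f : ZMod 5 → ZMod 5 → ℚ) :
    twoDensity (fun x y => f (3 * x) y) = fun c => oneDensity f (2 * c) := by
  funext c
  simp only [oneDensity, twoDensity]
  rw [show (3 * 2 : ZMod 5) = 1 by decide, show (3 * -2 : ZMod 5) = -1 by decide]

theorem PlaneDensity.swap (P : PlaneDensity f r) : PlaneDensity (fun x y => f (3 * x) y) r where
  nonneg _ _ := P.nonneg _ _
  le_one _ _ := P.le_one _ _
  tri h h' := P.tri (by rw [← mul_add, h]) h'
  adj x := P.adj (3 * x)
  le_r := P.le_r
  le_p := P.le_p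
  big := P.big
  cap c := by
    rw [oneDensity_swap, twoDensity_swap, add_comm]
    exact P.cap (2 * c)
  total := by
    rw [oneDensity_swap, twoDensity_swap, sum_double, sum_double, add_comm (∑ c, twoDensity f c)]
    exact P.total

theorem PlaneDensity.fourCells (P : PlaneDensity f r) (x c : ZMod 5) :
    FourCells (f 0 1) (f 0 (-1)) r (f x c) (f x (c + 1)) (f (-x) (-c)) (f (-x) (-(c + 1))) where
  same₁ := P.adj x rfl
  same₂ h h' := (P.adj (-x) (by ring) h' h).symm
  cross₁ := P.tri (by ring) (by ring)
  cross₂ := P.tri (by ring) (by ring)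

theorem PlaneDensity.mixed (P : PlaneDensity f r) {c : ZMod 5} (hU : 0 < oneDensity f c)
    (hW : 0 < twoDensity f c) :
    f 1 c + f (-1) (-c) ≤ 1 ∧ f 2 (2 * c) + f (-2) (-(2 * c)) ≤ 1 ∧
      f 1 c + f (-1) (-c) + f 2 (2 * c) + f (-2) (-(2 * c)) ≤ 8 / 5 ∧
      (f 1 c = 0 ∨ f (-1) (-c) = 0 →
        f 1 c + f (-1) (-c) + f 2 (2 * c) + f (-2) (-(2 * c)) ≤ 6 / 5) ∧
      (f 2 (2 * c) = 0 ∨ f (-2) (-(2 * c)) = 0 →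
        f 1 c + f (-1) (-c) + f 2 (2 * c) + f (-2) (-(2 * c)) ≤ 6 / 5) ∧
      (f 1 c + f (-1) (-c) + f 2 (2 * c) + f (-2) (-(2 * c)) = 8 / 5 →
        f 1 c = 2 / 5 ∧ f (-1) (-c) = 2 / 5 ∧ f 2 (2 * c) = 2 / 5 ∧ f (-2) (-(2 * c)) = 2 / 5) := by
  have e := (by decide : ∀ c : ZMod 5, c + c = 2 * c ∧ 2 * c + 2 * c = -c ∧
    -c + -c = -(2 * c) ∧ -(2 * c) + -(2 * c) = c ∧ c + 2 * c = -(2 * c) ∧ c + -(2 * c) = -c ∧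
    2 * c + -c = c ∧ -(2 * c) + -c = 2 * c) c
  obtain ⟨e1, e2, e3, e4, e5, e6, e7, e8⟩ := e
  refine multiples_bound (P.nonneg _ _) (P.nonneg _ _) (P.nonneg _ _) (P.nonneg _ _) (P.le_one _ _)
    (P.le_one _ _) (P.le_one _ _) (P.le_one _ _) (fun h h' => P.tri (by decide) e1 h h h')
    (fun h h' => P.tri (by decide) e2 h h h') (fun h h' => P.tri (by decide) e3 h h h')
    (fun h h' => P.tri (by decide) e4 h h h') (P.tri (by decide) e5) (P.tri (by decide) e6)
    (P.tri (by decide) e7) (P.tri (by decide) e8) ?_ ?_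
  · by_contra! h
    simp only [oneDensity] at hU
    linarith [h.1, h.2]
  · by_contra! h
    simp only [twoDensity] at hW
    linarith [h.1, h.2]

theorem PlaneDensity.middle (P : PlaneDensity f r) {x z c d e : ZMod 5} (hz : x + x = z)
    (hc : c + d = e) (h1 : 0 < f x c + f (-x) (-c)) (h2 : 0 < f x d + f (-x) (-d))
    (h3 : 0 < f z e + f (-z) (-e)) :
    f x c + f (-x) (-c) + (f x d + f (-x) (-d)) ≤ 2 ∧
      f x c + f (-x) (-c) + (f z e + f (-z) (-e)) ≤ 2 ∧
      f x d + f (-x) (-d) + (f z e + f (-z) (-e)) ≤ 2 ∧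
      (f x c + f (-x) (-c) + (f x d + f (-x) (-d)) + (f z e + f (-z) (-e)) ≤ 12 / 5 ∨
        ((f x c = 0 ∨ f (-x) (-c) = 0) ∧ (f x d = 0 ∨ f (-x) (-d) = 0))) := by
  subst hz hc
  apply middle_bound <;> first
    | exact P.nonneg _ _
    | exact P.le_one _ _
    | exact P.tri (by ring) (by ring)
    | exact fun a b c => P.tri (by ring) (by ring) c b a
    | exact fun a b c => P.tri (by ring) (by ring) c a b
    | by_contra! h; linarith [h.1, h.2]

/-- The four cells of two adjacent pairs have total density at most `2 * σ`. -/
def AdjacentBound (f : ZMod 5 → ZMod 5 → ℚ) (σ : ℚ) : Prop :=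
  ∀ x c, (0 < f x c ∨ 0 < f (-x) (-c)) → (0 < f x (c + 1) ∨ 0 < f (-x) (-(c + 1))) →
    f x c + f x (c + 1) + f (-x) (-c) + f (-x) (-(c + 1)) ≤ 2 * σ

theorem pos_or_pos_of_add_pos {a b : ℚ} (h : 0 < a + b) : 0 < a ∨ 0 < b := by
  by_contra! h'
  linarith [h'.1, h'.2]

theorem PlaneDensity.classRules (P : PlaneDensity f r) {σ : ℚ} (hσ : AdjacentBound f σ) :
    ClassRules σ (oneDensity f) (twoDensity f) where
  nonnegU c := by have := P.nonneg 1 c; have := P.nonneg (-1) (-c); unfold oneDensity; linarith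
  nonnegW c := by
    have := P.nonneg 2 (2 * c); have := P.nonneg (-2) (-(2 * c)); unfold twoDensity; linarith
  oneU c := by have := P.le_one 1 c; have := P.le_one (-1) (-c); unfold oneDensity; linarith
  oneW c := by
    have := P.le_one 2 (2 * c); have := P.le_one (-2) (-(2 * c)); unfold twoDensity; linarith
  adjU c d h h1 h2 := by
    subst h
    unfold oneDensity at *
    have := hσ 1 c (pos_or_pos_of_add_pos (by linarith)) (pos_or_pos_of_add_pos (by linarith))
    linarith
  adjW c d h h1 h2 := by
    have e : 2 * d + 1 = 2 * c := by
      subst h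
      exact (by decide : ∀ c : ZMod 5, 2 * (c + 2) + 1 = 2 * c) c
    unfold twoDensity at *
    have := hσ 2 (2 * d)
    rw [e] at this
    have := this (pos_or_pos_of_add_pos (by linarith)) (pos_or_pos_of_add_pos (by linarith))
    linarith
  mixed c h1 h2 := by
    have := P.mixed h1 h2
    unfold oneDensity twoDensity
    refine ⟨?_, ?_, ?_⟩ <;> linarith
  midU c d e h h1 h2 h3 := by
    have key := P.middle (x := 1) (z := 2) (by decide) h (by unfold oneDensity at h1; linarith)
      (by unfold oneDensity at h2; linarith) (by unfold twoDensity at h3; linarith)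
    have m1 := fun h => P.mixed (c := c) h1 h
    have m2 := fun h => P.mixed (c := d) h2 h
    unfold oneDensity twoDensity at *
    obtain ⟨k1, k2, k3, k4⟩ := key
    refine ⟨by linarith, by linarith, by linarith, ?_⟩
    rcases k4 with k4 | ⟨k4, k5⟩
    · left; linarith
    · right
      constructor <;> intro h
      · linarith [(m1 h).2.2.2.1 k4]
      · linarith [(m2 h).2.2.2.1 k5]
  midW c d e h h1 h2 h3 := by
    have he : 2 * c + 2 * d = -e := by
      rw [← mul_add, h]
      exact (by decide : ∀ c : ZMod 5, 2 * (2 * c) = -c) e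
    have key := P.middle (x := 2) (z := -1) (by decide) he (by unfold twoDensity at h1; linarith)
      (by unfold twoDensity at h2; linarith)
      (by unfold oneDensity at h3; rw [neg_neg, neg_neg]; linarith)
    rw [neg_neg, neg_neg] at key
    have m1 := fun h => P.mixed (c := c) h h1
    have m2 := fun h => P.mixed (c := d) h h2
    unfold oneDensity twoDensity at *
    obtain ⟨k1, k2, k3, k4⟩ := key
    refine ⟨by linarith, by linarith, by linarith, ?_⟩
    rcases k4 with k4 | ⟨k4, k5⟩
    · left; linarith
    · right
      constructor <;> intro h
      · linarith [(m1 h).2.2.2.2.1 k4]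
      · linarith [(m2 h).2.2.2.2.1 k5]

theorem ClassRules.sum_le_of_forall_pos {σ : ℚ} {U W : ZMod 5 → ℚ} (R : ClassRules σ U W)
    (h : ∀ c, 0 < U c) : ∑ c, U c ≤ 5 / 2 * σ := by
  rw [sum_zmod_five]
  linarith [R.adjU 0 1 (by decide) (h 0) (h 1), R.adjU 1 2 (by decide) (h 1) (h 2),
    R.adjU 2 3 (by decide) (h 2) (h 3), R.adjU 3 4 (by decide) (h 3) (h 4),
    R.adjU 4 0 (by decide) (h 4) (h 0)]

theorem ClassRules.sum_le_of_pathSupport {σ : ℚ} {U W : ZMod 5 → ℚ} (R : ClassRules σ U W)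
    {k : ZMod 5} (h : PathSupport U W k) : ∑ c, U c + ∑ c, W c ≤ W (k + 1) + 3 * σ := by
  obtain ⟨⟨u0, u1, u2, u3, u4⟩, w0, w1, w2, w3, w4⟩ := h
  rw [← sum_shift U k, ← sum_shift W k, sum_zmod_five, sum_zmod_five, add_zero]
  linarith [R.adjU (k + 2) (k + 3) (by ring) u2 u3,
    R.adjU (k + 4) k (by linear_combination -five_eq_zero) u4 u0, R.adjW k (k + 2) rfl w0 w2]

theorem TripleSupport.exists_eq {U W : ZMod 5 → ℚ} {k : ZMod 5} (h : TripleSupport U W k) :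
    ∃ a, (a = k + 1 ∨ a = k + 4) ∧ 0 < U a ∧ 0 < U (2 * k - a) ∧ 0 < W a ∧ 
      ∑ c, U c + ∑ c, W c = U a + W a + U (2 * k - a) := by
  obtain ⟨⟨u0, u1, u2, u3, u4⟩, w0, w2, w3, h⟩ := h
  rw [← sum_shift U k, ← sum_shift W k, sum_zmod_five, sum_zmod_five, add_zero]
  rcases h with ⟨w1, w4⟩ | ⟨w1, w4⟩
  · refine ⟨k + 1, Or.inl rfl, u1, ?_⟩
    rw [show 2 * k - (k + 1) = k + 4 by linear_combination -five_eq_zero]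
    exact ⟨u4, w1, by linarith⟩
  · refine ⟨k + 4, Or.inr rfl, u4, ?_⟩
    rw [show 2 * k - (k + 4) = k + 1 by linear_combination -five_eq_zero]
    exact ⟨u1, w4, by linarith⟩

/-- There are two adjacent cells in a row that are not too small. -/
def TiePair (f : ZMod 5 → ZMod 5 → ℚ) : Prop :=
  f 0 1 = 4 / 5 ∧ f 0 (-1) = 4 / 5 ∧ ∃ x c, 0 < f x c ∧ 0 < f x (c + 1) ∧
    6 / 25 < f x c + f x (c + 1)

/-- The four inequalities make four outcomes fall short of 14/5 - M: small total, path, one full row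
with the other sum at most 1, and two full rows. For σ = 2/5 the second one becomes an equality at M
= 4/5, which is why that value is separate. -/
theorem PlaneDensity.zone_of_ne (P : PlaneDensity f r) {M : ℚ} (hM : 2 * M = f 0 1 + f 0 (-1))
    (h : 3 / 5 < M) (h' : M ≠ 4 / 5) : ∃ σ, 1 / 5 ≤ σ ∧ σ ≤ 1 / 2 ∧ AdjacentBound f σ ∧
      3 / 2 + σ < 14 / 5 - M ∧ M + 3 * σ < 14 / 5 - M ∧ 5 / 2 * σ + 1 < 14 / 5 - M ∧
      5 * σ < 14 / 5 - M := by
  have h1 := P.le_one 0 1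
  have h2 := P.le_r
  have h3 := P.le_p
  rcases lt_or_gt_of_ne h' with h' | h'
  -- σ is the larger of 2/5 and 26/25 - M, the two bounds of `FourCells.middle`.
  · rcases le_total (13 / 25 - M / 2) (1 / 5) with h4 | h4
    · refine ⟨2 / 5, by norm_num, by norm_num, fun x c hb hc => ?_, by linarith, by linarith,
        by linarith, by linarith⟩
      rcases (P.fourCells x c).middle h2 h3 h1 (by linarith) (by linarith) (P.nonneg _ _)
        (P.nonneg _ _) (P.nonneg _ _) (P.nonneg _ _) hb hc with h5 | h5 <;> linarith
    · refine ⟨26 / 25 - M, by linarith, by linarith, fun x c hb hc => ?_, by linarith, by linarith,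
        by linarith, by linarith⟩
      rcases (P.fourCells x c).middle h2 h3 h1 (by linarith) (by linarith) (P.nonneg _ _)
        (P.nonneg _ _) (P.nonneg _ _) (P.nonneg _ _) hb hc with h5 | h5 <;> linarith
  · refine ⟨6 / 25, by norm_num, by norm_num, fun x c hb hc => ?_, by linarith, by linarith,
      by linarith, by linarith⟩
    have := (P.fourCells x c).high h2 h3 h1 (by linarith) (P.nonneg _ _)
        (P.nonneg _ _) (P.nonneg _ _) (P.nonneg _ _) hb hc
    linarith

theorem PlaneDensity.zone_tie (P : PlaneDensity f r) (hM : f 0 1 + f 0 (-1) = 8 / 5) :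
    AdjacentBound f (3 / 10) ∨ (TiePair f ∧ AdjacentBound f (2 / 5) ∧ ∀ x c,
      f x c + f x (c + 1) + f (-x) (-c) + f (-x) (-(c + 1)) = 4 / 5 → 
      (0 < f x c ∨ 0 < f (-x) (-c)) → (0 < f x (c + 1) ∨ 0 < f (-x) (-(c + 1))) →
      f x c = 1 / 5 ∧ f x (c + 1) = 1 / 5 ∧ f (-x) (-c) = 1 / 5 ∧ f (-x) (-(c + 1)) = 1 / 5) := by
  have key := fun x c => (P.fourCells x c).tie P.le_r P.le_p (P.le_one _ _) hM (P.nonneg _ _)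
        (P.nonneg _ _) (P.nonneg _ _) (P.nonneg _ _)
  rw [or_iff_not_imp_left]
  intro h
  simp only [AdjacentBound] at h
  push Not at h
  obtain ⟨x, c, hb, hc, h⟩ := h
  refine ⟨?_, fun x c hb hc => ?_, fun x c h hb hc => ?_⟩
  · rcases key x c hb hc with h1 | ⟨h1, -, -, h2⟩
    · linarith
    · refine ⟨h1, by linarith, ?_⟩
      rcases h2 with ⟨h3, h4, h5⟩ | ⟨h3, h4, h5⟩
      · exact ⟨x, c, h3, h4, h5⟩
      · have e : -(c + 1) + 1 = -c := by ring
        refine ⟨-x, -(c + 1), h4, ?_, ?_⟩ <;> rw [e]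
        · exact h3
        · linarith
  · rcases key x c hb hc with h1 | ⟨h1, h2, -⟩ <;> linarith
  · rcases key x c hb hc with h1 | ⟨h1, h2, h3, -⟩
    · linarith
    · obtain ⟨a, b, c, d⟩ := h3 h
      exact ⟨a, b, c, d⟩

theorem PlaneDensity.zone_low (P : PlaneDensity f r) : AdjacentBound f (1 / 2) := by
  intro x c hb hc
  have := (P.fourCells x c).low P.le_r P.le_p (P.le_one _ _) P.big (P.nonneg _ _)
        (P.nonneg _ _) (P.nonneg _ _) (P.nonneg _ _) hb hc
  linarith

/-- For M ≤ 3/5 only σ = 1/2 is available, and the resulting bound 5σ/2 for a full row is too weak;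
the rows are estimated directly as cyclic sequences. -/
theorem PlaneDensity.low_full (P : PlaneDensity f r) {M : ℚ} (hM : 2 * M = f 0 1 + f 0 (-1))
    (h : M ≤ 3 / 5) (hf : ∀ c, 0 < oneDensity f c) : 2 * ∑ c, oneDensity f c < 14 / 5 - M := by
  have := full_rows_lt (X := fun c => f 1 c) (Y := fun c => f (-1) (-c)) (M := M) (p := f 0 1)
    (by linarith [P.big]) h (by linarith [P.le_p]) P.le_r (fun _ => P.nonneg _ _)
    (fun _ => P.nonneg _ _) (fun c d h => P.adj 1 h)
    (fun c d h h1 h2 => (P.adj (-1) (by rw [h]; ring) h2 h1).symm)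
    (fun c d h h1 h2 => P.tri (by ring) (by rw [h]; ring) h1 h2 (by linarith [P.big, P.le_p]))
    (fun c => pos_or_pos_of_add_pos (by have := hf c; unfold oneDensity at this; linarith))
  simp only [oneDensity, ← Finset.sum_div, Finset.sum_add_distrib]
  linarith

/-- The exceptional configurations of densities. -/
def Exceptional (f : ZMod 5 → ZMod 5 → ℚ) : Prop :=
  -- The two alternatives with `TiePair` turn out to be impossible; the third is the density profile
  -- of Λ.
  (TiePair f ∧ (∀ c, 0 < oneDensity f c) ∧ 1 ≤ ∑ c, oneDensity f c) ∨
  (TiePair f ∧ ∃ k, oneDensity f (k + 1) = 0 ∧ (∀ c, c = k ∨ c = k + 2 ∨ c = k + 3 ∨ c = k + 4 →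
      f 1 c = 1 / 5 ∧ f (-1) (-c) = 1 / 5) ∧ (∀ c, c = k ∨ c = k + 2 →
      f 2 (2 * c) = 1 / 5 ∧ f (-2) (-(2 * c)) = 1 / 5) ∧
      f 2 (2 * (k + 1)) + f (-2) (-(2 * (k + 1))) = 8 / 5) ∨
  (f 0 1 = 1 ∧ f 0 (-1) = 1 ∧ ∃ k a, (a = k + 1 ∨ a = k + 4) ∧
    TripleSupport (oneDensity f) (twoDensity f) k ∧
    f 1 a = 2 / 5 ∧ f (-1) (-a) = 2 / 5 ∧ f 2 (2 * a) = 2 / 5 ∧ f (-2) (-(2 * a)) = 2 / 5 ∧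
    f 1 (2 * k - a) = 1 ∧ f (-1) (-(2 * k - a)) = 1 ∧
    ∑ c, oneDensity f c + ∑ c, twoDensity f c = 9 / 5)

/-- U a + W a ≤ 4/5, U ≤ 1 at the other point and M ≤ 1 add up to exactly 14/5, so the size of A
forces equality in each. -/
theorem PlaneDensity.exceptional_of_tripleSupport (P : PlaneDensity f r) {σ : ℚ}
    (hσ : AdjacentBound f σ) {k : ZMod 5}
    (h : TripleSupport (oneDensity f) (twoDensity f) k) : Exceptional f := by
  obtain ⟨a, ha, u1, u2, w, hs⟩ := h.exists_eq
  have R := P.classRules hσ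
  have t := P.total
  have h1 := P.mixed u1 w
  have h2 := R.mixed a u1 w
  have h3 := R.oneU (2 * k - a)
  have h4 := P.le_one 0 1
  have h5 := P.le_one 0 (-1)
  have h6 : oneDensity f (2 * k - a) = 1 := by linarith
  have h7 : oneDensity f a + twoDensity f a = 4 / 5 := by linarith
  have h8 := P.le_one 1 (2 * k - a)
  have h9 := P.le_one (-1) (-(2 * k - a))
  have h10 : f 1 a + f (-1) (-a) + f 2 (2 * a) + f (-2) (-(2 * a)) = 8 / 5 := by
    unfold oneDensity twoDensity at h7; linarith
  obtain ⟨c1, c2, c3, c4⟩ := h1.2.2.2.2.2 h10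
  unfold oneDensity at h6
  exact Or.inr (Or.inr ⟨by linarith, by linarith, k, a, ha, h, c1, c2, c3, c4, by linarith,
    by linarith, by linarith⟩)

theorem PlaneDensity.exceptional_of_zone (P : PlaneDensity f r) {M σ : ℚ}
    (hM : 2 * M = f 0 1 + f 0 (-1)) (h1 : 1 / 5 ≤ σ) (h2 : σ ≤ 1 / 2) (hσ : AdjacentBound f σ)
    (h3 : 3 / 2 + σ < 14 / 5 - M) (h4 : M + 3 * σ < 14 / 5 - M)
    (h5 : (∀ c, 0 < oneDensity f c) → ∑ c, oneDensity f c + 1 < 14 / 5 - M ∧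
      2 * ∑ c, oneDensity f c < 14 / 5 - M)
    (h6 : (∀ c, 0 < twoDensity f c) → ∑ c, twoDensity f c + 1 < 14 / 5 - M ∧
      2 * ∑ c, twoDensity f c < 14 / 5 - M) :
    NormalSupport (oneDensity f) (twoDensity f) ∨ Exceptional f ∨
      Exceptional fun x y => f (3 * x) y := by
  have R := P.classRules hσ
  have t := P.total
  have swσ : AdjacentBound (fun x y => f (3 * x) y) σ := fun x c => by
    have := hσ (3 * x) c
    rwa [← mul_neg] at this
  rcases R.outcome h1 h2 with h | h | ⟨h, h'⟩ | ⟨h, h'⟩ | ⟨k, h⟩ | ⟨k, h⟩ | ⟨k, h⟩ | ⟨k, h⟩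
  · exact Or.inl h
  · linarith
  · have g1 := h5 h
    rcases h' with h' | h'
    · linarith
    · linarith [h6 h']
  · have g1 := h6 h
    rcases h' with h' | h'
    · linarith
    · linarith [h5 h']
  · linarith [R.sum_le_of_pathSupport h, P.cap (k + 1), R.nonnegU (k + 1)]
  · have := R.swap.sum_le_of_pathSupport h
    rw [sum_double, sum_double] at this
    linarith [P.cap (2 * (k + 1)), R.nonnegW (2 * (k + 1))]
  · exact Or.inr (Or.inl (P.exceptional_of_tripleSupport hσ h))
  · refine Or.inr (Or.inr (P.swap.exceptional_of_tripleSupport swσ (k := k) ?_))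
    rwa [oneDensity_swap, twoDensity_swap]

/-- Three disjoint edges contribute at most 2/5 each and `cap` allows 4/5 at k + 1. The sum is
exactly 14/5 - 4/5, so all four bounds are attained. -/
theorem PlaneDensity.exceptional_of_pathSupport (P : PlaneDensity f r)
    (hM : f 0 1 + f 0 (-1) = 8 / 5) (hT : TiePair f) (hσ : AdjacentBound f (2 / 5))
    (heq : ∀ x c, f x c + f x (c + 1) + f (-x) (-c) + f (-x) (-(c + 1)) = 4 / 5 → 
      (0 < f x c ∨ 0 < f (-x) (-c)) → (0 < f x (c + 1) ∨ 0 < f (-x) (-(c + 1))) →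
      f x c = 1 / 5 ∧ f x (c + 1) = 1 / 5 ∧ f (-x) (-c) = 1 / 5 ∧ f (-x) (-(c + 1)) = 1 / 5)
    {k : ZMod 5} (h : PathSupport (oneDensity f) (twoDensity f) k) : Exceptional f := by
  have R := P.classRules hσ
  have t := P.total
  obtain ⟨⟨u0, u1, u2, u3, u4⟩, w0, w1, w2, w3, w4⟩ := h
  rw [← sum_shift _ k, ← sum_shift (twoDensity f) k, sum_zmod_five, sum_zmod_five, add_zero] at t
  have c5 : k + 4 + 1 = k := by linear_combination five_eq_zero
  have a1 := R.adjU (k + 2) (k + 3) (by ring) u2 u3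
  have a2 := R.adjU (k + 4) k c5.symm u4 u0
  have a3 := R.adjW k (k + 2) rfl w0 w2
  have a4 := P.cap (k + 1)
  have e1 := heq 1 (k + 2)
  have e2 := heq 1 (k + 4)
  have e3 := heq 2 (2 * (k + 2))
  rw [show k + 2 + 1 = k + 3 by ring] at e1
  rw [c5] at e2
  rw [show 2 * (k + 2) + 1 = 2 * k by linear_combination five_eq_zero] at e3
  have b1 : oneDensity f (k + 2) + oneDensity f (k + 3) = 2 / 5 := by linarith
  have b2 : oneDensity f (k + 4) + oneDensity f k = 2 / 5 := by linarith
  have b3 : twoDensity f k + twoDensity f (k + 2) = 2 / 5 := by linarith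
  have b4 : twoDensity f (k + 1) = 4 / 5 := by linarith
  refine Or.inr (Or.inl ⟨hT, k, u1, ?_⟩)
  unfold oneDensity twoDensity at *
  obtain ⟨p1, p2, p3, p4⟩ := e1 (by linarith) (pos_or_pos_of_add_pos (by linarith))
    (pos_or_pos_of_add_pos (by linarith))
  obtain ⟨q1, q2, q3, q4⟩ := e2 (by linarith) (pos_or_pos_of_add_pos (by linarith))
    (pos_or_pos_of_add_pos (by linarith))
  obtain ⟨s1, s2, s3, s4⟩ := e3 (by linarith) (pos_or_pos_of_add_pos (by linarith))
    (pos_or_pos_of_add_pos (by linarith))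
  refine ⟨?_, ?_, by linarith⟩
  · rintro c (rfl | rfl | rfl | rfl)
    exacts [⟨q2, q4⟩, ⟨p1, p3⟩, ⟨p2, p4⟩, ⟨q1, q3⟩]
  · rintro c (rfl | rfl)
    exacts [⟨s2, s4⟩, ⟨s1, s3⟩]

theorem PlaneDensity.exceptional_of_tie (P : PlaneDensity f r)
    (hM : f 0 1 + f 0 (-1) = 8 / 5) (hT : TiePair f) (hσ : AdjacentBound f (2 / 5))
    (heq : ∀ x c, f x c + f x (c + 1) + f (-x) (-c) + f (-x) (-(c + 1)) = 4 / 5 → 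
      (0 < f x c ∨ 0 < f (-x) (-c)) → (0 < f x (c + 1) ∨ 0 < f (-x) (-(c + 1))) →
      f x c = 1 / 5 ∧ f x (c + 1) = 1 / 5 ∧ f (-x) (-c) = 1 / 5 ∧ f (-x) (-(c + 1)) = 1 / 5) :
    NormalSupport (oneDensity f) (twoDensity f) ∨ Exceptional f ∨
      Exceptional fun x y => f (3 * x) y := by
  have R := P.classRules hσ
  have t := P.total
  have neg : ∀ x : ZMod 5, -(3 * x) = 3 * -x := fun x => (mul_neg 3 x).symm
  have swσ : AdjacentBound (fun x y => f (3 * x) y) (2 / 5) := fun x c => by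
    have := hσ (3 * x) c
    rwa [neg] at this
  have swT : TiePair fun x y => f (3 * x) y := by
    obtain ⟨h1, h2, x, c, h⟩ := hT
    refine ⟨h1, h2, 2 * x, c, ?_⟩
    simpa only [(by decide : ∀ x : ZMod 5, 3 * (2 * x) = x) x] using h
  rcases R.outcome (by norm_num) (by norm_num) with
    h | h | ⟨h, h'⟩ | ⟨h, h'⟩ | ⟨k, h⟩ | ⟨k, h⟩ | ⟨k, h⟩ | ⟨k, h⟩
  · exact Or.inl h
  · linarith
  · refine Or.inr (Or.inl (Or.inl ⟨hT, h, ?_⟩))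
    rcases h' with h' | h'
    · linarith
    · have := R.swap.sum_le_of_forall_pos fun c => h' (2 * c)
      rw [sum_double] at this
      linarith
  · refine Or.inr (Or.inr (Or.inl ⟨swT, ?_⟩))
    rw [oneDensity_swap, sum_double]
    refine ⟨fun c => h (2 * c), ?_⟩
    rcases h' with h' | h'
    · linarith
    · have := R.sum_le_of_forall_pos h'
      linarith
  · exact Or.inr (Or.inl (P.exceptional_of_pathSupport hM hT hσ heq h))
  · refine Or.inr (Or.inr (P.swap.exceptional_of_pathSupport hM swT swσ (k := k) ?_ ?_))
    · intro x c
      have := heq (3 * x) c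
      rwa [neg] at this
    · rwa [oneDensity_swap, twoDensity_swap]
  · exact Or.inr (Or.inl (P.exceptional_of_tripleSupport hσ h))
  · refine Or.inr (Or.inr (P.swap.exceptional_of_tripleSupport swσ (k := k) ?_))
    rwa [oneDensity_swap, twoDensity_swap]

theorem PlaneDensity.outcome (P : PlaneDensity f r) :
    NormalSupport (oneDensity f) (twoDensity f) ∨ Exceptional f ∨
      Exceptional fun x y => f (3 * x) y := by
  obtain ⟨M, hM⟩ : ∃ M, 2 * M = f 0 1 + f 0 (-1) :=
    ⟨(f 0 1 + f 0 (-1)) / 2, by ring⟩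
  have hbig := P.big
  rcases le_or_gt M (3 / 5) with h | h
  · refine P.exceptional_of_zone hM (by norm_num) le_rfl P.zone_low (by linarith) (by linarith) ?_ ?_
    · intro hf
      have := P.low_full hM h hf
      exact ⟨by linarith, this⟩
    · intro hf
      have := P.swap.low_full hM h (by rw [oneDensity_swap]; exact fun c => hf _)
      rw [oneDensity_swap, sum_double] at this
      exact ⟨by linarith, this⟩
  by_cases h45 : M = 4 / 5
  · rcases P.zone_tie (by linarith) with h' | ⟨hT, hσ, heq⟩
    · have R := P.classRules h'
      refine P.exceptional_of_zone hM (by norm_num) (by norm_num) h' (by linarith) (by linarith)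
        (fun hf => ?_) (fun hf => ?_)
      · have := R.sum_le_of_forall_pos hf
        constructor <;> linarith
      · have := R.swap.sum_le_of_forall_pos fun c => hf (2 * c)
        rw [sum_double] at this
        constructor <;> linarith
    · exact P.exceptional_of_tie (by linarith) hT hσ heq
  · obtain ⟨σ, h1, h2, h3, h4, h5, h6, h7⟩ := P.zone_of_ne hM h h45
    have R := P.classRules h3
    refine P.exceptional_of_zone hM h1 h2 h3 h4 h5 (fun hf => ?_) (fun hf => ?_)
    · have := R.sum_le_of_forall_pos hf
      constructor <;> linarith
    · have := R.swap.sum_le_of_forall_pos fun c => hf (2 * c)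
      rw [sum_double] at this
      constructor <;> linarith

end PlaneOutcome

theorem fact_prime_five : Fact (Nat.Prime 5) := ⟨Nat.prime_five⟩

attribute [local instance] fact_prime_five

/-! ### Fibers of functionals and the densest hyperplane section -/

section Counting

variable {V : Type*} [AddCommGroup V] [Module (ZMod 5) V] [Fintype V] [DecidableEq V]

theorem card_fiber_mul {M : Type*} [AddCommGroup M] [Fintype M] [DecidableEq M] (φ : V →+ M)
    (hφ : Function.Surjective φ) (w : M) :
    #(univ.filter fun v => φ v = w) * Fintype.card M = Fintype.card V := by
  have h := Finset.card_eq_sum_card_fiberwise (f := φ) (s := univ) (t := univ)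
    (fun _ _ => Finset.mem_coe.2 (Finset.mem_univ _))
  rw [Finset.sum_congr rfl fun m _ => AddMonoidHom.card_fiber_eq_of_mem_range φ (hφ m) (hφ w),
    Finset.sum_const, smul_eq_mul, Finset.card_univ, Finset.card_univ] at h
  rw [h, mul_comm]

theorem card_fiber_one {ξ : V →ₗ[ZMod 5] ZMod 5} (h : ξ ≠ 0) (x : ZMod 5) :
    5 * #(univ.filter fun v => ξ v = x) = Fintype.card V := by
  have := card_fiber_mul ξ.toAddMonoidHom (LinearMap.surjective (f := ξ) h) x
  rw [ZMod.card, mul_comm] at this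
  exact this

theorem card_fiber_two {ξ η : V →ₗ[ZMod 5] ZMod 5} (h : ∀ x y, ∃ v, ξ v = x ∧ η v = y)
    (x y : ZMod 5) : 25 * #(univ.filter fun v => ξ v = x ∧ η v = y) = Fintype.card V := by
  have := card_fiber_mul (ξ.prod η).toAddMonoidHom
    (fun p => (h p.1 p.2).imp fun v hv => Prod.ext hv.1 hv.2) (x, y)
  rw [Fintype.card_prod, ZMod.card, mul_comm] at this
  simpa only [LinearMap.toAddMonoidHom_coe, LinearMap.prod_apply, Function.prod, Prod.mk.injEq] using this

theorem card_fiber_three {ξ η θ : V →ₗ[ZMod 5] ZMod 5}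
    (h : ∀ x y z, ∃ v, ξ v = x ∧ η v = y ∧ θ v = z) (x y z : ZMod 5) :
    125 * #(univ.filter fun v => ξ v = x ∧ η v = y ∧ θ v = z) = Fintype.card V := by
  have := card_fiber_mul (ξ.prod (η.prod θ)).toAddMonoidHom
    (fun p => (h p.1 p.2.1 p.2.2).imp fun v hv =>
      Prod.ext hv.1 (Prod.ext hv.2.1 hv.2.2)) (x, y, z)
  rw [Fintype.card_prod, Fintype.card_prod, ZMod.card, mul_comm] at this
  simpa only [LinearMap.toAddMonoidHom_coe, LinearMap.prod_apply, Function.prod, Prod.mk.injEq] using this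

/-- Two functionals are jointly surjective as soon as one does not vanish on the kernel of the
other one, which is proper. -/
theorem jointly_surjective_two {ξ η : V →ₗ[ZMod 5] ZMod 5} {b a : V} (hb : ξ b ≠ 0) (ha : ξ a = 0)
    (ha' : η a ≠ 0) (x y : ZMod 5) : ∃ v, ξ v = x ∧ η v = y := by
  refine ⟨(x / ξ b) • b + ((y - x / ξ b * η b) / η a) • a, ?_, ?_⟩
  · simp [ha, hb]
  · simp only [map_add, map_smul, smul_eq_mul]
    field_simp
    ring

theorem jointly_surjective_three {ξ η θ : V →ₗ[ZMod 5] ZMod 5}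
    (h : ∀ x y, ∃ v, ξ v = x ∧ η v = y) {a : V} (h1 : ξ a = 0) (h2 : η a = 0) (h3 : θ a ≠ 0)
    (x y z : ZMod 5) : ∃ v, ξ v = x ∧ η v = y ∧ θ v = z := by
  obtain ⟨v, hx, hy⟩ := h x y
  refine ⟨v + ((z - θ v) / θ a) • a, ?_, ?_, ?_⟩
  · simp [h1, hx]
  · simp [h2, hy]
  · simp only [map_add, map_smul, smul_eq_mul]
    field_simp
    ring

/-- The intersection of the kernels of two functionals. -/
def planeKer (ξ η : V →ₗ[ZMod 5] ZMod 5) : AddSubgroup V := (LinearMap.ker ξ ⊓ LinearMap.ker η).toAddSubgroup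

theorem mem_planeKer {ξ η : V →ₗ[ZMod 5] ZMod 5} {v : V} : v ∈ planeKer ξ η ↔ ξ v = 0 ∧ η v = 0 := by
  simp [planeKer]

theorem card_planeKer {ξ η : V →ₗ[ZMod 5] ZMod 5} {N : ℕ} (h : ∀ x y, ∃ v, ξ v = x ∧ η v = y)
    (hN : 25 * N = Fintype.card V) : Nat.card (planeKer ξ η) = N := by
  have := card_fiber_two h 0 0
  have h1 : #(univ.filter fun v => ξ v = 0 ∧ η v = 0) = Nat.card (planeKer ξ η) :=
    le_antisymm (card_le_natCard_of_subset (by simp [mem_planeKer]))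
      (natCard_le_card_of_subset (by simp [mem_planeKer]))
  omega

theorem index_cases {H K : AddSubgroup V} (h : H < K) :
    ∃ t, Nat.card K = t * Nat.card H ∧ (t = 5 ∨ t = 25 ∨ 125 ≤ t) := by
  obtain ⟨t, ht⟩ := AddSubgroup.card_dvd_of_le h.le
  have hpos : 0 < Nat.card K := Nat.card_pos
  have hK : Nat.card K ∣ 5 ^ Module.finrank (ZMod 5) V := by
    have := AddSubgroup.card_addSubgroup_dvd_card K
    rwa [Nat.card_eq_fintype_card (α := V), Module.card_eq_pow_finrank (K := ZMod 5),
      ZMod.card] at this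
  obtain ⟨k, -, hk⟩ := (Nat.dvd_prime_pow Nat.prime_five).1 ((Dvd.intro_left _ ht.symm).trans hK)
  refine ⟨t, by rw [ht, mul_comm], ?_⟩
  subst hk
  have h1 : k ≠ 0 := by
    rintro rfl
    rw [pow_zero, mul_one] at ht
    exact h.ne (AddSubgroup.eq_of_le_of_card_ge h.le ht.le)
  rcases k with _ | _ | _ | k
  · exact absurd rfl h1
  · left; rfl
  · right; left; rfl
  · right; right
    have : 0 < 5 ^ k := by positivity
    rw [pow_add]
    omega

/-- Kneser's theorem for subsets of three fibers of a plane. -/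
theorem exists_index_cosets_le {ξ η : V →ₗ[ZMod 5] ZMod 5} {N : ℕ}
    (h : ∀ x y, ∃ v, ξ v = x ∧ η v = y) (hN : 25 * N = Fintype.card V) {B C D : Finset V}
    {x y x' y' x'' y'' : ZMod 5} (hx : x + x' = x'') (hy : y + y' = y'')
    (hB : ∀ v ∈ B, ξ v = x ∧ η v = y) (hC : ∀ v ∈ C, ξ v = x' ∧ η v = y')
    (hD : ∀ v ∈ D, ξ v = x'' ∧ η v = y'') (nB : B.Nonempty) (nC : C.Nonempty) (nD : D.Nonempty)
    (hdisj : ∀ b ∈ B, ∀ c ∈ C, b + c ∉ D) :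
    ∃ H < planeKer ξ η, ∃ t, N = t * Nat.card H ∧ (t = 5 ∨ t = 25 ∨ 125 ≤ t) ∧
      cosets H B + cosets H C + cosets H D ≤ t + 1 := by
  obtain ⟨H, hlt, hH⟩ := exists_lt_cosets_add_le (planeKer ξ η) nB nC nD
    (fun b hb b' hb' => by
      rw [mem_planeKer, map_sub, map_sub, (hB b hb).1, (hB b hb).2, (hB b' hb').1, (hB b' hb').2]
      simp)
    (fun b hb b' hb' => by
      rw [mem_planeKer, map_sub, map_sub, (hC b hb).1, (hC b hb).2, (hC b' hb').1, (hC b' hb').2]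
      simp)
    (fun b hb c hc d hd => by
      rw [mem_planeKer, map_sub, map_sub, map_add, map_add, (hB b hb).1, (hB b hb).2, (hC c hc).1,
        (hC c hc).2, (hD d hd).1, (hD d hd).2, hx, hy]
      simp) hdisj
  obtain ⟨t, ht, ht'⟩ := index_cases hlt
  refine ⟨H, hlt, t, by rw [← ht, card_planeKer h hN], ht', ?_⟩
  rw [ht] at hH
  refine Nat.le_of_mul_le_mul_right ?_ (Nat.card_pos (α := H))
  rwa [add_mul t, one_mul]

theorem mul_div_le_cosets {H : AddSubgroup V} {t N : ℕ} (hN : N = t * Nat.card H) (hpos : 0 < N)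
    (S : Finset V) : (t : ℚ) * (#S / N) ≤ cosets H S := by
  have h1 : (#S : ℚ) ≤ cosets H S * Nat.card H := by exact_mod_cast card_le_cosets_mul H S
  have hN' : (N : ℚ) = t * Nat.card H := by exact_mod_cast hN
  have hpos' : (0 : ℚ) < N := by exact_mod_cast hpos
  rw [← mul_div_assoc, div_le_iff₀ hpos', hN']
  have : (0 : ℚ) ≤ t := by positivity
  nlinarith

/-- The six hyperplanes through {ξ = ζ = 0}: a point of this subspace lies on all of them, any other
point on exactly one. -/
theorem card_filter_add_card_filter_pencil (A : Finset V) (ξ ζ : V →ₗ[ZMod 5] ZMod 5) :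
    #A + 5 * #(A.filter fun a => ξ a = 0 ∧ ζ a = 0) =
      #(A.filter fun a => ξ a = 0) + ∑ k : ZMod 5, #(A.filter fun a => (ζ - k • ξ) a = 0) := by
  simp only [Finset.card_filter, Finset.card_eq_sum_ones A]
  rw [Finset.sum_comm, Finset.mul_sum, ← Finset.sum_add_distrib, ← Finset.sum_add_distrib]
  refine Finset.sum_congr rfl fun a _ => ?_
  simp only [LinearMap.sub_apply, LinearMap.smul_apply, smul_eq_mul]
  exact (by decide : ∀ x z : ZMod 5, (1 + 5 * if x = 0 ∧ z = 0 then 1 else 0) =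
    (if x = 0 then 1 else 0) + ∑ k : ZMod 5, if z - k * x = 0 then 1 else 0) (ξ a) (ζ a)

/-- The elements of `A` over a point of a plane. -/
def cell (A : Finset V) (ξ η : V →ₗ[ZMod 5] ZMod 5) (x y : ZMod 5) : Finset V :=
  A.filter fun a => ξ a = x ∧ η a = y

theorem mem_cell {A : Finset V} {ξ η : V →ₗ[ZMod 5] ZMod 5} {x y : ZMod 5} {v : V} :
    v ∈ cell A ξ η x y ↔ v ∈ A ∧ ξ v = x ∧ η v = y := Finset.mem_filter

/-- A sum-free set together with a densest hyperplane section `ξ = 0`, on which `η = ± 1`. -/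
structure Pivot (A : Finset V) (ξ η : V →ₗ[ZMod 5] ZMod 5) (N : ℕ) : Prop where
  sumFree : IsSumFree A
  card : 25 * N = Fintype.card V
  ne_zero : ξ ≠ 0
  size : 28 * N ≤ 5 * #A
  max : ∀ χ : V →ₗ[ZMod 5] ZMod 5, χ ≠ 0 → #(A.filter fun a => χ a = 0) ≤ #(A.filter fun a => ξ a = 0)
  pm : ∀ a ∈ A, ξ a = 0 → η a = 1 ∨ η a = -1
  big : 28 * N < 25 * #(A.filter fun a => ξ a = 0)
  le : #(cell A ξ η 0 (-1)) ≤ #(cell A ξ η 0 1)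

variable {A : Finset V} {ξ η : V →ₗ[ZMod 5] ZMod 5} {N : ℕ}

theorem Pivot.surj (P : Pivot A ξ η N) : ∀ x y, ∃ v, ξ v = x ∧ η v = y := by
  obtain ⟨b, hb⟩ : ∃ b, ξ b ≠ 0 := by
    by_contra! h
    exact P.ne_zero (LinearMap.ext h)
  have : 0 < #(A.filter fun a => ξ a = 0) := by have := P.big; omega
  obtain ⟨a, ha⟩ := Finset.card_pos.1 this
  rw [Finset.mem_filter] at ha
  exact jointly_surjective_two hb ha.2 (by
    rcases P.pm a ha.1 ha.2 with h | h <;> rw [h] <;> decide)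

theorem Pivot.pos (P : Pivot A ξ η N) : 0 < N := by
  have := P.card
  have : 0 < Fintype.card V := Fintype.card_pos
  omega

/-- The density of a cell. -/
def density (A : Finset V) (ξ η : V →ₗ[ZMod 5] ZMod 5) (N : ℕ) (x y : ZMod 5) : ℚ :=
  (#(cell A ξ η x y) : ℚ) / N

theorem Pivot.density_pos (P : Pivot A ξ η N) {x y : ZMod 5} :
    0 < density A ξ η N x y ↔ (cell A ξ η x y).Nonempty := by
  have : (0 : ℚ) < N := by exact_mod_cast P.pos
  rw [density, ← Finset.card_pos, div_pos_iff_of_pos_right this, Nat.cast_pos]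

theorem Pivot.card_cell_le (P : Pivot A ξ η N) (x y : ZMod 5) : #(cell A ξ η x y) ≤ N := by
  have h1 := card_fiber_two P.surj x y
  have h2 : #(cell A ξ η x y) ≤ #(univ.filter fun v => ξ v = x ∧ η v = y) := by
    apply Finset.card_le_card
    intro v hv
    rw [mem_cell] at hv
    simpa using hv.2
  have := P.card
  omega

theorem Pivot.tri (P : Pivot A ξ η N) {x y x' y' x'' y'' : ZMod 5} (hx : x + x' = x'')
    (hy : y + y' = y'') (h1 : 0 < density A ξ η N x y) (h2 : 0 < density A ξ η N x' y')
    (h3 : 0 < density A ξ η N x'' y'') :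
    KneserTriple (density A ξ η N x y) (density A ξ η N x' y') (density A ξ η N x'' y'') := by
  rw [P.density_pos] at h1 h2 h3
  obtain ⟨H, -, t, ht, ht', hs⟩ := exists_index_cosets_le P.surj P.card hx hy
    (fun v hv => (mem_cell.1 hv).2) (fun v hv => (mem_cell.1 hv).2)
    (fun v hv => (mem_cell.1 hv).2) h1 h2 h3
    (fun b hb c hc hd => P.sumFree b (mem_cell.1 hb).1 c (mem_cell.1 hc).1 _ (mem_cell.1 hd).1 rfl)
  exact ⟨t, _, _, _, ht', cosets_pos H h1, cosets_pos H h2, cosets_pos H h3,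
    mul_div_le_cosets ht P.pos _, mul_div_le_cosets ht P.pos _, mul_div_le_cosets ht P.pos _, hs⟩

/-- The differences of row neighbours that are excluded. -/
def axisSet (A : Finset V) (ξ η : V →ₗ[ZMod 5] ZMod 5) : Finset V :=
  univ.filter fun v => ξ v = 0 ∧ η v = 1 ∧ (v ∈ A ∨ -v ∈ A)

theorem mem_axisSet {v : V} : v ∈ axisSet A ξ η ↔ ξ v = 0 ∧ η v = 1 ∧ (v ∈ A ∨ -v ∈ A) := by
  simp [axisSet]

theorem cell_subset_axisSet : cell A ξ η 0 1 ⊆ axisSet A ξ η := by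
  intro v hv
  rw [mem_cell] at hv
  exact mem_axisSet.2 ⟨hv.2.1, hv.2.2, Or.inl hv.1⟩

/-- If s and s' = s + d belong to A, then neither d nor -d does. So Kneser's theorem applies with
all of A ∪ -A over (0, 1) as the middle set. -/
theorem Pivot.exists_index_axis (P : Pivot A ξ η N) {x y y' : ZMod 5} (hy : y' = y + 1)
    (h1 : 0 < density A ξ η N x y) (h2 : 0 < density A ξ η N x y') :
    ∃ H < planeKer ξ η, ∃ t, N = t * Nat.card H ∧ (t = 5 ∨ t = 25 ∨ 125 ≤ t) ∧
      cosets H (cell A ξ η x y) + cosets H (axisSet A ξ η) + cosets H (cell A ξ η x y') ≤ t + 1 ∧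
      (axisSet A ξ η).Nonempty := by
  rw [P.density_pos] at h1 h2
  have hR : (axisSet A ξ η).Nonempty := by
    have : 0 < #(A.filter fun a => ξ a = 0) := by have := P.big; omega
    obtain ⟨a, ha⟩ := Finset.card_pos.1 this
    rw [Finset.mem_filter] at ha
    rcases P.pm a ha.1 ha.2 with h | h
    · exact ⟨a, mem_axisSet.2 ⟨ha.2, h, Or.inl ha.1⟩⟩
    · exact ⟨-a, mem_axisSet.2 ⟨by simp [ha.2], by simp [h], by simp [ha.1]⟩⟩
  obtain ⟨H, hlt, t, ht, ht', hs⟩ := exists_index_cosets_le P.surj P.card (add_zero x) hy.symm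
    (fun v hv => (mem_cell.1 hv).2)
    (fun v hv => ⟨(mem_axisSet.1 hv).1, (mem_axisSet.1 hv).2.1⟩) (fun v hv => (mem_cell.1 hv).2)
    h1 hR h2
    (fun b hb c hc hd => by
      rcases (mem_axisSet.1 hc).2.2 with h | h
      · exact P.sumFree b (mem_cell.1 hb).1 c h _ (mem_cell.1 hd).1 rfl
      · exact P.sumFree _ (mem_cell.1 hd).1 _ h b (mem_cell.1 hb).1 (by abel))
  exact ⟨H, hlt, t, ht, ht', hs, hR⟩

end Counting

/-! ### From the densest section to the density inequalities -/

section PivotPlane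

variable {V : Type*} [AddCommGroup V] [Module (ZMod 5) V] [Fintype V] [DecidableEq V]

/-- A subgroup of index `5` in a plane kernel is cut out by a functional. -/
theorem exists_functional_of_index_five {ξ η : V →ₗ[ZMod 5] ZMod 5} {N : ℕ}
    (h : ∀ x y, ∃ v, ξ v = x ∧ η v = y) (hN : 25 * N = Fintype.card V) {H : AddSubgroup V}
    (hlt : H < planeKer ξ η) (hH : N = 5 * Nat.card H) :
    ∃ θ : V →ₗ[ZMod 5] ZMod 5, (∀ x y z, ∃ v, ξ v = x ∧ η v = y ∧ θ v = z) ∧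
      (∀ v, v ∈ H ↔ ξ v = 0 ∧ η v = 0 ∧ θ v = 0) := by
  obtain ⟨a, haK, haH⟩ := SetLike.exists_of_lt hlt
  obtain ⟨θ, hθ, hle⟩ := Submodule.exists_le_ker_of_notMem
    (p := AddSubgroup.toZModSubmodule 5 H) (v := a) haH
  rw [mem_planeKer] at haK
  have hs := jointly_surjective_three h haK.1 haK.2 hθ
  refine ⟨θ, hs, ?_⟩
  have hc := card_fiber_three hs 0 0 0
  have hsub : ∀ v ∈ H, v ∈ univ.filter fun v => ξ v = 0 ∧ η v = 0 ∧ θ v = 0 := by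
    intro v hv
    have h1 := mem_planeKer.1 (hlt.le hv)
    have h2 : θ v = 0 := hle (show v ∈ AddSubgroup.toZModSubmodule 5 H from hv)
    simp [h1, h2]
  classical
  have heq : (univ.filter fun v => v ∈ H) = univ.filter fun v => ξ v = 0 ∧ η v = 0 ∧ θ v = 0 := by
    apply Finset.eq_of_subset_of_card_le
    · intro v hv
      exact hsub v (by simpa using hv)
    · have : Nat.card H ≤ #(univ.filter fun v => v ∈ H) := natCard_le_card_of_subset (by simp)
      omega
  intro v
  have := Finset.ext_iff.1 heq v
  simpa using this

theorem card_image_le_cosets {H : AddSubgroup V} {θ : V →ₗ[ZMod 5] ZMod 5}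
    (h : ∀ v ∈ H, θ v = 0) (S : Finset V) : #(S.image θ) ≤ cosets H S := by
  rw [← Set.ncard_coe_finset, Finset.coe_image]
  have : (θ : V → ZMod 5) '' S =
      QuotientAddGroup.lift H θ.toAddMonoidHom h '' ((QuotientAddGroup.mk : V → V ⧸ H) '' S) := by
    rw [Set.image_image]
    rfl
  rw [this]
  exact Set.ncard_image_le (Set.toFinite _)

variable {A : Finset V} {ξ η : V →ₗ[ZMod 5] ZMod 5} {N : ℕ}

theorem Pivot.card_axis (P : Pivot A ξ η N) :
    #(A.filter fun a => ξ a = 0) = #(cell A ξ η 0 1) + #(cell A ξ η 0 (-1)) := by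
  rw [← Finset.card_union_of_disjoint]
  · congr 1
    ext a
    simp only [Finset.mem_filter, Finset.mem_union, mem_cell]
    constructor
    · rintro ⟨h1, h2⟩
      rcases P.pm a h1 h2 with h | h
      · exact Or.inl ⟨h1, h2, h⟩
      · exact Or.inr ⟨h1, h2, h⟩
    · rintro (h | h) <;> exact ⟨h.1, h.2.1⟩
  · rw [Finset.disjoint_left]
    intro a h1 h2
    rw [mem_cell] at h1 h2
    exact absurd (h1.2.2.symm.trans h2.2.2) (by decide)

/-- A section of codimension two of a set whose hyperplane sections are small. -/
theorem Pivot.card_section_le (P : Pivot A ξ η N) {ζ : V →ₗ[ZMod 5] ZMod 5} {a : V} (h1 : ξ a = 0)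
    (h2 : ζ a ≠ 0) : #A + 5 * #(A.filter fun a => ξ a = 0 ∧ ζ a = 0) ≤
      6 * #(A.filter fun a => ξ a = 0) := by
  rw [card_filter_add_card_filter_pencil]
  have : ∑ k : ZMod 5, #(A.filter fun a => (ζ - k • ξ) a = 0) ≤
      ∑ k : ZMod 5, #(A.filter fun a => ξ a = 0) := by
    apply Finset.sum_le_sum
    intro k _
    apply P.max
    intro h
    have := LinearMap.congr_fun h a
    simp [h1] at this
    exact h2 this
  rw [Finset.sum_const, Finset.card_univ, ZMod.card, smul_eq_mul] at this
  omega

/-- Let m = |A ∩ {ξ = 0}|. If three cosets sufficed, three sections of codimension two would cover A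
∩ {ξ = 0}. By maximality each has at most (6m - |A|)/5 elements, so 13m ≥ 3|A| ≥ 84N/5; but three
cosets also give m ≤ 6N/5. -/
theorem Pivot.four_le_cosets_axis (P : Pivot A ξ η N) {H : AddSubgroup V}
    (hlt : H < planeKer ξ η) (hH : N = 5 * Nat.card H) : 4 ≤ cosets H (axisSet A ξ η) := by
  by_contra! hcos
  have h1 : #(cell A ξ η 0 1) ≤ cosets H (axisSet A ξ η) * Nat.card H :=
    (Finset.card_le_card cell_subset_axisSet).trans (card_le_cosets_mul H _)
  have h1' : #(cell A ξ η 0 1) ≤ 3 * Nat.card H :=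
    h1.trans (Nat.mul_le_mul_right _ (by omega))
  have h2 := P.card_axis
  have h3 := P.le
  obtain ⟨θ, hs, hθ⟩ := exists_functional_of_index_five P.surj P.card hlt hH
  obtain ⟨a, a1, a2, a3⟩ := hs 0 0 1
  have h4 := card_image_le_cosets (θ := θ) (fun v hv => ((hθ v).1 hv).2.2) (axisSet A ξ η)
  have hcover : (A.filter fun a => ξ a = 0) ⊆ ((axisSet A ξ η).image θ).biUnion
      fun k => A.filter fun a => ξ a = 0 ∧ (θ - k • η) a = 0 := by
    intro v hv
    rw [Finset.mem_filter] at hv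
    rw [Finset.mem_biUnion]
    rcases P.pm v hv.1 hv.2 with h | h
    · refine ⟨θ v, Finset.mem_image_of_mem _ (mem_axisSet.2 ⟨hv.2, h, Or.inl hv.1⟩), ?_⟩
      simp [hv, h]
    · refine ⟨θ (-v), Finset.mem_image_of_mem _ (mem_axisSet.2 ⟨by simp [hv], by simp [h],
        Or.inr (by simp [hv])⟩), ?_⟩
      simp [hv, h]
  have h5 : #(A.filter fun a => ξ a = 0) ≤
      #((axisSet A ξ η).image θ) * ((6 * #(A.filter fun a => ξ a = 0) - #A) / 5) := by
    refine (Finset.card_le_card hcover).trans (Finset.card_biUnion_le_card_mul _ _ _ ?_)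
    intro k _
    have := P.card_section_le (ζ := θ - k • η) a1 (by simp [a2, a3])
    omega
  have h6 : #(A.filter fun a => ξ a = 0) ≤ 3 * ((6 * #(A.filter fun a => ξ a = 0) - #A) / 5) :=
    h5.trans (Nat.mul_le_mul_right _ (by omega))
  have := P.size
  have := P.pos
  have := P.big
  omega

theorem Pivot.adj (P : Pivot A ξ η N) (x : ZMod 5) {y y' : ZMod 5} (hy : y' = y + 1)
    (h1 : 0 < density A ξ η N x y) (h2 : 0 < density A ξ η N x y') :
    KneserAdj (density A ξ η N x y) (#(axisSet A ξ η) / N) (density A ξ η N x y') := by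
  obtain ⟨H, hlt, t, ht, ht', hs, hR⟩ := P.exists_index_axis hy h1 h2
  rw [P.density_pos] at h1 h2
  refine ⟨t, _, _, _, ?_, cosets_pos H h1, cosets_pos H hR, cosets_pos H h2,
    mul_div_le_cosets ht P.pos _, mul_div_le_cosets ht P.pos _, mul_div_le_cosets ht P.pos _, hs⟩
  rcases ht' with rfl | h | h
  · exact Or.inl ⟨rfl, P.four_le_cosets_axis hlt ht⟩
  · exact Or.inr (Or.inl h)
  · exact Or.inr (Or.inr h)

theorem card_filter_eq_sum_cell (A : Finset V) (ξ η : V →ₗ[ZMod 5] ZMod 5) (x : ZMod 5) :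
    #(A.filter fun a => ξ a = x) = ∑ y, #(cell A ξ η x y) := by
  rw [Finset.card_eq_sum_card_fiberwise (f := η) (t := univ)
    (fun _ _ => Finset.mem_coe.2 (Finset.mem_univ _))]
  simp only [cell, Finset.filter_filter]

theorem card_eq_sum_cell (A : Finset V) (ξ η : V →ₗ[ZMod 5] ZMod 5) :
    #A = ∑ x, ∑ y, #(cell A ξ η x y) := by
  simp only [← card_filter_eq_sum_cell]
  exact Finset.card_eq_sum_card_fiberwise (f := ξ) (t := univ)
    (fun _ _ => Finset.mem_coe.2 (Finset.mem_univ _))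

theorem card_line (A : Finset V) (ξ η : V →ₗ[ZMod 5] ZMod 5) (c : ZMod 5) :
    #(A.filter fun a => (η - c • ξ) a = 0) = ∑ x, #(cell A ξ η x (c * x)) := by
  rw [Finset.card_eq_sum_card_fiberwise (f := ξ) (t := univ)
    (fun _ _ => Finset.mem_coe.2 (Finset.mem_univ _))]
  refine Finset.sum_congr rfl fun x _ => ?_
  congr 1
  ext a
  simp only [cell, Finset.mem_filter, LinearMap.sub_apply, LinearMap.smul_apply, smul_eq_mul,
    sub_eq_zero]
  constructor
  · rintro ⟨⟨h1, h2⟩, rfl⟩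
    exact ⟨h1, rfl, h2⟩
  · rintro ⟨h1, rfl, h2⟩
    exact ⟨⟨h1, h2⟩, rfl⟩

theorem Pivot.planeDensity (P : Pivot A ξ η N) :
    PlaneDensity (density A ξ η N) (#(axisSet A ξ η) / N) := by
  have hN : (0 : ℚ) < N := by exact_mod_cast P.pos
  have hax : density A ξ η N 0 1 + density A ξ η N 0 (-1) = (#(A.filter fun a => ξ a = 0) : ℚ) / N := by
    rw [P.card_axis, density, density]
    push_cast
    ring
  have hz : ∀ y, y ≠ 1 → y ≠ -1 → #(cell A ξ η 0 y) = 0 := by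
    intro y h1 h2
    rw [Finset.card_eq_zero, Finset.eq_empty_iff_forall_notMem]
    intro a ha
    rw [mem_cell] at ha
    rcases P.pm a ha.1 ha.2.1 with h | h
    · exact h1 (ha.2.2.symm.trans h)
    · exact h2 (ha.2.2.symm.trans h)
  refine ⟨fun _ _ => by unfold density; positivity, fun x y => ?_, P.tri, P.adj, ?_, ?_, ?_,
    fun c => ?_, ?_⟩
  · rw [density, div_le_one hN]
    exact_mod_cast P.card_cell_le x y
  · rw [density]
    gcongr
    exact cell_subset_axisSet
  · exact div_le_div_of_nonneg_right (Nat.cast_le.2 P.le) hN.le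
  · rw [hax, lt_div_iff₀ hN]
    have : (28 * N : ℚ) < 25 * #(A.filter fun a => ξ a = 0) := by exact_mod_cast P.big
    linarith
  · obtain ⟨v, hv1, hv2⟩ := P.surj 0 1
    have := P.max (η - c • ξ) (fun h => by
      have := LinearMap.congr_fun h v
      simp [hv1, hv2] at this)
    rw [hax, le_div_iff₀ (by norm_num), le_div_iff₀ hN]
    rw [card_line, show ∑ x, #(cell A ξ η x (c * x)) = #(cell A ξ η 0 (c * 0)) +
      #(cell A ξ η 1 (c * 1)) + #(cell A ξ η 2 (c * 2)) + #(cell A ξ η 3 (c * 3)) +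
      #(cell A ξ η 4 (c * 4)) from Fin.sum_univ_five _] at this
    have e3 : (3 : ZMod 5) = -2 := by decide
    have e4 : (4 : ZMod 5) = -1 := by decide
    rw [e3, e4, mul_one, mul_neg, mul_neg, mul_one] at this
    have this' := (Nat.cast_le (α := ℚ)).2 this
    push_cast at this'
    unfold oneDensity twoDensity density
    have h0 : (0 : ℚ) ≤ #(cell A ξ η 0 (c * 0)) := by positivity
    field_simp
    linarith
  · have ht := card_eq_sum_cell A ξ η
    have hs := P.size
    have hA : (28 / 5 : ℚ) ≤ #A / N := by
      rw [le_div_iff₀ hN]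
      have : (28 * N : ℚ) ≤ 5 * #A := by exact_mod_cast hs
      linarith
    refine hA.trans (le_of_eq ?_)
    have h5 : ∀ F : ZMod 5 → ℕ, ∑ x, F x = F 0 + F 1 + F 2 + F 3 + F 4 := Fin.sum_univ_five
    rw [ht]
    simp only [h5]
    rw [hz 0 (by decide) (by decide), hz 2 (by decide) (by decide), hz 3 (by decide) (by decide)]
    simp only [sum_zmod_five, oneDensity, twoDensity, density]
    rw [show (-0 : ZMod 5) = 0 by decide, show (-1 : ZMod 5) = 4 by decide,
      show (-2 : ZMod 5) = 3 by decide, show (-3 : ZMod 5) = 2 by decide,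
      show (-4 : ZMod 5) = 1 by decide, show (2 * 0 : ZMod 5) = 0 by decide,
      show (2 * 1 : ZMod 5) = 2 by decide, show (2 * 2 : ZMod 5) = 4 by decide,
      show (2 * 3 : ZMod 5) = 1 by decide, show (2 * 4 : ZMod 5) = 3 by decide,
      show (-0 : ZMod 5) = 0 by decide, show (-1 : ZMod 5) = 4 by decide,
      show (-2 : ZMod 5) = 3 by decide, show (-3 : ZMod 5) = 2 by decide,
      show (-4 : ZMod 5) = 1 by decide]
    push_cast
    field_simp
    ring

/-- There is a functional taking only the values `± 1` on `A`. -/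
def NormalSet (A : Finset V) : Prop :=
  ∃ χ : V →ₗ[ZMod 5] ZMod 5, ∀ a ∈ A, χ a = 1 ∨ χ a = -1

theorem Pivot.normalSet (P : Pivot A ξ η N)
    (h : NormalSupport (oneDensity (density A ξ η N)) (twoDensity (density A ξ η N))) :
    NormalSet A := by
  obtain ⟨α, hU, hW⟩ := h
  refine ⟨η + α • ξ, fun a ha => ?_⟩
  have nn := P.planeDensity.nonneg
  have hpos : 0 < density A ξ η N (ξ a) (η a) := P.density_pos.2 ⟨a, mem_cell.2 ⟨ha, rfl, rfl⟩⟩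
  have key : ξ a = 0 ∨ ξ a = 1 ∨ ξ a = -1 ∨ ξ a = 2 ∨ ξ a = -2 :=
    (by decide : ∀ x : ZMod 5, x = 0 ∨ x = 1 ∨ x = -1 ∨ x = 2 ∨ x = -2) (ξ a)
  have hpm := P.pm a ha
  simp only [LinearMap.add_apply, LinearMap.smul_apply, smul_eq_mul]
  generalize η a = y at *
  have e1 := (by decide : ∀ y : ZMod 5, 2 * (3 * y) = y) y
  have e2 := (by decide : ∀ y : ZMod 5, -(2 * (-(3 * y))) = y) y
  rcases key with h | h | h | h | h <;> rw [h] at hpos hpm ⊢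
  · simpa using hpm rfl
  · have := hU y (by unfold oneDensity; linarith [nn (-1) (-y)])
    rwa [mul_one]
  · have := hU (-y) (by unfold oneDensity; rw [neg_neg]; linarith [nn 1 (-y)])
    exact (by decide : ∀ y α : ZMod 5, -y + α = 1 ∨ -y + α = -1 → y + α * -1 = 1 ∨ y + α * -1 = -1)
      y α this
  · have := hW (3 * y) (by unfold twoDensity; rw [e1]; linarith [nn (-2) (-y)])
    exact (by decide : ∀ y α : ZMod 5, 3 * y + α = 2 ∨ 3 * y + α = -2 →
      y + α * 2 = 1 ∨ y + α * 2 = -1) y α this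
  · have := hW (-(3 * y)) (by
      unfold twoDensity; rw [e2]; linarith [nn 2 (2 * -(3 * y))])
    exact (by decide : ∀ y α : ZMod 5, -(3 * y) + α = 2 ∨ -(3 * y) + α = -2 →
      y + α * -2 = 1 ∨ y + α * -2 = -1) y α this

end PivotPlane

/-! ### Excluding the borderline configurations with M = 4/5 -/

section Tie

variable {V : Type*} [AddCommGroup V] [Module (ZMod 5) V] [Fintype V] [DecidableEq V]
variable {A : Finset V} {ξ η θ : V →ₗ[ZMod 5] ZMod 5} {N : ℕ}

theorem two_mul_eq_iff (u x : ZMod 5) : 2 * u = x ↔ u = 3 * x :=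
  (by decide : ∀ u x : ZMod 5, 2 * u = x ↔ u = 3 * x) u x

theorem cell_two_smul (A : Finset V) (ξ η : V →ₗ[ZMod 5] ZMod 5) (x y : ZMod 5) :
    cell A ((2 : ZMod 5) • ξ) η x y = cell A ξ η (3 * x) y := by
  ext a
  simp only [mem_cell, LinearMap.smul_apply, smul_eq_mul, two_mul_eq_iff]

theorem density_two_smul (A : Finset V) (ξ η : V →ₗ[ZMod 5] ZMod 5) (N : ℕ) :
    density A ((2 : ZMod 5) • ξ) η N = fun x y => density A ξ η N (3 * x) y := by
  funext x y
  rw [density, cell_two_smul, density]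

theorem Pivot.swap (P : Pivot A ξ η N) : Pivot A ((2 : ZMod 5) • ξ) η N := by
  have e : ∀ v, ((2 : ZMod 5) • ξ) v = 0 ↔ ξ v = 0 := fun v => by
    rw [LinearMap.smul_apply, smul_eq_mul, two_mul_eq_iff, mul_zero]
  refine ⟨P.sumFree, P.card, fun h => P.ne_zero (LinearMap.ext fun v => ?_), P.size, ?_,
    fun a ha h => P.pm a ha ((e a).1 h), ?_, ?_⟩
  · rw [LinearMap.zero_apply, ← e, h, LinearMap.zero_apply]
  · simp only [e]; exact P.max
  · simp only [e]; exact P.big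
  · simp only [cell_two_smul, mul_zero]; exact P.le

/-- The symmetric relation satisfied by `A ∪ -A` in the extremal case. -/
def RowConstant (A : Finset V) (ξ η θ : V →ₗ[ZMod 5] ZMod 5) : Prop :=
  ∀ s s' : V, (s ∈ A ∨ -s ∈ A) → (s' ∈ A ∨ -s' ∈ A) → ξ s' = ξ s → η s' = η s + 1 → θ s' = θ s

theorem Pivot.card_cell_of_density (P : Pivot A ξ η N) {x y : ZMod 5} {q : ℚ}
    (h : density A ξ η N x y = q) : (#(cell A ξ η x y) : ℚ) = q * N := by
  have hN : (N : ℚ) ≠ 0 := by exact_mod_cast P.pos.ne'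
  rw [← h, density, div_mul_cancel₀ _ hN]

/-- With t = 5, the fiber of A ∪ -A over (0, 1) lies in four cosets of H, and the cells over (0, 1)
and (0, -1), of density 4/5, fill them. So ξ d = 0, η d = 1 and θ d ≠ 0 imply d, -d ∈ A, and no such
d is a difference of row neighbours in A ∪ -A. -/
theorem Pivot.exists_rowConstant (P : Pivot A ξ η N) (hT : TiePair (density A ξ η N)) :
    ∃ θ : V →ₗ[ZMod 5] ZMod 5, (∀ x y z, ∃ v, ξ v = x ∧ η v = y ∧ θ v = z) ∧
      RowConstant A ξ η θ := by
  obtain ⟨hp, hq, x, c, h1, h2, h3⟩ := hT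
  obtain ⟨H, hlt, t, ht, ht', hs, hR⟩ := P.exists_index_axis rfl h1 h2
  have i1 := mul_div_le_cosets ht P.pos (cell A ξ η x c)
  have i2 := mul_div_le_cosets ht P.pos (axisSet A ξ η)
  have i3 := mul_div_le_cosets ht P.pos (cell A ξ η x (c + 1))
  have i4 : density A ξ η N 0 1 ≤ #(axisSet A ξ η) / N := P.planeDensity.le_r
  change (t : ℚ) * density A ξ η N x c ≤ _ at i1
  change (t : ℚ) * density A ξ η N x (c + 1) ≤ _ at i3
  have hs' : (cosets H (cell A ξ η x c) + cosets H (axisSet A ξ η) +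
      cosets H (cell A ξ η x (c + 1)) : ℚ) ≤ t + 1 := by exact_mod_cast hs
  -- The densities exceed 4/5 + 6/25 = 26/25 in total, more than (t + 1)/t for t ≥ 25.
  have t5 : t = 5 := by
    rcases ht' with h | h | h
    · exact h
    · exfalso
      subst h
      push_cast at *
      have : (20 : ℚ) ≤ cosets H (axisSet A ξ η) := by linarith
      linarith
    · exfalso
      have h' : (125 : ℚ) ≤ t := by exact_mod_cast h
      have : (t : ℚ) * (4 / 5) ≤ t * (#(axisSet A ξ η) / N) :=
        mul_le_mul_of_nonneg_left (by linarith) (by linarith)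
      have : (t : ℚ) * (density A ξ η N x c + density A ξ η N x (c + 1)) ≥ t * (6 / 25) :=
        mul_le_mul_of_nonneg_left h3.le (by linarith)
      linarith
  subst t5
  rw [P.density_pos] at h1 h2
  have c1 := cosets_pos H h1
  have c2 := cosets_pos H h2
  have cR : cosets H (axisSet A ξ η) ≤ 4 := by omega
  obtain ⟨θ₀, hs₀, hθ₀⟩ := exists_functional_of_index_five P.surj P.card hlt ht
  have kp := P.card_cell_of_density hp
  have kq := P.card_cell_of_density hq
  rw [ht] at kp kq
  push_cast at kp kq
  have kp' : #(cell A ξ η 0 1) = 4 * Nat.card H := by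
    have : (#(cell A ξ η 0 1) : ℚ) = 4 * Nat.card H := by linarith
    exact_mod_cast this
  have kq' : #(cell A ξ η 0 (-1)) = 4 * Nat.card H := by
    have : (#(cell A ξ η 0 (-1)) : ℚ) = 4 * Nat.card H := by linarith
    exact_mod_cast this
  obtain ⟨T, hT, cT⟩ := exists_coset_hull H (axisSet A ξ η)
  have hRT : axisSet A ξ η ⊆ T := fun v hv => (hT v).2 ⟨v, hv, by simp⟩
  have cP := Finset.card_le_card (cell_subset_axisSet (A := A) (ξ := ξ) (η := η))
  have cT' : #T ≤ 4 * Nat.card H := cT ▸ Nat.mul_le_mul_right _ cR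
  have hTR : axisSet A ξ η = T := Finset.eq_of_subset_of_card_le hRT (by omega)
  have hF := card_fiber_two P.surj 0 1
  have hcard := P.card
  obtain ⟨v₀, hv₀, hv₀R⟩ : ∃ v₀, v₀ ∈ univ.filter (fun v => ξ v = 0 ∧ η v = 1) ∧
      v₀ ∉ axisSet A ξ η := by
    by_contra! h
    have h1 := Finset.card_le_card h
    have h2 := Finset.card_le_card hRT
    have h3 : 0 < Nat.card H := Nat.card_pos
    omega
  simp only [Finset.mem_filter, Finset.mem_univ, true_and] at hv₀
  -- The shear by a multiple of η moves the missing coset to {θ = 0}.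
  set θ := θ₀ - θ₀ v₀ • η with hθ
  have θv : ∀ v, η v = 1 → θ v = θ₀ v - θ₀ v₀ := fun v hv => by simp [hθ, hv]
  have hsθ : ∀ x y z, ∃ v, ξ v = x ∧ η v = y ∧ θ v = z := by
    intro x y z
    obtain ⟨v, h1, h2, h3⟩ := hs₀ x y (z + θ₀ v₀ * y)
    exact ⟨v, h1, h2, by simp [hθ, h2, h3]⟩
  set E := (univ.filter fun v => ξ v = 0 ∧ η v = 1) \ (univ.filter fun v => ξ v = 0 ∧ η v = 1 ∧ θ v = 0)
    with hE
  have memE : ∀ v, v ∈ E ↔ ξ v = 0 ∧ η v = 1 ∧ θ v ≠ 0 := by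
    intro v
    simp only [hE, Finset.mem_sdiff, Finset.mem_filter, Finset.mem_univ, true_and]
    tauto
  have cE : #E = 4 * Nat.card H := by
    have h1 := card_fiber_three hsθ 0 1 0
    rw [hE, Finset.card_sdiff_of_subset]
    · omega
    · intro v hv
      simp only [Finset.mem_filter, Finset.mem_univ, true_and] at hv ⊢
      exact ⟨hv.1, hv.2.1⟩
  have hRE : axisSet A ξ η ⊆ E := by
    intro v hv
    have hv' := mem_axisSet.1 hv
    refine (memE v).2 ⟨hv'.1, hv'.2.1, fun h => hv₀R ?_⟩
    rw [hTR, hT]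
    refine ⟨v, hv, (hθ₀ _).2 ⟨by simp [hv₀, hv'.1], by simp [hv₀, hv'.2.1], ?_⟩⟩
    rw [θv v hv'.2.1] at h
    rw [map_sub, ← neg_sub, h, neg_zero]
  have hPE : cell A ξ η 0 1 = E :=
    Finset.eq_of_subset_of_card_le (cell_subset_axisSet.trans hRE) (by omega)
  have hQE : (cell A ξ η 0 (-1)).image (fun v => -v) = E := by
    apply Finset.eq_of_subset_of_card_le
    · intro v hv
      obtain ⟨w, hw, rfl⟩ := Finset.mem_image.1 hv
      rw [mem_cell] at hw
      exact hRE (mem_axisSet.2 ⟨by simp [hw], by simp [hw], by simp [hw]⟩)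
    · rw [Finset.card_image_of_injective _ neg_injective]
      omega
  have key : ∀ d, ξ d = 0 → η d = 1 → (d ∉ A ∨ -d ∉ A) → θ d = 0 := by
    intro d h1 h2 h3
    by_contra h4
    have hd : d ∈ E := (memE d).2 ⟨h1, h2, h4⟩
    rcases h3 with h3 | h3
    · rw [← hPE, mem_cell] at hd
      exact h3 hd.1
    · rw [← hQE] at hd
      obtain ⟨w, hw, rfl⟩ := Finset.mem_image.1 hd
      rw [neg_neg] at h3
      exact h3 (mem_cell.1 hw).1
  refine ⟨θ, hsθ, fun s s' hs hs' h1 h2 => ?_⟩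
  have := key (s' - s) (by simp [h1]) (by simp [h2]) ?_
  · rwa [map_sub, sub_eq_zero] at this
  · rcases hs with hs | hs <;> rcases hs' with hs' | hs'
    · exact Or.inl fun h => P.sumFree _ h _ hs _ hs' (by abel)
    · exact Or.inr fun h => P.sumFree _ hs _ hs' _ h (by abel)
    · exact Or.inl fun h => P.sumFree _ hs _ hs' _ h (by abel)
    · exact Or.inl fun h => P.sumFree _ hs' _ h _ hs (by abel)

theorem Pivot.exists_of_oneDensity_pos (P : Pivot A ξ η N) {c : ZMod 5}
    (h : 0 < oneDensity (density A ξ η N) c) : ∃ s, (s ∈ A ∨ -s ∈ A) ∧ ξ s = 1 ∧ η s = c := by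
  unfold oneDensity at h
  rcases pos_or_pos_of_add_pos (by linarith : 0 < density A ξ η N 1 c + density A ξ η N (-1) (-c))
    with h | h
  · obtain ⟨s, hs⟩ := P.density_pos.1 h
    rw [mem_cell] at hs
    exact ⟨s, Or.inl hs.1, hs.2⟩
  · obtain ⟨s, hs⟩ := P.density_pos.1 h
    rw [mem_cell] at hs
    exact ⟨-s, Or.inr (by simp [hs]), by simp [hs], by simp [hs]⟩

/-- Around the full cycle of columns θ keeps a single value g on A ∪ -A over ξ = 1. The hyperplane θ
= gξ then contains A ∩ {ξ = ±1}, at least 2N elements, against 8N/5 in the densest section. -/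
theorem Pivot.not_full (P : Pivot A ξ η N) (hT : TiePair (density A ξ η N))
    (hfull : ∀ c, 0 < oneDensity (density A ξ η N) c) :
    ¬ 1 ≤ ∑ c, oneDensity (density A ξ η N) c := by
  intro hsum
  obtain ⟨θ, hsθ, hθ⟩ := P.exists_rowConstant hT
  choose s hsA hs1 hsc using fun c => P.exists_of_oneDensity_pos (hfull c)
  have hstep : ∀ c, θ (s (c + 1)) = θ (s c) := fun c =>
    hθ _ _ (hsA c) (hsA (c + 1)) (by rw [hs1, hs1]) (by rw [hsc, hsc])
  have hstep' : ∀ c d, d = c + 1 → θ (s d) = θ (s c) := fun c d h => h ▸ hstep c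
  have h1 : θ (s (0 + 1)) = θ (s 0) := hstep' 0 (0 + 1) (by decide)
  have h2 := (hstep' (0 + 1) (0 + 2) (by decide)).trans h1
  have h3 := (hstep' (0 + 2) (0 + 3) (by decide)).trans h2
  have h4 := (hstep' (0 + 3) (0 + 4) (by decide)).trans h3
  have hconst : ∀ c, θ (s c) = θ (s 0) :=
    forall_zmod_five_shift (p := fun c => θ (s c) = θ (s 0)) 0 rfl h1 h2 h3 h4
  have hall : ∀ v, (v ∈ A ∨ -v ∈ A) → ξ v = 1 → θ v = θ (s 0) := by
    intro v hv hv1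
    rw [← hθ v (s (η v + 1)) hv (hsA _) (by rw [hs1, hv1]) (hsc _), hconst]
  set χ := θ - θ (s 0) • ξ with hχ
  have hχ0 : χ ≠ 0 := by
    obtain ⟨v, v1, v2, v3⟩ := hsθ 0 0 1
    intro h
    have := LinearMap.congr_fun h v
    simp [hχ, v1, v3] at this
  have hcard : #(A.filter fun a => ξ a = 1) + #(A.filter fun a => ξ a = -1) ≤
      #(A.filter fun a => χ a = 0) := by
    rw [← Finset.card_union_of_disjoint]
    · apply Finset.card_le_card
      intro a ha
      simp only [Finset.mem_union, Finset.mem_filter] at ha ⊢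
      rcases ha with ⟨ha, h⟩ | ⟨ha, h⟩
      · exact ⟨ha, by simp [hχ, h, hall a (Or.inl ha) h]⟩
      · have := hall (-a) (Or.inr (by simpa using ha)) (by simp [h])
        rw [map_neg] at this
        refine ⟨ha, ?_⟩
        simp only [hχ, LinearMap.sub_apply, LinearMap.smul_apply, h, ← this, smul_eq_mul]
        ring
    · rw [Finset.disjoint_left]
      intro a h1 h2
      simp only [Finset.mem_filter] at h1 h2
      exact absurd (h1.2.symm.trans h2.2) (by decide)
  have hmax := P.max χ hχ0
  have hN : (0 : ℚ) < N := by exact_mod_cast P.pos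
  have haxis : (#(A.filter fun a => ξ a = 0) : ℚ) = 8 / 5 * N := by
    rw [P.card_axis]
    push_cast
    rw [P.card_cell_of_density hT.1, P.card_cell_of_density hT.2.1]
    ring
  have hsum' : ∑ c, oneDensity (density A ξ η N) c =
      ((#(A.filter fun a => ξ a = 1) : ℚ) + #(A.filter fun a => ξ a = -1)) / (2 * N) := by
    rw [card_filter_eq_sum_cell A ξ η 1, card_filter_eq_sum_cell A ξ η (-1),
      ← Equiv.sum_comp (Equiv.neg (ZMod 5)) fun y => #(cell A ξ η (-1) y)]
    push_cast
    rw [← Finset.sum_add_distrib, Finset.sum_div]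
    refine Finset.sum_congr rfl fun c _ => ?_
    simp only [oneDensity, density, Equiv.neg_apply]
    field_simp
  rw [hsum', le_div_iff₀ (by linarith)] at hsum
  have h5 : (#(A.filter fun a => ξ a = 1) : ℚ) + #(A.filter fun a => ξ a = -1) ≤
      #(A.filter fun a => ξ a = 0) := by exact_mod_cast hcard.trans hmax
  linarith

/-- A cell of density `1/5` contained in a fiber of three functionals is equal to it. -/
theorem Pivot.mem_of_density_eq (P : Pivot A ξ η N)
    (hs : ∀ x y z, ∃ v, ξ v = x ∧ η v = y ∧ θ v = z) {x y z : ZMod 5}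
    (h : ∀ a ∈ A, ξ a = x → η a = y → θ a = z) (hd : density A ξ η N x y = 1 / 5) {v : V}
    (h1 : ξ v = x) (h2 : η v = y) (h3 : θ v = z) : v ∈ A := by
  have hc := P.card_cell_of_density hd
  have hc' : 5 * #(cell A ξ η x y) = N := by
    have : (5 * #(cell A ξ η x y) : ℚ) = N := by linarith
    exact_mod_cast this
  have h3' := card_fiber_three hs x y z
  have heq : cell A ξ η x y = univ.filter fun v => ξ v = x ∧ η v = y ∧ θ v = z := by
    apply Finset.eq_of_subset_of_card_le
    · intro a ha
      rw [mem_cell] at ha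
      simp only [Finset.mem_filter, Finset.mem_univ, true_and]
      exact ⟨ha.2.1, ha.2.2, h a ha.1 ha.2.1 ha.2.2⟩
    · have := P.card
      omega
  have : v ∈ cell A ξ η x y := by
    rw [heq]
    simp [h1, h2, h3]
  exact (mem_cell.1 this).1

theorem Pivot.mem_and_neg_mem (P : Pivot A ξ η N)
    (hs : ∀ x y z, ∃ v, ξ v = x ∧ η v = y ∧ θ v = z) {x y z : ZMod 5}
    (h : ∀ s, (s ∈ A ∨ -s ∈ A) → ξ s = x → η s = y → θ s = z)
    (hd : density A ξ η N x y = 1 / 5) (hd' : density A ξ η N (-x) (-y) = 1 / 5) {v : V}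
    (h1 : ξ v = x) (h2 : η v = y) (h3 : θ v = z) : v ∈ A ∧ -v ∈ A := by
  refine ⟨P.mem_of_density_eq hs (fun a ha => h a (Or.inl ha)) hd h1 h2 h3,
    P.mem_of_density_eq hs (z := -z) (fun a ha ha1 ha2 => ?_) hd' (by simp [h1]) (by simp [h2])
      (by simp [h3])⟩
  have := h (-a) (Or.inr (by simpa using ha)) (by simp [ha1]) (by simp [ha2])
  rw [← this, map_neg, neg_neg]

theorem Pivot.card_cell_le_of_two_ne (P : Pivot A ξ η N)
    (hs : ∀ x y z, ∃ v, ξ v = x ∧ η v = y ∧ θ v = z) {x y z z' : ZMod 5} (hz : z ≠ z')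
    (h : ∀ a ∈ A, ξ a = x → η a = y → θ a ≠ z ∧ θ a ≠ z') : 5 * #(cell A ξ η x y) ≤ 3 * N := by
  have h1 := card_fiber_three hs x y z
  have h2 := card_fiber_three hs x y z'
  have h3 := card_fiber_two P.surj x y
  have h4 : #(cell A ξ η x y) + (#(univ.filter fun v => ξ v = x ∧ η v = y ∧ θ v = z) +
      #(univ.filter fun v => ξ v = x ∧ η v = y ∧ θ v = z')) ≤
      #(univ.filter fun v => ξ v = x ∧ η v = y) := by
    rw [← Finset.card_union_of_disjoint, ← Finset.card_union_of_disjoint]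
    · apply Finset.card_le_card
      intro v hv
      simp only [Finset.mem_union, Finset.mem_filter, Finset.mem_univ, true_and, mem_cell] at hv ⊢
      tauto
    · rw [Finset.disjoint_left]
      intro v hv
      rw [mem_cell] at hv
      have := h v hv.1 hv.2.1 hv.2.2
      simp only [Finset.mem_union, Finset.mem_filter, Finset.mem_univ, true_and]
      tauto
    · rw [Finset.disjoint_left]
      intro v hv hv'
      simp only [Finset.mem_filter, Finset.mem_univ, true_and] at hv hv'
      exact hz (hv.2.2.symm.trans hv'.2.2)
  have := P.card
  omega

/-- θ has one value g on the four cells of row 1 and one value h on the two cells of row 2, and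
density 1/5 makes these cells whole fibers of θ. In the cell (2, 2k + 2), the relation (1, k) + (1,
k + 2) = (2, 2k + 2) forbids θ = 2g and (2, 2k + 2) + (2, 2k) = -(1, k + 3) forbids θ = -g - h. So
this cell and its opposite have density at most 3/5. -/
theorem Pivot.not_path (P : Pivot A ξ η N) (hT : TiePair (density A ξ η N)) {k : ZMod 5}
    (h1 : ∀ c, c = k ∨ c = k + 2 ∨ c = k + 3 ∨ c = k + 4 →
      density A ξ η N 1 c = 1 / 5 ∧ density A ξ η N (-1) (-c) = 1 / 5)
    (h2 : ∀ c, c = k ∨ c = k + 2 →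
      density A ξ η N 2 (2 * c) = 1 / 5 ∧ density A ξ η N (-2) (-(2 * c)) = 1 / 5) :
    density A ξ η N 2 (2 * (k + 1)) + density A ξ η N (-2) (-(2 * (k + 1))) ≠ 8 / 5 := by
  intro hW
  obtain ⟨θ, hsθ, hθ⟩ := P.exists_rowConstant hT
  have ex : ∀ {x y}, density A ξ η N x y = 1 / 5 → ∃ s, (s ∈ A ∨ -s ∈ A) ∧ ξ s = x ∧ η s = y := by
    intro x y h
    obtain ⟨s, hs⟩ := P.density_pos.1 (by rw [h]; norm_num : 0 < density A ξ η N x y)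
    rw [mem_cell] at hs
    exact ⟨s, Or.inl hs.1, hs.2⟩
  obtain ⟨s3, s3A, s31, s3c⟩ := ex (h1 (k + 3) (Or.inr (Or.inr (Or.inl rfl)))).1
  obtain ⟨s4, s4A, s41, s4c⟩ := ex (h1 (k + 4) (Or.inr (Or.inr (Or.inr rfl)))).1
  obtain ⟨t0, t0A, t01, t0c⟩ := ex (h2 k (Or.inl rfl)).1
  obtain ⟨t2, t2A, t21, t2c⟩ := ex (h2 (k + 2) (Or.inr rfl)).1
  have e43 : θ s4 = θ s3 := hθ _ _ s3A s4A (by rw [s31, s41]) (by rw [s3c, s4c]; ring)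
  have e5 : 2 * k = 2 * (k + 2) + 1 := by linear_combination -five_eq_zero
  have e02 : θ t0 = θ t2 := hθ _ _ t2A t0A (by rw [t01, t21]) (by rw [t0c, t2c, ← e5])
  have c1 : ∀ c, c = k ∨ c = k + 2 ∨ c = k + 3 ∨ c = k + 4 →
      ∀ s, (s ∈ A ∨ -s ∈ A) → ξ s = 1 → η s = c → θ s = θ s3 := by
    rintro c (rfl | rfl | rfl | rfl) s hs hs1 hsc
    · rw [← e43]
      exact hθ _ _ s4A hs (by rw [hs1, s41]) (by rw [hsc, s4c]; linear_combination -five_eq_zero)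
    · exact (hθ _ _ hs s3A (by rw [hs1, s31]) (by rw [hsc, s3c]; ring)).symm
    · rw [← e43]
      exact (hθ _ _ hs s4A (by rw [hs1, s41]) (by rw [hsc, s4c]; ring)).symm
    · exact hθ _ _ s3A hs (by rw [hs1, s31]) (by rw [hsc, s3c]; ring)
  have c2 : ∀ c, c = k ∨ c = k + 2 →
      ∀ s, (s ∈ A ∨ -s ∈ A) → ξ s = 2 → η s = 2 * c → θ s = θ t0 := by
    rintro c (rfl | rfl) s hs hs1 hsc
    · rw [e02]
      exact hθ _ _ t2A hs (by rw [hs1, t21]) (by rw [hsc, t2c, ← e5])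
    · exact (hθ _ _ hs t0A (by rw [hs1, t01]) (by rw [hsc, t0c, ← e5])).symm
  generalize θ s3 = g at c1
  generalize θ t0 = h at c2
  have m1 : ∀ c, (c = k ∨ c = k + 2 ∨ c = k + 3 ∨ c = k + 4) →
      ∀ v, ξ v = 1 → η v = c → θ v = g → v ∈ A ∧ -v ∈ A := fun c hc v a b d =>
    P.mem_and_neg_mem hsθ (c1 c hc) (h1 c hc).1 (h1 c hc).2 a b d
  have m2 : ∀ c, (c = k ∨ c = k + 2) →
      ∀ v, ξ v = 2 → η v = 2 * c → θ v = h → v ∈ A ∧ -v ∈ A := fun c hc v a b d =>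
    P.mem_and_neg_mem hsθ (c2 c hc) (h2 c hc).1 (h2 c hc).2 a b d
  -- Otherwise h = 2g, and doubling a point of the cell (1, k) leads into the cell (2, 2k).
  have hne : 2 * g ≠ -g - h := by
    intro he
    obtain ⟨v, v1, v2, v3⟩ := hsθ 1 k g
    have hvA := (m1 k (Or.inl rfl) v v1 v2 v3).1
    have h2A := (m2 k (Or.inl rfl) (v + v) (by rw [map_add, v1]; decide) (by rw [map_add, v2]; ring)
      (by rw [map_add, v3]; linear_combination (-1 : ZMod 5) * he + g * five_eq_zero)).1
    exact P.sumFree v hvA v hvA _ h2A rfl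
  have key : ∀ s, (s ∈ A ∨ -s ∈ A) → ξ s = 2 → η s = 2 * (k + 1) → θ s ≠ 2 * g ∧ θ s ≠ -g - h := by
    intro s hs hs1 hsc
    constructor
    · intro he
      obtain ⟨v, v1, v2, v3⟩ := hsθ 1 k g
      have hv := m1 k (Or.inl rfl) v v1 v2 v3
      have hu := m1 (k + 2) (Or.inr (Or.inl rfl)) (s - v) (by rw [map_sub, v1, hs1]; decide)
        (by rw [map_sub, v2, hsc]; ring) (by rw [map_sub, v3, he]; ring)
      rcases hs with hs | hs
      · exact P.sumFree v hv.1 _ hu.1 s hs (by abel)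
      · exact P.sumFree _ hv.2 _ hu.2 _ hs (by abel)
    · intro he
      obtain ⟨w, w1, w2, w3⟩ := hsθ 2 (2 * k) h
      have hw := m2 k (Or.inl rfl) w w1 w2 w3
      have hu := m1 (k + 3) (Or.inr (Or.inr (Or.inl rfl))) (-(s + w)) (by rw [map_neg, map_add, w1, hs1]; decide)
        (by rw [map_neg, map_add, w2, hsc]; linear_combination (-k - 1 : ZMod 5) * five_eq_zero)
        (by rw [map_neg, map_add, w3, he]; ring)
      rw [neg_neg] at hu
      rcases hs with hs | hs
      · exact P.sumFree s hs w hw.1 _ hu.2 rfl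
      · exact P.sumFree _ hs _ hw.2 _ hu.1 (by abel)
  have b1 := P.card_cell_le_of_two_ne hsθ hne (x := 2) (y := 2 * (k + 1))
    (fun a ha => key a (Or.inl ha))
  have b2 := P.card_cell_le_of_two_ne hsθ (z := -(2 * g)) (z' := -(-g - h)) (x := -2)
    (y := -(2 * (k + 1))) (fun he => hne (neg_injective he)) (fun a ha ha1 ha2 => by
      have := key (-a) (Or.inr (by simpa using ha)) (by rw [map_neg, ha1, neg_neg])
        (by rw [map_neg, ha2, neg_neg])
      rw [map_neg] at this
      exact ⟨fun he => this.1 (by rw [he, neg_neg]), fun he => this.2 (by rw [he, neg_neg])⟩)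
  have hN : (0 : ℚ) < N := by exact_mod_cast P.pos
  have b1' : (5 * #(cell A ξ η 2 (2 * (k + 1))) : ℚ) ≤ 3 * N := by exact_mod_cast b1
  have b2' : (5 * #(cell A ξ η (-2) (-(2 * (k + 1)))) : ℚ) ≤ 3 * N := by exact_mod_cast b2
  rw [density, density, ← add_div, div_eq_iff hN.ne'] at hW
  linarith

end Tie

/-! ### Recovering Λ from its density profile -/

section Reconstruction

theorem mem_Lam_iff (w : Fin 3 → ZMod 5) : w ∈ Lam ↔
    ((w 0 = 1 ∨ w 0 = -1) ∧ w 1 = 0) ∨ (w 0 = 0 ∧ (w 1 = 1 ∨ w 1 = -1)) ∨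
    (w 0 = -1 ∧ w 1 = 2 ∧ (w 2 = 0 ∨ w 2 = 1)) ∨ (w 0 = 2 ∧ w 1 = 1 ∧ (w 2 = 1 ∨ w 2 = 2)) ∨
    (w 0 = 1 ∧ w 1 = -2 ∧ (w 2 = 0 ∨ w 2 = -1)) ∨
    (w 0 = -2 ∧ w 1 = -1 ∧ (w 2 = -1 ∨ w 2 = -2)) := by
  have e : ∀ a b c : ZMod 5, w = ![a, b, c] ↔ w 0 = a ∧ w 1 = b ∧ w 2 = c := by
    intro a b c
    constructor
    · rintro rfl; exact ⟨rfl, rfl, rfl⟩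
    · rintro ⟨h0, h1, h2⟩
      funext i
      fin_cases i <;> assumption
  simp only [Lam, Set.mem_union, Set.mem_ofPred_eq, Set.mem_insert_iff, Set.mem_singleton_iff, e,
    exists_or, exists_and_left, exists_eq', and_true]
  generalize w 0 = x, w 1 = y, w 2 = z
  constructor
  · rintro ((h | h | h | h) | h | h | h | h | h | h | h | h) <;> simp [h]
  · rintro (⟨h | h, h'⟩ | ⟨h, h' | h'⟩ | ⟨h, h', h'' | h''⟩ | ⟨h, h', h'' | h''⟩ |
      ⟨h, h', h'' | h''⟩ | ⟨h, h', h'' | h''⟩) <;> simp [*]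

variable {V : Type*} [AddCommGroup V] [Module (ZMod 5) V] [Fintype V] [DecidableEq V]

/-- The preimage of `Λ` under a surjective linear map. -/
def VLPreimage (A : Finset V) : Prop :=
  ∃ φ : V →ₗ[ZMod 5] (Fin 3 → ZMod 5), Function.Surjective φ ∧ ∀ v, v ∈ A ↔ φ v ∈ Lam

variable {A : Finset V} {ξ η lam : V →ₗ[ZMod 5] ZMod 5} {N : ℕ}

set_option synthInstance.maxHeartbeats 400000 in
set_option synthInstance.maxSize 10000 in
-- The coordinates ξ and ε(η - bξ) put the four full cells on the axes, and the sign ε puts the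
-- remaining line on y = -2x, as in Λ. On it the values `lam` = ±1 become those listed in Λ under
-- the third coordinate 2(`lam` + ξ).
theorem vlPreimage_of_forall_mem_iff {a b : ZMod 5} (hab : a - b = 2 ∨ a - b = -2)
    (hs : ∀ x y z, ∃ v, ξ v = x ∧ η v = y ∧ lam v = z)
    (hA : ∀ v, v ∈ A ↔ (ξ v = 0 ∧ (η v = 1 ∨ η v = -1)) ∨ (ξ v = 1 ∧ η v = b) ∨
      (ξ v = -1 ∧ η v = -b) ∨ (η v = a * ξ v ∧ ξ v ≠ 0 ∧ (lam v = 1 ∨ lam v = -1))) :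
    VLPreimage A := by
  obtain ⟨ε, hεδ, hε2⟩ : ∃ ε : ZMod 5, (ε = 1 ∧ a - b = -2 ∨ ε = -1 ∧ a - b = 2) ∧ ε * ε = 1 := by
    rcases hab with h | h
    · exact ⟨-1, Or.inr ⟨rfl, h⟩, by decide⟩
    · exact ⟨1, Or.inl ⟨rfl, h⟩, by decide⟩
  refine ⟨LinearMap.pi ![ξ, ε • (η - b • ξ), (2 : ZMod 5) • (lam + ξ)], fun w => ?_, fun v => ?_⟩
  · obtain ⟨v, h1, h2, h3⟩ := hs (w 0) (ε * w 1 + b * w 0) (3 * w 2 - w 0)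
    refine ⟨v, ?_⟩
    funext i
    fin_cases i
    · simpa using h1
    · simp [h1, h2, ← mul_assoc, hε2]
    · simp only [LinearMap.pi_apply, Fin.reduceFinMk, Matrix.cons_val, LinearMap.smul_apply,
        LinearMap.add_apply, h1, h3, smul_eq_mul]
      linear_combination (w 2) * five_eq_zero
  · rw [hA, mem_Lam_iff]
    simp only [LinearMap.pi_apply, Matrix.cons_val_zero, Matrix.cons_val_one, Matrix.cons_val,
      LinearMap.smul_apply, LinearMap.add_apply, LinearMap.sub_apply, smul_eq_mul]
    have key : ∀ ε δ : ZMod 5, (ε = 1 ∧ δ = -2 ∨ ε = -1 ∧ δ = 2) → ∀ x y l : ZMod 5,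
      ((x = 0 ∧ (y = 1 ∨ y = -1)) ∨ (x = 1 ∧ y = 0) ∨ (x = -1 ∧ y = 0) ∨
        (y = δ * x ∧ x ≠ 0 ∧ (l = 1 ∨ l = -1))) ↔
      ((x = 1 ∨ x = -1) ∧ ε * y = 0) ∨ (x = 0 ∧ (ε * y = 1 ∨ ε * y = -1)) ∨
      (x = -1 ∧ ε * y = 2 ∧ (2 * (l + x) = 0 ∨ 2 * (l + x) = 1)) ∨
      (x = 2 ∧ ε * y = 1 ∧ (2 * (l + x) = 1 ∨ 2 * (l + x) = 2)) ∨
      (x = 1 ∧ ε * y = -2 ∧ (2 * (l + x) = 0 ∨ 2 * (l + x) = -1)) ∨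
      (x = -2 ∧ ε * y = -1 ∧ (2 * (l + x) = -1 ∨ 2 * (l + x) = -2)) := by
      rintro _ _ (⟨rfl, rfl⟩ | ⟨rfl, rfl⟩) <;> decide
    rw [← key ε (a - b) hεδ]
    have e1 : ξ v = 0 → η v - b * ξ v = η v := fun h => by rw [h]; ring
    have e2 : (ξ v = 1 ∧ η v = b) ↔ (ξ v = 1 ∧ η v - b * ξ v = 0) :=
      and_congr_right fun h => by rw [h, mul_one, sub_eq_zero]
    have e3 : (ξ v = -1 ∧ η v = -b) ↔ (ξ v = -1 ∧ η v - b * ξ v = 0) :=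
      and_congr_right fun h => by rw [h, mul_neg, mul_one, sub_eq_zero]
    have e4 : η v = a * ξ v ↔ η v - b * ξ v = (a - b) * ξ v := by
      rw [sub_mul, sub_left_inj]
    have e5 : (ξ v = 0 ∧ (η v = 1 ∨ η v = -1)) ↔
        (ξ v = 0 ∧ (η v - b * ξ v = 1 ∨ η v - b * ξ v = -1)) :=
      and_congr_right fun h => by rw [e1 h]
    rw [e2, e3, e4, e5]

/-- The four cells of density 2/5 lie on the hyperplane η = aξ, whose section has 8N/5 > 28N/25
elements. By induction some `lam` is ±1 on it, and each cell has just the size of the two fibers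
`lam` = 1 and `lam` = -1. -/
theorem Pivot.vlPreimage (P : Pivot A ξ η N)
    (ih : ∀ χ : V →ₗ[ZMod 5] ZMod 5, χ ≠ 0 → 28 * N < 25 * #(A.filter fun a => χ a = 0) →
      ∃ lam : V →ₗ[ZMod 5] ZMod 5, ∀ a ∈ A, χ a = 0 → lam a = 1 ∨ lam a = -1)
    (hp : density A ξ η N 0 1 = 1) (hq : density A ξ η N 0 (-1) = 1) {k a : ZMod 5}
    (ha : a = k + 1 ∨ a = k + 4)
    (hT : TripleSupport (oneDensity (density A ξ η N)) (twoDensity (density A ξ η N)) k)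
    (h1 : density A ξ η N 1 a = 2 / 5) (h2 : density A ξ η N (-1) (-a) = 2 / 5)
    (h3 : density A ξ η N 2 (2 * a) = 2 / 5) (h4 : density A ξ η N (-2) (-(2 * a)) = 2 / 5)
    (h5 : density A ξ η N 1 (2 * k - a) = 1)
    (h6 : density A ξ η N (-1) (-(2 * k - a)) = 1) : VLPreimage A := by
  have hN : (0 : ℚ) < N := by exact_mod_cast P.pos
  have nn := P.planeDensity.nonneg
  have hUa : ∀ c, 0 < oneDensity (density A ξ η N) c → c = a ∨ c = 2 * k - a := by
    obtain ⟨⟨t0, t1, t2, t3, t4⟩, -⟩ := hT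
    refine forall_zmod_five_shift (p := fun c => 0 < oneDensity (density A ξ η N) c →
      c = a ∨ c = 2 * k - a) k ?_ ?_ ?_ ?_ ?_
    · exact fun h => absurd h (by rw [t0]; exact lt_irrefl _)
    · rcases ha with rfl | rfl
      · exact fun _ => Or.inl rfl
      · exact fun _ => Or.inr (by linear_combination five_eq_zero)
    · exact fun h => absurd h (by rw [t2]; exact lt_irrefl _)
    · exact fun h => absurd h (by rw [t3]; exact lt_irrefl _)
    · rcases ha with rfl | rfl
      · exact fun _ => Or.inr (by linear_combination five_eq_zero)
      · exact fun _ => Or.inl rfl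
  have hWa : ∀ c, 0 < twoDensity (density A ξ η N) c → c = a := by
    obtain ⟨-, s0, s2, s3, s14⟩ := hT
    have hpos : 0 < twoDensity (density A ξ η N) a := by
      unfold twoDensity
      rw [h3, h4]
      norm_num
    refine forall_zmod_five_shift (p := fun c => 0 < twoDensity (density A ξ η N) c →
      c = a) k ?_ ?_ ?_ ?_ ?_
    · exact fun h => absurd h (by rw [s0]; exact lt_irrefl _)
    · intro h
      rcases ha with rfl | rfl
      · rfl
      · rcases s14 with s | s <;> linarith
    · exact fun h => absurd h (by rw [s2]; exact lt_irrefl _)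
    · exact fun h => absurd h (by rw [s3]; exact lt_irrefl _)
    · intro h
      rcases ha with rfl | rfl
      · rcases s14 with s | s <;> linarith
      · rfl
  have hab : a - (2 * k - a) = 2 ∨ a - (2 * k - a) = -2 := by
    rcases ha with rfl | rfl
    · left; ring
    · right; linear_combination 2 * five_eq_zero
  have hfull : ∀ {x y v}, density A ξ η N x y = 1 → ξ v = x → η v = y → v ∈ A := by
    intro x y v hd hx hy
    have hc := P.card_cell_of_density hd
    rw [one_mul] at hc
    have hc' : #(cell A ξ η x y) = N := by exact_mod_cast hc
    have h := card_fiber_two P.surj x y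
    have heq : cell A ξ η x y = univ.filter fun v => ξ v = x ∧ η v = y := by
      apply Finset.eq_of_subset_of_card_le
      · intro a ha
        rw [mem_cell] at ha
        simpa using ha.2
      · have := P.card
        omega
    have : v ∈ cell A ξ η x y := by rw [heq]; simp [hx, hy]
    exact (mem_cell.1 this).1
  have cells : ∀ x, x ≠ 0 → density A ξ η N x (a * x) = 2 / 5 := by
    intro x hx
    have : x = 1 ∨ x = -1 ∨ x = 2 ∨ x = -2 := by revert x; decide
    rcases this with rfl | rfl | rfl | rfl
    · rwa [mul_one]
    · rwa [mul_neg, mul_one]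
    · rwa [mul_comm]
    · rwa [mul_neg, mul_comm]
  have cc : ∀ x, x ≠ 0 → 5 * #(cell A ξ η x (a * x)) = 2 * N := by
    intro x hx
    have := P.card_cell_of_density (cells x hx)
    have : (5 * #(cell A ξ η x (a * x)) : ℚ) = 2 * N := by linarith
    exact_mod_cast this
  have hz0 : ∃ v, ξ v = 0 ∧ (η - a • ξ) v = 1 := by
    obtain ⟨v, v1, v2⟩ := P.surj 0 1
    exact ⟨v, v1, by simp [v1, v2]⟩
  obtain ⟨lam, hlam⟩ := ih (η - a • ξ) (fun h => by
      obtain ⟨v, v1, v2⟩ := hz0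
      have := LinearMap.congr_fun h v
      rw [v2, LinearMap.zero_apply] at this
      exact absurd this (by decide)) (by
    rw [card_line]
    have h : ∑ x : ZMod 5, #(cell A ξ η x (a * x)) = #(cell A ξ η 0 (a * 0)) +
      #(cell A ξ η 1 (a * 1)) + #(cell A ξ η 2 (a * 2)) + #(cell A ξ η 3 (a * 3)) +
      #(cell A ξ η 4 (a * 4)) := Fin.sum_univ_five _
    have := cc 1 (by decide)
    have := cc 2 (by decide)
    have := cc 3 (by decide)
    have := cc 4 (by decide)
    have := P.pos
    omega)
  have hlam' : ∀ v ∈ A, η v = a * ξ v → lam v = 1 ∨ lam v = -1 := fun v hv h =>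
    hlam v hv (by simp [h])
  -- If `lam` vanished on the kernel of (ξ, η), points s over (1, a) and t over (2, 2a) would
  -- satisfy `lam t = 2 * lam s`, which is impossible for values ±1.
  obtain ⟨w, w1, w2, w3⟩ : ∃ w, ξ w = 0 ∧ η w = 0 ∧ lam w ≠ 0 := by
    by_contra! hcon
    obtain ⟨s, hs⟩ := P.density_pos.1 (by rw [h1]; norm_num : 0 < density A ξ η N 1 a)
    obtain ⟨t, ht⟩ := P.density_pos.1 (by rw [h3]; norm_num : 0 < density A ξ η N 2 (2 * a))
    rw [mem_cell] at hs ht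
    have e := hcon (t - (2 : ZMod 5) • s) (by simp [hs, ht]) (by simp [hs, ht])
    have b1 := hlam' s hs.1 (by simp [hs])
    have b2 := hlam' t ht.1 (by rw [ht.2.1, ht.2.2, mul_comm])
    rw [map_sub, map_smul, smul_eq_mul, sub_eq_zero] at e
    rw [e] at b2
    revert b1 b2
    generalize lam s = l
    revert l
    decide
  have hs := jointly_surjective_three P.surj w1 w2 w3
  have hline : ∀ v, η v = a * ξ v → ξ v ≠ 0 → (lam v = 1 ∨ lam v = -1) → v ∈ A := by
    intro v hv hv0 hl
    have c1 := card_fiber_three hs (ξ v) (a * ξ v) 1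
    have c2 := card_fiber_three hs (ξ v) (a * ξ v) (-1)
    have c3 := cc (ξ v) hv0
    have heq : cell A ξ η (ξ v) (a * ξ v) =
        (univ.filter fun u => ξ u = ξ v ∧ η u = a * ξ v ∧ lam u = 1) ∪
        (univ.filter fun u => ξ u = ξ v ∧ η u = a * ξ v ∧ lam u = -1) := by
      apply Finset.eq_of_subset_of_card_le
      · intro u hu
        rw [mem_cell] at hu
        simp only [Finset.mem_union, Finset.mem_filter, Finset.mem_univ, true_and]
        rcases hlam' u hu.1 (by rw [hu.2.1, hu.2.2]) with h | h
        · exact Or.inl ⟨hu.2.1, hu.2.2, h⟩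
        · exact Or.inr ⟨hu.2.1, hu.2.2, h⟩
      · refine (Finset.card_union_le _ _).trans ?_
        have := P.card
        omega
    have : v ∈ cell A ξ η (ξ v) (a * ξ v) := by
      rw [heq]
      simp only [Finset.mem_union, Finset.mem_filter, Finset.mem_univ, true_and, hv]
      exact hl
    exact (mem_cell.1 this).1
  refine vlPreimage_of_forall_mem_iff (a := a) hab hs fun v => ⟨fun hv => ?_, ?_⟩
  · have key : ξ v = 0 ∨ ξ v = 1 ∨ ξ v = -1 ∨ ξ v = 2 ∨ ξ v = -2 :=
      (by decide : ∀ x : ZMod 5, x = 0 ∨ x = 1 ∨ x = -1 ∨ x = 2 ∨ x = -2) (ξ v)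
    have hpos : 0 < density A ξ η N (ξ v) (η v) := P.density_pos.2 ⟨v, mem_cell.2 ⟨hv, rfl, rfl⟩⟩
    have hl := hlam' v hv
    have e1 := (by decide : ∀ y : ZMod 5, 2 * (3 * y) = y) (η v)
    have e2 := (by decide : ∀ y : ZMod 5, -(2 * (-(3 * y))) = y) (η v)
    rcases key with h | h | h | h | h <;> rw [h] at hpos hl
    · exact Or.inl ⟨h, P.pm v hv h⟩
    · rcases hUa (η v) (by unfold oneDensity; linarith [nn (-1) (-η v)]) with h' | h'
      · have h'' : η v = a * 1 := by rw [h', mul_one]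
        exact Or.inr (Or.inr (Or.inr ⟨by rw [h, h''], by rw [h]; decide, hl h''⟩))
      · exact Or.inr (Or.inl ⟨h, h'⟩)
    · rcases hUa (-η v) (by unfold oneDensity; rw [neg_neg]; linarith [nn 1 (-η v)]) with h' | h'
      · have h'' : η v = a * -1 := by rw [← h', mul_neg, mul_one, neg_neg]
        exact Or.inr (Or.inr (Or.inr ⟨by rw [h, h''], by rw [h]; decide, hl h''⟩))
      · exact Or.inr (Or.inr (Or.inl ⟨h, by rw [← h', neg_neg]⟩))
    · have h' := hWa (3 * η v) (by unfold twoDensity; rw [e1]; linarith [nn (-2) (-η v)])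
      have h'' : η v = a * 2 := by rw [← h', mul_comm, e1]
      exact Or.inr (Or.inr (Or.inr ⟨by rw [h, h''], by rw [h]; decide, hl h''⟩))
    · have h' := hWa (-(3 * η v)) (by
        unfold twoDensity; rw [e2]; linarith [nn 2 (2 * -(3 * η v))])
      have h'' : η v = a * -2 := by rw [← h', mul_neg, mul_comm, e2]
      exact Or.inr (Or.inr (Or.inr ⟨by rw [h, h''], by rw [h]; decide, hl h''⟩))
  · rintro (⟨h, h' | h'⟩ | ⟨h, h'⟩ | ⟨h, h'⟩ | ⟨h, h', h''⟩)
    · exact hfull hp h h'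
    · exact hfull hq h h'
    · exact hfull h5 h h'
    · exact hfull h6 h h'
    · exact hline v h h' h''

end Reconstruction

/-! ### Size, sum-freeness and non-normality of Λ -/

section LamFacts

set_option synthInstance.maxHeartbeats 400000 in
set_option synthInstance.maxSize 10000 in
instance : DecidablePred (· ∈ Lam) := fun w => decidable_of_iff' _ (mem_Lam_iff w)

theorem card_filter_mem_Lam : #(univ.filter (· ∈ Lam)) = 28 := by decide +kernel

theorem add_notMem_Lam {u v : Fin 3 → ZMod 5} (hu : u ∈ Lam) (hv : v ∈ Lam) : u + v ∉ Lam := by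
  have h : ∀ u ∈ univ.filter (· ∈ Lam), ∀ v ∈ univ.filter (· ∈ Lam), u + v ∉ Lam := by
    decide +kernel
  exact h u (by simpa using hu) v (by simpa using hv)

/-- Six points of Λ already exclude every functional (α, β, γ). -/
theorem not_forall_Lam (α β γ : ZMod 5) :
    ¬ ∀ x y z, ![x, y, z] ∈ Lam → x * α + y * β + z * γ = 1 ∨ x * α + y * β + z * γ = -1 := by
  intro h
  have h1 := h 1 0 0 (by decide)
  have h2 := h 1 0 1 (by decide)
  have h3 := h 1 0 2 (by decide)
  have h4 := h 0 1 0 (by decide)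
  have h5 := h (-1) 2 0 (by decide)
  have h6 := h 2 1 1 (by decide)
  revert α β γ
  decide +kernel

variable {V : Type*} [AddCommGroup V] [Module (ZMod 5) V]

theorem VLPreimage.card [Fintype V] [DecidableEq V] {A : Finset V} (h : VLPreimage A) :
    125 * #A = 28 * Fintype.card V := by
  obtain ⟨φ, hφ, hA⟩ := h
  have h1 := Finset.card_eq_sum_card_fiberwise (f := φ) (s := A) (t := univ.filter (· ∈ Lam))
    (fun a ha => by simpa using (hA a).1 ha)
  have h2 : ∀ w ∈ univ.filter (· ∈ Lam), 125 * #(A.filter fun a => φ a = w) = Fintype.card V := by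
    intro w hw
    have h := card_fiber_mul φ.toAddMonoidHom hφ w
    rw [Fintype.card_fun, ZMod.card, Fintype.card_fin, mul_comm] at h
    rw [← h]
    congr 2
    ext v
    rw [Finset.mem_filter_univ] at hw
    rw [Finset.mem_filter, Finset.mem_filter_univ, hA]
    exact ⟨fun h => h.2, fun h => ⟨(show φ v = w from h) ▸ hw, h⟩⟩
  rw [h1, Finset.mul_sum, Finset.sum_congr rfl h2, Finset.sum_const, card_filter_mem_Lam,
    smul_eq_mul]

theorem VLPreimage.isSumFree {A : Finset V} (h : VLPreimage A) : IsSumFree A := by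
  obtain ⟨φ, hφ, hA⟩ := h
  intro x hx y hy z hz hxy
  rw [hA] at hx hy hz
  rw [← hxy, map_add] at hz
  exact add_notMem_Lam hx hy hz

theorem VLPreimage.exists_mem_neg_mem {A : Finset V} (h : VLPreimage A) : ∃ v, v ∈ A ∧ -v ∈ A := by
  obtain ⟨φ, hφ, hA⟩ := h
  obtain ⟨v, hv⟩ := hφ ![1, 0, 0]
  refine ⟨v, (hA v).2 (by rw [hv]; decide), (hA _).2 (by rw [map_neg, hv]; decide)⟩

theorem VLPreimage.not_normalSet {A : Finset V} (h : VLPreimage A) : ¬ NormalSet A := by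
  obtain ⟨φ, hφ, hA⟩ := h
  rintro ⟨χ, hχ⟩
  obtain ⟨v₁, h1⟩ := hφ ![1, 0, 0]
  obtain ⟨v₂, h2⟩ := hφ ![0, 1, 0]
  obtain ⟨v₃, h3⟩ := hφ ![0, 0, 1]
  refine not_forall_Lam (χ v₁) (χ v₂) (χ v₃) fun x y z h => ?_
  have := hχ (x • v₁ + y • v₂ + z • v₃) ((hA _).2 (by
    simpa only [map_add, map_smul, h1, h2, h3, Matrix.smul_cons, Matrix.smul_empty, smul_eq_mul,
      mul_one, mul_zero, Matrix.cons_add_cons, Matrix.empty_add_empty, add_zero, zero_add] using h))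
  simpa only [map_add, map_smul, smul_eq_mul] using this

end LamFacts

/-! ### The dichotomy for a set with a normal densest section -/

section Outcome

variable {V : Type*} [AddCommGroup V] [Module (ZMod 5) V] [Fintype V] [DecidableEq V]
  {A : Finset V} {ξ η : V →ₗ[ZMod 5] ZMod 5} {N : ℕ}

theorem Pivot.vlPreimage_of_exceptional (P : Pivot A ξ η N)
    (ih : ∀ χ : V →ₗ[ZMod 5] ZMod 5, χ ≠ 0 → 28 * N < 25 * #(A.filter fun a => χ a = 0) →
      ∃ lam : V →ₗ[ZMod 5] ZMod 5, ∀ a ∈ A, χ a = 0 → lam a = 1 ∨ lam a = -1)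
    (h : Exceptional (density A ξ η N)) : VLPreimage A := by
  rcases h with ⟨hT, h1, h2⟩ | ⟨hT, k, -, h1, h2, h3⟩ | ⟨hp, hq, k, a, ha, hT, h1, h2, h3, h4, h5, h6, -⟩
  · exact absurd h2 (P.not_full hT h1)
  · exact absurd h3 (P.not_path hT h1 h2)
  · exact P.vlPreimage ih hp hq ha hT h1 h2 h3 h4 h5 h6

theorem Pivot.outcome (P : Pivot A ξ η N)
    (ih : ∀ χ : V →ₗ[ZMod 5] ZMod 5, χ ≠ 0 → 28 * N < 25 * #(A.filter fun a => χ a = 0) →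
      ∃ lam : V →ₗ[ZMod 5] ZMod 5, ∀ a ∈ A, χ a = 0 → lam a = 1 ∨ lam a = -1) :
    NormalSet A ∨ VLPreimage A := by
  rcases P.planeDensity.outcome with h | h | h
  · exact Or.inl (P.normalSet h)
  · exact Or.inr (P.vlPreimage_of_exceptional ih h)
  · exact Or.inr (P.swap.vlPreimage_of_exceptional ih (by rwa [density_two_smul]))

end Outcome

/-! ### Double counting over hyperplanes through a vector -/

section Averaging

variable {V : Type*} [AddCommGroup V] [Module (ZMod 5) V] [Fintype V] [DecidableEq V]

/-- Averaging over the hyperplanes through a given nonzero vector. -/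
theorem exists_dense_section (A : Finset V) {N : ℕ} (hN : 25 * N = Fintype.card V) {x : V}
    (hx : x ≠ 0) {c : ℕ} (hc : c ≤ #(A.filter fun a => ∃ t : ZMod 5, t • x = a)) :
    ∃ χ : V →ₗ[ZMod 5] ZMod 5, χ ≠ 0 ∧
      4 * c * N + #A * N + #(A.filter fun a => χ a = 0) ≤
        5 * N * #(A.filter fun a => χ a = 0) + #A := by
  classical
  have : Finite (V →ₗ[ZMod 5] ZMod 5) := DFunLike.finite _
  have : Fintype (V →ₗ[ZMod 5] ZMod 5) := Fintype.ofFinite _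
  have hcard : Fintype.card (V →ₗ[ZMod 5] ZMod 5) = 25 * N := by
    rw [hN, Module.card_eq_pow_finrank (K := ZMod 5) (V := V),
      Module.card_eq_pow_finrank (K := ZMod 5) (V := V →ₗ[ZMod 5] ZMod 5)]
    congr 1
    exact Subspace.dual_finrank_eq
  let ev : V → ((V →ₗ[ZMod 5] ZMod 5) →ₗ[ZMod 5] ZMod 5) := fun v => LinearMap.applyₗ v
  have hev : ∀ v χ, ev v χ = χ v := fun v χ => rfl
  obtain ⟨χ₀, h0⟩ := Module.Projective.exists_dual_ne_zero (ZMod 5) hx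
  have hx0 : ev x ≠ 0 := fun h => h0 (LinearMap.congr_fun h χ₀)
  have h1 : #(univ.filter fun χ : V →ₗ[ZMod 5] ZMod 5 => χ x = 0) = 5 * N := by
    have := card_fiber_one hx0 0
    simp only [hev] at this
    omega
  -- A multiple of x is killed by all 5N functionals that kill x, any other vector by one fifth of
  -- them.
  have h2 : ∀ a : V, #(univ.filter fun χ : V →ₗ[ZMod 5] ZMod 5 => χ x = 0 ∧ χ a = 0) =
      if ∃ t : ZMod 5, t • x = a then 5 * N else N := by
    intro a
    split_ifs with h
    · obtain ⟨t, rfl⟩ := h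
      rw [← h1]
      congr 1
      ext χ
      simp +contextual
    · obtain ⟨χ, hχ, hle⟩ := Submodule.exists_le_ker_of_notMem
        (p := Submodule.span (ZMod 5) {x}) (v := a) (by rwa [Submodule.mem_span_singleton])
      have hχx : χ x = 0 := hle (Submodule.mem_span_singleton_self x)
      have := card_fiber_two (jointly_surjective_two (ξ := ev x) (η := ev a) (b := χ₀) h0
        (a := χ) hχx hχ) 0 0
      simp only [hev] at this
      omega
  set S : Finset (V →ₗ[ZMod 5] ZMod 5) := univ.filter fun χ => χ x = 0 with hS
  have h3 : ∑ χ ∈ S, #(A.filter fun a => χ a = 0) =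
      ∑ a ∈ A, if ∃ t : ZMod 5, t • x = a then 5 * N else N := by
    simp only [← h2, Finset.card_filter, hS, Finset.sum_filter]
    rw [Finset.sum_comm' (s := A) (t := fun _ => univ) (t' := univ) (s' := fun _ => A) (by simp)]
    refine Finset.sum_congr rfl fun χ _ => ?_
    by_cases h : χ x = 0 <;> simp [h]
  have h4 : (∑ a ∈ A, if ∃ t : ZMod 5, t • x = a then 5 * N else N) =
      4 * #(A.filter fun a => ∃ t : ZMod 5, t • x = a) * N + #A * N := by
    have : ∀ a, (if ∃ t : ZMod 5, t • x = a then 5 * N else N) =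
        N + 4 * N * (if ∃ t : ZMod 5, t • x = a then 1 else 0) := by
      intro a; split_ifs <;> ring
    simp only [this]
    rw [Finset.sum_add_distrib, ← Finset.mul_sum, ← Finset.card_filter, Finset.sum_const,
      smul_eq_mul]
    ring
  -- The zero functional contributes |A| to the double count and is removed; this is the source of
  -- the lower-order terms in the inequality.
  have hmem : (0 : V →ₗ[ZMod 5] ZMod 5) ∈ S := by simp [hS]
  have h5 : #(S.erase 0) + 1 = 5 * N := by rw [← h1, Finset.card_erase_add_one hmem]
  have h6 := Finset.add_sum_erase S (fun χ => #(A.filter fun a => χ a = 0)) hmem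
  simp only [LinearMap.zero_apply, Finset.filter_true] at h6
  have hpos : 0 < N := by
    have : 0 < Fintype.card V := Fintype.card_pos
    omega
  obtain ⟨χ, hχ, hmax⟩ := Finset.exists_max_image (S.erase 0)
    (fun χ => #(A.filter fun a => χ a = 0)) (Finset.card_pos.1 (by omega))
  refine ⟨χ, Finset.ne_of_mem_erase hχ, ?_⟩
  have h7 := Finset.sum_le_card_nsmul _ _ _ hmax
  rw [smul_eq_mul] at h7
  have h8 : 4 * c * N ≤ 4 * #(A.filter fun a => ∃ t : ZMod 5, t • x = a) * N := by gcongr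
  generalize #(A.filter fun a => χ a = 0) = m at *
  have h9 : 5 * N * m = #(S.erase 0) * m + m := by rw [← h5]; ring
  omega

end Averaging

/-! ### Induction on the dimension -/

section Classification

universe u

/-- Large sum-free sets in spaces with `m` elements are normal or VL-sets. -/
def Classified (m : ℕ) : Prop :=
  ∀ (V : Type u) [AddCommGroup V] [Module (ZMod 5) V] [Fintype V] [DecidableEq V],
    Fintype.card V = m → ∀ A : Finset V, IsSumFree A → 28 * m ≤ 125 * #A →
      NormalSet A ∨ VLPreimage A

/-- A section that is a preimage of Λ has exactly the threshold size, so strict inequality leaves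
only the normal case; at the threshold its antipodal pair is what the induction uses. -/
theorem Classified.section {m : ℕ} (hm : Classified.{u} m) {V : Type u} [AddCommGroup V]
    [Module (ZMod 5) V] [Fintype V] [DecidableEq V] (hV : Fintype.card V = 5 * m) {A : Finset V}
    (hA : IsSumFree A) {χ : V →ₗ[ZMod 5] ZMod 5} (hχ : χ ≠ 0)
    (h : 28 * m ≤ 125 * #(A.filter fun a => χ a = 0)) :
    (∃ lam : V →ₗ[ZMod 5] ZMod 5, ∀ a ∈ A, χ a = 0 → lam a = 1 ∨ lam a = -1) ∨
      125 * #(A.filter fun a => χ a = 0) = 28 * m ∧ ∃ v, χ v = 0 ∧ v ∈ A ∧ -v ∈ A := by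
  classical
  have hK : Fintype.card (LinearMap.ker χ) = m := by
    have := card_fiber_one hχ 0
    rw [← Fintype.card_subtype] at this
    have e : Fintype.card (LinearMap.ker χ) = Fintype.card {v // χ v = 0} :=
      Fintype.card_congr (Equiv.refl _)
    omega
  have hB : #(A.subtype (· ∈ LinearMap.ker χ)) = #(A.filter fun a => χ a = 0) := by
    rw [Finset.card_subtype]
    congr
  rw [← hB] at h ⊢
  rcases hm (LinearMap.ker χ) hK (A.subtype (· ∈ LinearMap.ker χ)) (fun x hx y hy z hz hxy => by
    rw [Finset.mem_subtype] at hx hy hz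
    exact hA _ hx _ hy _ hz (congrArg Subtype.val hxy)) h with ⟨f, hf⟩ | hvl
  · obtain ⟨g, hg⟩ := f.exists_extend
    refine Or.inl ⟨g, fun a ha h0 => ?_⟩
    have := hf ⟨a, h0⟩ (Finset.mem_subtype.2 ha)
    rwa [← hg] at this
  · obtain ⟨v, h1, h2⟩ := hvl.exists_mem_neg_mem
    rw [Finset.mem_subtype] at h1 h2
    exact Or.inr ⟨by rw [hvl.card, hK], v, v.2, h1, h2⟩

theorem Classified.section_of_lt {m : ℕ} (hm : Classified.{u} m) {V : Type u} [AddCommGroup V]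
    [Module (ZMod 5) V] [Fintype V] [DecidableEq V] (hV : Fintype.card V = 5 * m) {A : Finset V}
    (hA : IsSumFree A) {χ : V →ₗ[ZMod 5] ZMod 5} (hχ : χ ≠ 0)
    (h : 28 * m < 125 * #(A.filter fun a => χ a = 0)) :
    ∃ lam : V →ₗ[ZMod 5] ZMod 5, ∀ a ∈ A, χ a = 0 → lam a = 1 ∨ lam a = -1 := by
  rcases hm.section hV hA hχ h.le with h' | ⟨h', -⟩
  · exact h'
  · omega

variable {V : Type u} [AddCommGroup V] [Module (ZMod 5) V] [Fintype V] [DecidableEq V]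

theorem IsSumFree.ne_zero {A : Finset V} (hA : IsSumFree A) {x : V} (hx : x ∈ A) : x ≠ 0 := by
  rintro rfl
  exact hA 0 hx 0 hx 0 hx (add_zero 0)

/-- Proportional elements of a sum-free set are equal or opposite. -/
theorem IsSumFree.eq_one_or_neg_one {A : Finset V} (hA : IsSumFree A) {x : V} (hx : x ∈ A)
    {t : ZMod 5} (ht : t • x ∈ A) : t = 1 ∨ t = -1 := by
  have h0 := hA.ne_zero ht
  have : t = 0 ∨ t = 1 ∨ t = -1 ∨ t = 2 ∨ t = 3 :=
    (by decide : ∀ t : ZMod 5, t = 0 ∨ t = 1 ∨ t = -1 ∨ t = 2 ∨ t = 3) t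
  rcases this with rfl | rfl | rfl | rfl | rfl
  · exact absurd (zero_smul _ x) h0
  · exact Or.inl rfl
  · exact Or.inr rfl
  · exact absurd (two_smul (ZMod 5) x).symm (hA x hx x hx _ ht)
  · refine absurd ?_ (hA _ ht _ ht _ hx)
    rw [← add_smul, show (3 : ZMod 5) + 3 = 1 from rfl, one_smul]

theorem classified_five : Classified.{u} 5 := by
  intro V _ _ _ _ hV A hA hcard
  obtain ⟨x, hx⟩ : A.Nonempty := Finset.card_pos.1 (by omega)
  obtain ⟨χ, hχ⟩ := Module.Projective.exists_dual_eq_one (ZMod 5) (hA.ne_zero hx)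
  refine Or.inl ⟨χ, fun a ha => ?_⟩
  have hspan : χ a • x = a := by
    have h := card_fiber_one (ξ := χ) (fun h => by
      rw [h, LinearMap.zero_apply] at hχ
      exact absurd hχ (by decide)) (χ a)
    rw [hV] at h
    have h1 : #(univ.filter fun v => χ v = χ a) ≤ 1 := by omega
    exact Finset.card_le_one.1 h1 _ (by simp [hχ]) _ (by simp)
  exact hA.eq_one_or_neg_one hx (by rwa [hspan])

theorem Classified.of_antipodal {N : ℕ} (ih : Classified.{u} (5 * N))
    (hV : 25 * N = Fintype.card V) {A : Finset V} (hA : IsSumFree A) (hcard : 28 * N ≤ 5 * #A)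
    {x : V} (h1 : x ∈ A) (h2 : -x ∈ A) : NormalSet A ∨ VLPreimage A := by
  classical
  have hN : 0 < N := by
    have : 0 < Fintype.card V := Fintype.card_pos
    omega
  have hV' : Fintype.card V = 5 * (5 * N) := by omega
  have hx := hA.ne_zero h1
  have hne : x ≠ -x := by
    intro h
    apply hx
    have h5 : (3 : ZMod 5) • (x + x) = x := by
      rw [← two_smul (ZMod 5), smul_smul, show (3 : ZMod 5) * 2 = 1 from rfl, one_smul]
    rw [← h5, add_eq_zero_iff_eq_neg.2 h, smul_zero]
  have hc : 2 ≤ #(A.filter fun a => ∃ t : ZMod 5, t • x = a) := by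
    rw [← Finset.card_pair hne]
    refine Finset.card_le_card fun a ha => ?_
    rw [Finset.mem_insert, Finset.mem_singleton] at ha
    rw [Finset.mem_filter]
    rcases ha with rfl | rfl
    · exact ⟨h1, 1, one_smul _ _⟩
    · exact ⟨h2, -1, by simp⟩
  obtain ⟨χ, hχ, hden⟩ := exists_dense_section A hV hx hc
  have : Finite (V →ₗ[ZMod 5] ZMod 5) := DFunLike.finite _
  have : Fintype (V →ₗ[ZMod 5] ZMod 5) := Fintype.ofFinite _
  obtain ⟨ξ, hξ, hmax⟩ := Finset.exists_max_image
    (univ.filter fun χ : V →ₗ[ZMod 5] ZMod 5 => χ ≠ 0)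
    (fun χ => #(A.filter fun a => χ a = 0)) ⟨χ, by simpa using hχ⟩
  have hξ0 : ξ ≠ 0 := by simpa using hξ
  have hmax' : ∀ χ : V →ₗ[ZMod 5] ZMod 5, χ ≠ 0 →
      #(A.filter fun a => χ a = 0) ≤ #(A.filter fun a => ξ a = 0) :=
    fun χ h => hmax χ (by simpa using h)
  -- For m elements in the averaged section, two points on the line of x give 25m(5N - 1) ≥ 140N² +
  -- 60N, against 28N(5N - 1) = 140N² - 28N.
  have hbig : 28 * N < 25 * #(A.filter fun a => ξ a = 0) := by
    refine lt_of_lt_of_le ?_ (Nat.mul_le_mul_left 25 (hmax' χ hχ))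
    clear hmax hmax'
    generalize #(A.filter fun a => χ a = 0) = m at *
    zify at *
    nlinarith
  have ih' : ∀ χ : V →ₗ[ZMod 5] ZMod 5, χ ≠ 0 → 28 * N < 25 * #(A.filter fun a => χ a = 0) →
      ∃ lam : V →ₗ[ZMod 5] ZMod 5, ∀ a ∈ A, χ a = 0 → lam a = 1 ∨ lam a = -1 :=
    fun χ h h' => ih.section_of_lt hV' hA h (by omega)
  obtain ⟨η, hη⟩ := ih' ξ hξ0 hbig
  rcases le_total #(cell A ξ η 0 (-1)) #(cell A ξ η 0 1) with hle | hle
  · exact Pivot.outcome ⟨hA, hV, hξ0, hcard, hmax', hη, hbig, hle⟩ ih'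
  · refine Pivot.outcome (η := -η) ⟨hA, hV, hξ0, hcard, hmax', fun a ha h => ?_, hbig, ?_⟩ ih'
    · rw [LinearMap.neg_apply, neg_inj, neg_eq_iff_eq_neg]
      exact (hη a ha h).symm
    · simpa only [cell, LinearMap.neg_apply, neg_inj, neg_eq_iff_eq_neg, neg_neg] using hle

/-- A normal section without antipodal pair is embedded by v ↦ `lam v • v` in a fiber of 5M points,
fewer than the 28M/5 that averaging provides. -/
theorem Classified.exists_antipodal {M : ℕ} (ih : Classified.{u} (25 * M))
    (hV : 125 * M = Fintype.card V) {A : Finset V} (hA : IsSumFree A) (hcard : 28 * M ≤ #A) :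
    ∃ v, v ∈ A ∧ -v ∈ A := by
  have hM : 0 < M := by
    have : 0 < Fintype.card V := Fintype.card_pos
    omega
  obtain ⟨x, hx⟩ : A.Nonempty := Finset.card_pos.1 (by omega)
  obtain ⟨χ, hχ, hden⟩ := exists_dense_section A (N := 5 * M) (by omega) (hA.ne_zero hx) (c := 1)
    (Finset.card_pos.2 ⟨x, by simpa [hx] using ⟨1, one_smul _ x⟩⟩)
  -- For m elements in the section, averaging gives 5m(25M - 1) ≥ 28M(25M - 1) - 12M; the deficit
  -- 12M is less than 25M - 1, and 5m is an integer.
  have hbig : 28 * M ≤ 5 * #(A.filter fun a => χ a = 0) := by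
    generalize #(A.filter fun a => χ a = 0) = m at *
    by_contra! hlt
    zify at *
    nlinarith
  rcases ih.section (by omega) hA hχ (by omega) with ⟨lam, hlam⟩ | ⟨-, v, -, hv⟩
  swap
  · exact ⟨v, hv⟩
  by_contra! hno
  set S := A.filter fun a => χ a = 0 with hS
  have hmem : ∀ {a}, a ∈ S → lam a = 1 ∨ lam a = -1 := fun h =>
    hlam _ (Finset.mem_filter.1 h).1 (Finset.mem_filter.1 h).2
  obtain ⟨s, hs⟩ : S.Nonempty := Finset.card_pos.1 (by omega)
  obtain ⟨b, hb⟩ : ∃ b, χ b ≠ 0 := by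
    by_contra! h
    exact hχ (LinearMap.ext h)
  have hfib := card_fiber_two (jointly_surjective_two hb (Finset.mem_filter.1 hs).2
    (by rcases hmem hs with h | h <;> rw [h] <;> decide)) 0 1
  have hle : #S ≤ #(univ.filter fun v => χ v = 0 ∧ lam v = 1) := by
    refine Finset.card_le_card_of_injOn (fun v => lam v • v) (fun v hv => ?_) fun v hv w hw h => ?_
    · have h0 := (Finset.mem_filter.1 hv).2
      rcases hmem hv with h | h <;> simp [h, h0]
    · have hv' := (Finset.mem_filter.1 hv).1
      have hw' := (Finset.mem_filter.1 hw).1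
      rcases hmem hv with h1 | h1 <;> rcases hmem hw with h2 | h2 <;>
        simp only [h1, h2, one_smul, neg_smul, neg_inj] at h
      · exact h
      · exact absurd hv' (h ▸ hno w hw')
      · exact absurd hw' (h ▸ hno v hv')
      · exact h
  omega

/-- Six points of the plane, one on each line through the origin. -/
def pencilPoints (a b c d : ZMod 5) : Finset (ZMod 5 × ZMod 5) :=
  {(1, 0), (0, 1), (a, a), (b, 2 * b), (c, 3 * c), (d, 4 * d)}

theorem pencil_not_sumFree {a b c d : ZMod 5} (ha : a ≠ 0) (hb : b ≠ 0) (hc : c ≠ 0) (hd : d ≠ 0) :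
    ∃ u ∈ pencilPoints a b c d, ∃ v ∈ pencilPoints a b c d, u + v ∈ pencilPoints a b c d := by
  revert a b c d
  decide +kernel

/-- Without an antipodal pair each of the six lines through 0 carries at most one point, so all six
are occupied. With two of the points as a basis, a finite check of the other four yields a solution
of u + v = w. -/
theorem exists_antipodal_plane (hV : Fintype.card V = 25) {A : Finset V} (hA : IsSumFree A)
    (hcard : 6 ≤ #A) : ∃ v, v ∈ A ∧ -v ∈ A := by
  by_contra! hno
  have hline : ∀ {a b : V} {t : ZMod 5}, a ∈ A → b ∈ A → t • a = b → a = b := by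
    rintro a b t ha hb rfl
    rcases hA.eq_one_or_neg_one ha hb with rfl | rfl
    · rw [one_smul]
    · rw [neg_smul, one_smul] at hb
      exact absurd hb (hno a ha)
  obtain ⟨x, hx, y, hy, hxy⟩ := Finset.one_lt_card.1 (by omega : 1 < #A)
  have dual : ∀ {x y : V}, x ∈ A → y ∈ A → x ≠ y →
      ∃ f : V →ₗ[ZMod 5] ZMod 5, f x = 0 ∧ f y = 1 := by
    intro x y hx hy hxy
    obtain ⟨f, h1, h2⟩ := Submodule.exists_le_ker_of_notMem
      (p := Submodule.span (ZMod 5) {x}) (v := y) (by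
        rw [Submodule.mem_span_singleton]
        rintro ⟨t, ht⟩
        exact hxy (hline hx hy ht))
    exact ⟨(f y)⁻¹ • f, by simpa using Or.inr (h2 (Submodule.mem_span_singleton_self x)),
      by simp [h1]⟩
  obtain ⟨η, η1, η2⟩ := dual hx hy hxy
  obtain ⟨ξ, ξ1, ξ2⟩ := dual hy hx hxy.symm
  have hsurj := jointly_surjective_two (ξ := ξ) (η := η) (b := x) (a := y)
    (by rw [ξ2]; decide) ξ1 (by rw [η2]; decide)
  have hinj : ∀ {v w : V}, ξ v = ξ w → η v = η w → v = w := by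
    intro v w h1 h2
    have h := card_fiber_two hsurj (ξ w) (η w)
    rw [hV] at h
    have h' : #(univ.filter fun v => ξ v = ξ w ∧ η v = η w) ≤ 1 := by omega
    exact Finset.card_le_one.1 h' _ (by simp [h1, h2]) _ (by simp)
  have hpar : ∀ {a b : V}, a ∈ A → b ∈ A → ξ a * η b = ξ b * η a → a = b := by
    intro a b ha hb h
    by_cases h0 : ξ a = 0
    · have h1 : η a ≠ 0 := fun h1 => hA.ne_zero ha (hinj (by simpa using h0) (by simpa using h1))
      rw [h0, zero_mul, eq_comm, mul_eq_zero, or_iff_left h1] at h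
      exact hline (t := η b / η a) ha hb (hinj (by simp [h, h0]) (by simp [h1]))
    · refine hline (t := ξ b / ξ a) ha hb (hinj (by simp [h0]) ?_)
      rw [map_smul, smul_eq_mul]
      field_simp
      linear_combination -h
  have hle : ∀ ζ : V →ₗ[ZMod 5] ZMod 5, (∀ a b, ζ a = 0 → ζ b = 0 → ξ a * η b = ξ b * η a) →
      #(A.filter fun a => ζ a = 0) ≤ 1 := by
    intro ζ h
    refine Finset.card_le_one.2 fun a ha b hb => ?_
    rw [Finset.mem_filter] at ha hb
    exact hpar ha.1 hb.1 (h a b ha.2 hb.2)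
  have hpencil := card_filter_add_card_filter_pencil A ξ η
  have hle' : ∀ k : ZMod 5, #(A.filter fun a => (η - k • ξ) a = 0) ≤ 1 := fun k =>
    hle _ fun a b ha hb => by
      simp only [LinearMap.sub_apply, LinearMap.smul_apply, smul_eq_mul, sub_eq_zero] at ha hb
      rw [ha, hb]; ring
  have hξ := hle ξ fun a b ha hb => by rw [ha, hb, zero_mul, zero_mul]
  have hex : ∀ k : ZMod 5, k ≠ 0 → ∃ a ∈ A, ξ a ≠ 0 ∧ η a = k * ξ a := by
    intro k hk
    have h1 := Finset.add_sum_erase univ (fun k : ZMod 5 => #(A.filter fun a => (η - k • ξ) a = 0))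
      (Finset.mem_univ k)
    have h2 := Finset.sum_le_card_nsmul (univ.erase k) _ 1 fun k _ => hle' k
    rw [Finset.card_erase_of_mem (Finset.mem_univ k), Finset.card_univ, ZMod.card, smul_eq_mul] at h2
    obtain ⟨a, ha⟩ := Finset.card_pos.1 (by
      omega : 0 < #(A.filter fun a => (η - k • ξ) a = 0))
    rw [Finset.mem_filter, LinearMap.sub_apply, LinearMap.smul_apply, smul_eq_mul, sub_eq_zero] at ha
    refine ⟨a, ha.1, fun h => hA.ne_zero ha.1 (hinj (by simpa using h) ?_), ha.2⟩
    rw [ha.2, h, mul_zero, map_zero]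
  obtain ⟨a, ha, ha0, ha'⟩ := hex 1 (by decide)
  obtain ⟨b, hb, hb0, hb'⟩ := hex 2 (by decide)
  obtain ⟨c, hc, hc0, hc'⟩ := hex 3 (by decide)
  obtain ⟨d, hd, hd0, hd'⟩ := hex 4 (by decide)
  obtain ⟨u, hu, v, hv, huv⟩ := pencil_not_sumFree ha0 hb0 hc0 hd0
  have hlift : ∀ u ∈ pencilPoints (ξ a) (ξ b) (ξ c) (ξ d), ∃ s ∈ A, u = (ξ s, η s) := by
    intro u hu
    simp only [pencilPoints, Finset.mem_insert, Finset.mem_singleton] at hu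
    rcases hu with rfl | rfl | rfl | rfl | rfl | rfl
    · exact ⟨x, hx, by rw [ξ2, η1]⟩
    · exact ⟨y, hy, by rw [ξ1, η2]⟩
    · exact ⟨a, ha, by rw [ha', one_mul]⟩
    · exact ⟨b, hb, by rw [hb']⟩
    · exact ⟨c, hc, by rw [hc']⟩
    · exact ⟨d, hd, by rw [hd']⟩
  obtain ⟨s, hs, rfl⟩ := hlift u hu
  obtain ⟨t, ht, rfl⟩ := hlift v hv
  obtain ⟨w, hw, hstw⟩ := hlift _ huv
  rw [Prod.mk_add_mk, Prod.mk.injEq] at hstw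
  exact hA s hs t ht w hw (hinj (by rw [map_add, hstw.1]) (by rw [map_add, hstw.2]))

theorem classified (n : ℕ) : Classified.{u} (5 ^ (n + 1)) := by
  induction n with
  | zero => exact classified_five
  | succ n ih =>
    intro V _ _ _ _ hV A hA hcard
    obtain ⟨v, h1, h2⟩ : ∃ v, v ∈ A ∧ -v ∈ A := by
      rcases n with _ | n
      -- In the plane the threshold is 28/5, that is six points.
      · exact exists_antipodal_plane hV hA (by omega)
      · have h1 : 5 ^ (n + 1 + 1) = 25 * 5 ^ n := by ring
        have h2 : 5 ^ (n + 1 + 1 + 1) = 125 * 5 ^ n := by ring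
        rw [h1] at ih
        exact ih.exists_antipodal (by rw [hV, h2]) hA (by omega)
    have h3 : 5 ^ (n + 1) = 5 * 5 ^ n := by ring
    have h4 : 5 ^ (n + 1 + 1) = 25 * 5 ^ n := by ring
    rw [h3] at ih
    exact ih.of_antipodal (by rw [hV, h4]) hA (by omega) h1 h2

end Classification

/-! ### Bounds for sf₀ and sf₁ from their definitions -/

section Extremal

variable {G : Type*} [AddCommGroup G] [Fintype G] {m : ℕ}

open Classical in
theorem sf0_le (h : ∀ A : Finset G, IsSumFree A → #A ≤ m) : sf0 G ≤ m :=
  Finset.sup_le fun A hA => h A (Finset.mem_filter.1 hA).2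

open Classical in
theorem IsSumFree.card_le_sf0 {A : Finset G} (hA : IsSumFree A) : #A ≤ sf0 G :=
  Finset.le_sup (f := Finset.card) (Finset.mem_filter.2 ⟨Finset.mem_univ _, hA⟩)

open Classical in
theorem sf1_le (h : ∀ A : Finset G, IsSumFree A →
    (∀ B : Finset G, IsMaximumSumFree B → ¬ A ⊆ B) → #A ≤ m) : sf1 G ≤ m :=
  Finset.sup_le fun A hA => h A (Finset.mem_filter.1 hA).2.1 (Finset.mem_filter.1 hA).2.2

open Classical in
theorem IsSumFree.card_le_sf1 {A : Finset G} (hA : IsSumFree A)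
    (h : ∀ B : Finset G, IsMaximumSumFree B → ¬ A ⊆ B) : #A ≤ sf1 G :=
  Finset.le_sup (f := Finset.card) (Finset.mem_filter.2 ⟨Finset.mem_univ _, hA, h⟩)

end Extremal

/-! ### Translation to 𝔽₅ⁿ and the values of sf₀ and sf₁ -/

section Coordinates

variable {n : ℕ}

theorem NormalSet.isNormal {A : Finset (Fin n → ZMod 5)} (h : NormalSet A) (hA : A.Nonempty) :
    IsNormal A := by
  obtain ⟨χ, hχ⟩ := h
  obtain ⟨a₀, ha₀⟩ := hA
  have h0 : χ ≠ 0 := by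
    rintro rfl
    rcases hχ a₀ ha₀ with h | h <;> rw [LinearMap.zero_apply] at h <;> exact absurd h (by decide)
  obtain ⟨v, hv⟩ := LinearMap.surjective (f := χ) h0 1
  refine ⟨AffineSubspace.mk' v (LinearMap.ker χ), ⟨⟨v, AffineSubspace.self_mem_mk' _ _⟩, ?_⟩, ?_, ?_⟩
  · rw [AffineSubspace.direction_mk']
    have := Module.Dual.finrank_ker_add_one_of_ne_zero (K := ZMod 5) (f := χ) h0
    rw [this, Module.finrank_fin_fun]
  · rw [AffineSubspace.mem_mk', vsub_eq_sub, zero_sub, LinearMap.mem_ker, map_neg, hv]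
    decide
  · intro a ha
    simp only [AffineSubspace.mem_mk', vsub_eq_sub, LinearMap.mem_ker, map_sub, map_neg, hv]
    rcases hχ a ha with h | h <;> rw [h]
    · exact Or.inl (sub_self 1)
    · exact Or.inr (by ring)

/-- The projection to the first three coordinates. -/
def headProj (hn : 3 ≤ n) : (Fin n → ZMod 5) →ₗ[ZMod 5] (Fin 3 → ZMod 5) :=
  LinearMap.funLeft (ZMod 5) (ZMod 5) (Fin.castLE hn)

theorem headProj_surjective (hn : 3 ≤ n) : Function.Surjective (headProj hn) :=
  LinearMap.funLeft_surjective_of_injective _ _ _ (Fin.castLE_injective hn)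

/-- The kernels of φ and π have equal dimension: e identifies them, and carries a complement of ker
π over by a section of φ. -/
theorem exists_equiv_comp_eq {K V W : Type*} [Field K] [AddCommGroup V] [Module K V]
    [FiniteDimensional K V] [AddCommGroup W] [Module K W] {φ π : V →ₗ[K] W}
    (hφ : Function.Surjective φ) (hπ : Function.Surjective π) :
    ∃ e : V ≃ₗ[K] V, ∀ v, φ (e v) = π v := by
  obtain ⟨s, hs⟩ := φ.exists_rightInverse_of_surjective (LinearMap.range_eq_top.2 hφ)
  obtain ⟨p, hp⟩ := (LinearMap.ker π).subtype.exists_leftInverse_of_injective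
    (Submodule.ker_subtype _)
  have hdim : Module.finrank K (LinearMap.ker π) = Module.finrank K (LinearMap.ker φ) := by
    have h1 := φ.finrank_range_add_finrank_ker
    have h2 := π.finrank_range_add_finrank_ker
    rw [LinearMap.range_eq_top.2 hφ] at h1
    rw [LinearMap.range_eq_top.2 hπ] at h2
    omega
  let g := LinearEquiv.ofFinrankEq _ _ hdim
  let f : V →ₗ[K] V := s ∘ₗ π + (LinearMap.ker φ).subtype ∘ₗ g.toLinearMap ∘ₗ p
  have hf : ∀ v, f v = s (π v) + g (p v) := fun v => rfl
  have hφf : ∀ v, φ (f v) = π v := by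
    intro v
    rw [hf, map_add, LinearMap.mem_ker.1 (g (p v)).2, add_zero]
    exact LinearMap.congr_fun hs (π v)
  have hinj : Function.Injective f := by
    rw [injective_iff_map_eq_zero]
    intro v hv
    have h0 : π v = 0 := by rw [← hφf, hv, map_zero]
    have h1 : p v = ⟨v, h0⟩ := LinearMap.congr_fun hp ⟨v, h0⟩
    rw [hf, h0, map_zero, zero_add, Submodule.coe_eq_zero, LinearEquiv.map_eq_zero_iff, h1] at hv
    exact congrArg Subtype.val hv
  exact ⟨LinearEquiv.ofInjectiveEndo f hinj, hφf⟩

theorem VLPreimage.isVLSet (hn : 3 ≤ n) {A : Finset (Fin n → ZMod 5)} (h : VLPreimage A) :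
    IsVLSet hn A := by
  obtain ⟨φ, hφ, hA⟩ := h
  obtain ⟨e, he⟩ := exists_equiv_comp_eq hφ (headProj_surjective hn)
  refine ⟨e, Set.ext fun a => ?_⟩
  obtain ⟨v, rfl⟩ := e.surjective a
  rw [e.injective.mem_set_image, Finset.mem_coe, hA, he]
  rfl

theorem classification {A : Finset (Fin (n + 3) → ZMod 5)} (hA : IsSumFree A)
    (h : 28 * 5 ^ n ≤ #A) : NormalSet A ∨ VLPreimage A := by
  refine classified (n + 2) _ (by simp) A hA ?_
  have : 5 ^ (n + 2 + 1) = 125 * 5 ^ n := by ring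
  omega

theorem VLPreimage.card_fin {A : Finset (Fin (n + 3) → ZMod 5)} (h : VLPreimage A) :
    #A = 28 * 5 ^ n := by
  have h1 := h.card
  rw [Fintype.card_fun, ZMod.card, Fintype.card_fin] at h1
  have : 5 ^ (n + 3) = 125 * 5 ^ n := by ring
  omega

theorem normalSet_of_lt {A : Finset (Fin (n + 3) → ZMod 5)} (hA : IsSumFree A)
    (h : 28 * 5 ^ n < #A) : NormalSet A := by
  rcases classification hA h.le with h' | h'
  · exact h'
  · have := h'.card_fin
    omega

/-- The union of the two hyperplanes `χ = ± 1`. -/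
def slab (χ : (Fin n → ZMod 5) →ₗ[ZMod 5] ZMod 5) : Finset (Fin n → ZMod 5) :=
  univ.filter fun v => χ v = 1 ∨ χ v = -1

theorem slab_isSumFree (χ : (Fin n → ZMod 5) →ₗ[ZMod 5] ZMod 5) : IsSumFree (slab χ) := by
  intro x hx y hy z hz hxy
  rw [slab, Finset.mem_filter_univ] at hx hy hz
  rw [← hxy, map_add] at hz
  revert hx hy hz
  generalize χ x = s
  generalize χ y = t
  revert s t
  decide

theorem card_slab {χ : (Fin (n + 3) → ZMod 5) →ₗ[ZMod 5] ZMod 5} (hχ : χ ≠ 0) :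
    #(slab χ) = 50 * 5 ^ n := by
  rw [slab, Finset.filter_or, Finset.card_union_of_disjoint]
  · have h1 := card_fiber_one hχ 1
    have h2 := card_fiber_one hχ (-1)
    rw [Fintype.card_fun, ZMod.card, Fintype.card_fin] at h1 h2
    have : 5 ^ (n + 3) = 125 * 5 ^ n := by ring
    omega
  · rw [Finset.disjoint_filter]
    intro v _ h
    rw [h]
    decide

theorem NormalSet.exists_subset_slab {A : Finset (Fin n → ZMod 5)} (h : NormalSet A)
    (hA : A.Nonempty) : ∃ χ, χ ≠ 0 ∧ A ⊆ slab χ := by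
  obtain ⟨χ, hχ⟩ := h
  obtain ⟨a₀, ha₀⟩ := hA
  refine ⟨χ, ?_, fun a ha => by rw [slab, Finset.mem_filter_univ]; exact hχ a ha⟩
  rintro rfl
  rcases hχ a₀ ha₀ with h | h <;> rw [LinearMap.zero_apply] at h <;> exact absurd h (by decide)

theorem sf0_eq (n : ℕ) : sf0 (Fin (n + 3) → ZMod 5) = 50 * 5 ^ n := by
  apply le_antisymm
  · refine sf0_le fun A hA => ?_
    by_contra! hlt
    obtain ⟨χ, hχ, hsub⟩ := (normalSet_of_lt hA (by omega)).exists_subset_slab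
      (Finset.card_pos.1 (by omega))
    have := Finset.card_le_card hsub
    rw [card_slab hχ] at this
    omega
  · have hχ : LinearMap.proj (R := ZMod 5) (φ := fun _ : Fin (n + 3) => ZMod 5) 0 ≠ 0 := fun h =>
      absurd (LinearMap.congr_fun h (fun _ => 1)) (by
        rw [LinearMap.proj_apply, LinearMap.zero_apply]
        decide)
    rw [← card_slab hχ]
    exact (slab_isSumFree _).card_le_sf0

/-- Above 28 · 5ⁿ a sum-free set is normal and lies in a slab, a maximum sum-free set. Conversely, a
maximum sum-free set has 50 · 5ⁿ elements and is normal, so it cannot contain the non-normal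
cylinder over Λ. -/
theorem sf1_eq (n : ℕ) : sf1 (Fin (n + 3) → ZMod 5) = 28 * 5 ^ n := by
  classical
  have hpos : 0 < 5 ^ n := by positivity
  apply le_antisymm
  · refine sf1_le fun A hA hmax => ?_
    by_contra! hlt
    obtain ⟨χ, hχ, hsub⟩ := (normalSet_of_lt hA hlt).exists_subset_slab
      (Finset.card_pos.1 (by omega))
    exact hmax _ ⟨slab_isSumFree χ, by rw [card_slab hχ, sf0_eq]⟩ hsub
  · have hn : 3 ≤ n + 3 := by omega
    have hL : VLPreimage (univ.filter (· ∈ LamCylinder hn)) :=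
      ⟨headProj hn, headProj_surjective hn, fun v => Finset.mem_filter_univ v⟩
    rw [← hL.card_fin]
    refine hL.isSumFree.card_le_sf1 fun B hB hsub => hL.not_normalSet ?_
    have hcard := hB.2
    rw [sf0_eq] at hcard
    obtain ⟨χ, hχ⟩ := normalSet_of_lt hB.1 (by omega)
    exact ⟨χ, fun a ha => hχ a (hsub ha)⟩

end Coordinates

end SumFreeSets

theorem theorem1p2 (n : ℕ) (hn : 3 ≤ n) :
    SumFreeSets.sf1 (Fin n → ZMod 5) = 28 * 5 ^ (n - 3) ∧
      ∀ A : Finset (Fin n → ZMod 5), SumFreeSets.IsSumFree A →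
        28 * 5 ^ (n - 3) ≤ A.card →
          SumFreeSets.IsNormal A ∨ SumFreeSets.IsVLSet hn A := by
  obtain ⟨m, rfl⟩ : ∃ m, n = m + 3 := ⟨n - 3, by omega⟩
  rw [Nat.add_sub_cancel]
  refine ⟨SumFreeSets.sf1_eq m, fun A hA hcard => ?_⟩
  have hpos : 0 < 5 ^ m := by positivity
  rcases SumFreeSets.classification hA hcard with h | h
  · exact Or.inl (h.isNormal (Finset.card_pos.1 (by omega)))
  · exact Or.inr (h.isVLSet hn)
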